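/- Let $d\ge 1$ and let $X$ be a random vector in $\mathbb{R}^d$ with a differentiable probability density $p_{\mathrm x}$ for which the entropy $H(X)=-\int p_{\mathrm x}\log p_{\mathrm x}$ exists (the integrand is Lebesgue integrable). For every $N$ let $S=\{s^{(i)}\}_{i=1}^N$ be i.i.d. training samples from $p_{\mathrm x}$ and let $f=f_S$ be the uniformizing map (UM) constructed from $S$: a bijection from $\mathbb{R}^d$ onto $(0,1)^d$ such that $f$, $f^{-1}$ and $|\det \partial f/\partial x|$ are differentiable, and such that $f_S(x)$ is jointly measurable in $(S,x)$. Let $$p_{\mathrm z}^S(z)=p_{\mathrm x}(f^{-1}(z))\,\Big|\det\frac{\partial f^{-1}(z)}{\partial z}\Big|$$ be the density of $Z=f(X)$, and let $C_2^N=\sup_{z\in(0,1)^d}\|\nabla p_{\mathrm z}^S(z)\|_1$. Assume that $C_2^N\to0$ in probability as $N\to\infty$, and that there are a positive integer $M$ and a real $0<\bar C<1$ with $C_2^N\le\bar C$ a.s. for all $N>M$. For $k\ge1$ and $N>k$ let $x^{(1)},\dots,x^{(N)}$ be i.i.d. samples from $p_{\mathrm x}$, independent of $S$; put $z^{(i)}=f(x^{(i)})$,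 let $\epsilon_i$ be twice the maximum-norm distance from $z^{(i)}$ to its $k$-th nearest neighbour among the other $z^{(l)}$, let $\xi_{i,j}=\min\{z^{(i)}_j+\epsilon_i/2,1\}-\max\{z^{(i)}_j-\epsilon_i/2,0\}$, and define, with $\psi=\Gamma'/\Gamma$, the UM-tKL estimator $$\widehat H=-\psi(k)+\psi(N)+\frac1N\sum_{i=1}^N\sum_{j=1}^d\log\xi_{i,j}+\frac1N\sum_{i=1}^N\log\Big|\det\frac{\partial f^{-1}(z^{(i)})}{\partial z}\Big| .$$ Then there are real sequences $(C^N)$ and $(D^N)$, not depending on $k$, with $C^N\to0$ and $D^N\to0$ as $N\to\infty$, such that for every $k\ge1$: (i) for all $N>\max(M,k)$ the estimator $\widehat H$ is integrable and $$\big|\mathbb{E}[\widehat H]-H(X)\big|\le C^N\Big(\frac kN\Big)^{1/d};$$ (ii) if moreover $\mathbb{E}[(\log p_{\mathrm x}(X))^2]<\infty$, then there is a constant $C_1>0$ (depending on $k$ but not on $N$) such that for all $N>\max(M,k)$ the squared error $(\widehat H-H(X))^2$ is integrable and $$\mathbb{E}\big[(\widehat H-H(X))^2\big]\le C_1\frac1N+D^N\Big(\frac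 kN\Big)^{2/d}.$$ Here the expectations are over both the training samples $S$ and the samples $x^{(i)}$. -/

import Mathlib

open MeasureTheory Filter Topology
open scoped ENNReal

noncomputable section

/-- The open unit cube `(0,1)^d`, the interior of `[0,1]^d`.  Points of `ℝ^d` are functions
`Fin d → ℝ`, whose norm and distance in Mathlib are those of the maximum norm. -/
def openCube (d : ℕ) : Set (Fin d → ℝ) := {z | ∀ j, z j ∈ Set.Ioo (0 : ℝ) 1}

/-- The law on `ℝ^d` with Lebesgue density `p`. -/
def densityLaw {d : ℕ} (p : (Fin d → ℝ) → ℝ) : Measure (Fin d → ℝ) :=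
  volume.withDensity (fun x => ENNReal.ofReal (p x))

/-- The law of `N` i.i.d. samples from the density `p`. -/
def sampleLaw {d : ℕ} (p : (Fin d → ℝ) → ℝ) (N : ℕ) : Measure (Fin N → Fin d → ℝ) :=
  Measure.pi (fun _ => densityLaw p)

/-- The differential entropy `H(X) = - ∫ p log p` of a random variable with density `p`. -/
def entropy {d : ℕ} (p : (Fin d → ℝ) → ℝ) : ℝ := - ∫ x, p x * Real.log (p x)

/-- The digamma function `ψ = Γ' / Γ`. -/
def digamma (x : ℝ) : ℝ := deriv Real.Gamma x / Real.Gamma x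

/-- A map `f` from `ℝ^d` onto the open unit cube that is bijective and differentiable, has a
differentiable inverse, and whose Jacobian factor `|det Df|` is differentiable.  The values of
`inv` outside of the cube are irrelevant. -/
structure CubeMap (d : ℕ) where
  /-- the map `f` -/
  map : (Fin d → ℝ) → (Fin d → ℝ)
  /-- the inverse of `f`, on the open cube -/
  inv : (Fin d → ℝ) → (Fin d → ℝ)
  map_mem : ∀ x, map x ∈ openCube d
  inv_map : ∀ x, inv (map x) = x
  map_inv : ∀ z ∈ openCube d, map (inv z) = z
  differentiable_map : Differentiable ℝ map
  differentiableOn_inv : DifferentiableOn ℝ inv (openCube d)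
  differentiable_jacobian : Differentiable ℝ (fun x => |(fderiv ℝ map x).det|)

/-- The density of `Z = f(X)` when `X` has density `p`:
`p_z(z) = p(f⁻¹(z)) |det ∂f⁻¹(z)/∂z|` on the open cube, and `0` elsewhere. -/
def pushDensity {d : ℕ} (p : (Fin d → ℝ) → ℝ) (f : CubeMap d) : (Fin d → ℝ) → ℝ :=
  (openCube d).indicator (fun z => p (f.inv z) * |(fderiv ℝ f.inv z).det|)

/-- `sup_{z ∈ (0,1)^d} ‖∇ q(z)‖₁`, as an element of `[0,∞]`. -/
def gradSup {d : ℕ} (q : (Fin d → ℝ) → ℝ) : ℝ≥0∞ :=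
  ⨆ z ∈ openCube d, ENNReal.ofReal (∑ j, |fderiv ℝ q z (Pi.single j 1)|)

/-- `ε_i`: twice the maximum-norm distance from the `i`-th point to its `k`-th nearest neighbour
among the other points of the sample (that is, twice the radius of the smallest closed ball around
the `i`-th point that contains at least `k` of the other points). -/
def knnEps {d N : ℕ} (k : ℕ) (z : Fin N → Fin d → ℝ) (i : Fin N) : ℝ :=
  2 * sInf {r : ℝ | k ≤ (Finset.univ.filter (fun l => l ≠ i ∧ dist (z i) (z l) ≤ r)).card}

/-- `ξ_{i,j}`: the `j`-th side length of the `i`-th `k`-NN cell truncated to the unit cube. -/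
def truncSide {d N : ℕ} (k : ℕ) (z : Fin N → Fin d → ℝ) (i : Fin N) (j : Fin d) : ℝ :=
  min (z i j + knnEps k z i / 2) 1 - max (z i j - knnEps k z i / 2) 0

/-- The truncated Kozachenko-Leonenko estimator
`- ψ(k) + ψ(N) + N⁻¹ ∑_i ∑_j log ξ_{i,j}` on a sample in the unit cube. -/
def tKL {d N : ℕ} (k : ℕ) (z : Fin N → Fin d → ℝ) : ℝ :=
  - digamma k + digamma N + (1 / (N : ℝ)) * ∑ i, ∑ j, Real.log (truncSide k z i j)

/-- The UM-tKL estimator of `H(X)` with uniformizing map `f`, from the sample `x`: the truncated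
Kozachenko-Leonenko estimator on the transformed sample `z_i = f(x_i)`, corrected by
`N⁻¹ ∑_i log |det ∂f⁻¹(z_i)/∂z|`. -/
def umTKL {d N : ℕ} (k : ℕ) (f : CubeMap d) (x : Fin N → Fin d → ℝ) : ℝ :=
  tKL k (fun i => f.map (x i))
    + (1 / (N : ℝ)) * ∑ i, Real.log |(fderiv ℝ f.inv (f.map (x i))).det|

/-- The assumption on the uniformizing maps: `UM N S` is the map constructed from the `N` training
samples `S`, and `C₂^N = sup ‖∇ p_z^S‖₁`.  Then `C₂^N → 0` in probability, and
`C₂^N ≤ Cbar < 1` almost surely for every `N > M`. -/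
structure UMAssumption {d : ℕ} (p : (Fin d → ℝ) → ℝ)
    (UM : ∀ N : ℕ, (Fin N → Fin d → ℝ) → CubeMap d) (M : ℕ) (Cbar : ℝ) : Prop where
  tendsto_inProbability : ∀ ε : ℝ≥0∞, 0 < ε →
    Tendsto (fun N => sampleLaw p N {S | ε ≤ gradSup (pushDensity p (UM N S))}) atTop (𝓝 0)
  Cbar_pos : 0 < Cbar
  Cbar_lt_one : Cbar < 1
  ae_le : ∀ N > M, ∀ᵐ S ∂(sampleLaw p N),
    gradSup (pushDensity p (UM N S)) ≤ ENNReal.ofReal Cbar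

end

/-! Fix the training sample `S`. The map `f` carries the law of `X` to a density `q` on the open
cube whose gradient has ℓ¹-norm at most `L = C₂^N ≤ Cbar < 1`. By duality with the maximum norm `q`
is `L`-Lipschitz. The cube has volume one and diameter at most one, so `q` takes values in `[1 -
Cbar, 1 + Cbar]`; this is `IsNearUniform`. Along the sample, `log |det ∂f⁻¹| = log q(f x) - log p
x`, so the empirical mean of this term converts an estimate of the entropy of `q` into one of the
entropy of `p`.

Bias. Given one point `z`, let `R` be the distance to the `k`-th nearest of the other `n = N - 1`
points, `U` the mass of the ball of radius `R`, and `V` the volume of the truncated cell. Distances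
from `z` have no atoms, so `U` is distributed as the `k`-th smallest of `n` uniform variables and `E
log U = ψ(k) - ψ(N)` exactly. The truncated cell is the ball cut by the cube, hence `U / V` is an
average of `q` over the cell and `|log U - log V - log q(z)| ≤ L R / (1 - Cbar)`. Jensen's
inequality with `(1 - Cbar) R^d ≤ U` and `E U = k / N` bounds `E R` by a constant times
`(k/N)^(1/d)`. The factor `L` is what later tends to zero.

Variance. The Efron–Stein inequality `evariance_pi_le` compares the estimator with its leave-one-out
versions. Deleting a point changes only the cells of those points that have it among their `k`
nearest neighbours. There are at most `k * 2 ^ d` of them (`card_filter_isNearNeighbour_le`), and a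
changed cell stays between the `k`-NN and the `(k+1)`-NN cell. Since `log (N V)` has second moments
bounded uniformly in `N`, the variance is `O(1/N)`.

Averaging over `S`. The bounds depend on `S` only through `L`, linearly for the bias and through `L²
≤ L` for its square. Thus `C^N` and `D^N` are constants times the mean of `min C₂^N 1`, which
vanishes because `C₂^N → 0` in probability. Measurability of `C₂^N` in `S` is not assumed, so this
mean is a lower integral. -/

noncomputable section

/-! ### Order statistics and the combinatorics of nearest neighbours -/

section KthSmallest

variable {ι : Type*}

/-- The `k`-th smallest value of `v` on the finite set `s`. -/
def kthSmallest (s : Finset ι) (k : ℕ) (v : ι → ℝ) : ℝ :=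
  sInf {r : ℝ | k ≤ (s.filter (fun l => v l ≤ r)).card}

/-- The set in the definition is a ray `Set.Ici (v l)`: take `l` minimising `v` among the indices
with at least `k` values not above theirs. So the infimum is attained. The bounds on `k` exclude the
whole line (`k = 0`) and the empty set (`k > s.card`), where `sInf` has its default value. -/
theorem kthSmallest_spec {s : Finset ι} {k : ℕ} (v : ι → ℝ) (hk : 1 ≤ k) (hs : k ≤ s.card) :
    (∃ l ∈ s, kthSmallest s k v = v l) ∧
      ∀ r, k ≤ (s.filter (fun l => v l ≤ r)).card ↔ kthSmallest s k v ≤ r := by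
  set A := s.filter (fun l => k ≤ (s.filter (fun m => v m ≤ v l)).card) with hA
  have hsne : s.Nonempty := Finset.card_pos.1 (by omega)
  have hAne : A.Nonempty := by
    obtain ⟨l, hl, hmax⟩ := s.exists_max_image v hsne
    refine ⟨l, Finset.mem_filter.2 ⟨hl, ?_⟩⟩
    rwa [Finset.filter_true_of_mem hmax]
  obtain ⟨l, hl, hmin⟩ := A.exists_min_image v hAne
  have hset : {r : ℝ | k ≤ (s.filter (fun l => v l ≤ r)).card} = Set.Ici (v l) := by
    ext r
    simp only [Set.mem_ofPred_eq, Set.mem_Ici]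
    constructor
    · intro h
      have hne : (s.filter (fun l => v l ≤ r)).Nonempty := Finset.card_pos.1 (by omega)
      obtain ⟨m, hm, hmmax⟩ := Finset.exists_max_image _ v hne
      rw [Finset.mem_filter] at hm
      have hmA : m ∈ A := by
        refine Finset.mem_filter.2 ⟨hm.1, h.trans (Finset.card_le_card ?_)⟩
        intro x hx
        exact Finset.mem_filter.2 ⟨(Finset.mem_filter.1 hx).1, hmmax x hx⟩
      exact (hmin m hmA).trans hm.2
    · intro h
      refine (Finset.mem_filter.1 hl).2.trans (Finset.card_le_card ?_)
      intro x hx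
      rw [Finset.mem_filter] at hx ⊢
      exact ⟨hx.1, hx.2.trans h⟩
  have hval : kthSmallest s k v = v l := by rw [kthSmallest, hset, csInf_Ici]
  refine ⟨⟨l, (Finset.mem_filter.1 hl).1, hval⟩, fun r => ?_⟩
  rw [hval]
  exact Set.ext_iff.1 hset r

theorem kthSmallest_le_iff {s : Finset ι} {k : ℕ} {v : ι → ℝ} (hk : 1 ≤ k) (hs : k ≤ s.card)
    {r : ℝ} : kthSmallest s k v ≤ r ↔ k ≤ (s.filter (fun l => v l ≤ r)).card :=
  ((kthSmallest_spec v hk hs).2 r).symm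

theorem exists_kthSmallest_eq {s : Finset ι} {k : ℕ} (v : ι → ℝ) (hk : 1 ≤ k)
    (hs : k ≤ s.card) : ∃ l ∈ s, kthSmallest s k v = v l :=
  (kthSmallest_spec v hk hs).1

/-- Since the order statistic is one of the values of `v`, no continuity or strictness of `F` is
needed. It is applied with `F` a distribution function, which may be flat. -/
theorem kthSmallest_monotone_comp {s : Finset ι} {k : ℕ} (v : ι → ℝ) (hk : 1 ≤ k)
    (hs : k ≤ s.card) {F : ℝ → ℝ} (hF : Monotone F) :
    F (kthSmallest s k v) = kthSmallest s k (fun l => F (v l)) := by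
  apply le_antisymm
  · obtain ⟨m, hm, hmv⟩ := exists_kthSmallest_eq (fun l => F (v l)) hk hs
    by_contra! hlt
    have h1 : k ≤ (s.filter (fun l => F (v l) ≤ F (v m))).card := by
      rw [← hmv]; exact (kthSmallest_le_iff hk hs).1 le_rfl
    have hne : (s.filter (fun l => F (v l) ≤ F (v m))).Nonempty := Finset.card_pos.1 (by omega)
    obtain ⟨a, ha, hamax⟩ := Finset.exists_max_image _ v hne
    rw [Finset.mem_filter] at ha
    have h2 : kthSmallest s k v ≤ v a := by
      rw [kthSmallest_le_iff hk hs]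
      refine h1.trans (Finset.card_le_card fun x hx => ?_)
      exact Finset.mem_filter.2 ⟨(Finset.mem_filter.1 hx).1, hamax x hx⟩
    have h3 := (hF h2).trans ha.2
    rw [hmv] at hlt
    linarith
  · rw [kthSmallest_le_iff hk hs]
    refine ((kthSmallest_le_iff (v := v) hk hs).1 le_rfl).trans (Finset.card_le_card ?_)
    intro x hx
    rw [Finset.mem_filter] at hx ⊢
    exact ⟨hx.1, hF hx.2⟩

variable [DecidableEq ι]

theorem kthSmallest_le_erase {s : Finset ι} {k : ℕ} (v : ι → ℝ) (hk : 1 ≤ k)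
    (hs : k + 1 ≤ s.card) (j : ι) : kthSmallest s k v ≤ kthSmallest (s.erase j) k v := by
  have h1 : k ≤ (s.erase j).card := by have := Finset.pred_card_le_card_erase (s := s) (a := j); omega
  rw [kthSmallest_le_iff hk (by omega)]
  refine ((kthSmallest_le_iff (v := v) hk h1).1 le_rfl).trans (Finset.card_le_card ?_)
  exact Finset.filter_subset_filter _ (Finset.erase_subset _ _)

theorem kthSmallest_erase_le_succ {s : Finset ι} {k : ℕ} (v : ι → ℝ) (hk : 1 ≤ k)
    (hs : k + 1 ≤ s.card) (j : ι) :
    kthSmallest (s.erase j) k v ≤ kthSmallest s (k + 1) v := by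
  have h1 : k ≤ (s.erase j).card := by have := Finset.pred_card_le_card_erase (s := s) (a := j); omega
  rw [kthSmallest_le_iff hk h1, Finset.filter_erase]
  have h2 := (kthSmallest_le_iff (v := v) (r := kthSmallest s (k + 1) v) (by omega) hs).1 le_rfl
  have := Finset.pred_card_le_card_erase
    (s := s.filter (fun l => v l ≤ kthSmallest s (k + 1) v)) (a := j)
  omega

/-- Either the `k`-th smallest value is at least `v j`, and the `k` other indices not above `j`
witness it without `j`; or `j` lies strictly above it and was never counted. -/
theorem kthSmallest_erase_eq {s : Finset ι} {k : ℕ} (v : ι → ℝ) (hk : 1 ≤ k)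
    (hs : k + 1 ≤ s.card) (j : ι)
    (hj : k ≤ ((s.erase j).filter (fun l => v l ≤ v j)).card) :
    kthSmallest (s.erase j) k v = kthSmallest s k v := by
  have h1 : k ≤ (s.erase j).card := by have := Finset.pred_card_le_card_erase (s := s) (a := j); omega
  apply le_antisymm _ (kthSmallest_le_erase v hk hs j)
  rw [kthSmallest_le_iff hk h1]
  by_cases h : v j ≤ kthSmallest s k v
  · refine hj.trans (Finset.card_le_card fun x hx => ?_)
    rw [Finset.mem_filter] at hx ⊢
    exact ⟨hx.1, hx.2.trans h⟩
  · refine ((kthSmallest_le_iff (s := s) (v := v) hk (by omega)).1 le_rfl).trans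
      (Finset.card_le_card fun x hx => ?_)
    rw [Finset.mem_filter] at hx ⊢
    refine ⟨Finset.mem_erase.2 ⟨fun hxj => h (hxj ▸ hx.2), hx.1⟩, hx.2⟩

/-- At most `k` indices have fewer than `k` others not above them. -/
theorem card_filter_rank_lt_le (s : Finset ι) (k : ℕ) (v : ι → ℝ) :
    (s.filter (fun j => ((s.erase j).filter (fun l => v l ≤ v j)).card < k)).card ≤ k := by
  set A := s.filter (fun j => ((s.erase j).filter (fun l => v l ≤ v j)).card < k) with hA
  rcases A.eq_empty_or_nonempty with h | h
  · simp [h]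
  -- At a maximiser of `v` on `A` every other element of `A` is counted, whence `A.card - 1 < k`,
  -- ties included.
  obtain ⟨j, hj, hmax⟩ := A.exists_max_image v h
  have h1 : A.erase j ⊆ (s.erase j).filter (fun l => v l ≤ v j) := by
    intro x hx
    rw [Finset.mem_erase] at hx
    exact Finset.mem_filter.2
      ⟨Finset.mem_erase.2 ⟨hx.1, (Finset.mem_filter.1 hx.2).1⟩, hmax x hx.2⟩
  have h2 := Finset.card_le_card h1
  have h3 := (Finset.mem_filter.1 hj).2
  rw [Finset.card_erase_of_mem hj] at h2
  omega

/-- A point of `ℝ^d` is among the `k` nearest neighbours of at most `2 ^ d * k` other points. -/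
theorem card_filter_isNearNeighbour_le [Fintype ι] {d : ℕ} (k : ℕ) (z : ι → Fin d → ℝ) (j : ι) :
    ((Finset.univ.erase j).filter (fun i =>
      (((Finset.univ.erase i).erase j).filter
        (fun l => dist (z i) (z l) ≤ dist (z i) (z j))).card < k)).card ≤ k * 2 ^ d := by
  set A := (Finset.univ.erase j).filter (fun i =>
      (((Finset.univ.erase i).erase j).filter
        (fun l => dist (z i) (z l) ≤ dist (z i) (z j))).card < k) with hA
  -- Sort the points into the `2 ^ d` orthants around `z j` by the signs of their offsets. Each
  -- orthant contributes at most `k`, by ranking its points according to their distance to `z j`.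
  have key := Finset.card_le_mul_card_image_of_maps_to (s := A)
    (t := (Finset.univ : Finset (Fin d → Bool)))
    (f := fun i c => decide (z j c ≤ z i c)) (fun _ _ => Finset.mem_univ _) k ?_
  · simpa using key
  intro σ _
  set B := A.filter (fun i => (fun c => decide (z j c ≤ z i c)) = σ) with hB
  refine le_trans (Finset.card_le_card ?_) (card_filter_rank_lt_le B k (fun i => dist (z i) (z j)))
  intro i hi
  refine Finset.mem_filter.2 ⟨hi, ?_⟩
  have hiB := Finset.mem_filter.1 hi
  refine lt_of_le_of_lt (Finset.card_le_card ?_) (Finset.mem_filter.1 hiB.1).2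
  intro l hl
  rw [Finset.mem_filter, Finset.mem_erase] at hl
  have hlB := Finset.mem_filter.1 hl.1.2
  refine Finset.mem_filter.2 ⟨?_, ?_⟩
  · have := (Finset.mem_filter.1 hlB.1).1
    simp only [Finset.mem_erase, Finset.mem_univ, and_true] at this ⊢
    exact ⟨this, hl.1.1⟩
  -- Within an orthant the offsets of `z i` and `z l` from `z j` have equal sign in each coordinate
  -- and size at most `dist (z i) (z j)`, hence so does their difference. This uses the maximum
  -- norm.
  · rw [dist_pi_le_iff dist_nonneg]
    intro c
    have h1 := dist_le_pi_dist (z l) (z j) c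
    have h2 := dist_le_pi_dist (z i) (z j) c
    have h4 := hl.2
    have h3 : decide (z j c ≤ z i c) = decide (z j c ≤ z l c) := by
      rw [congrFun hiB.2 c, congrFun hlB.2 c]
    rw [decide_eq_decide] at h3
    rw [Real.dist_eq] at h1 h2 ⊢
    rw [abs_le] at *
    by_cases hc : z j c ≤ z i c
    · have := h3.1 hc
      constructor <;> linarith
    · have : ¬ z j c ≤ z l c := fun h => hc (h3.2 h)
      constructor <;> linarith

end KthSmallest

/-! ### Binomial counts -/

section Binomial

variable {E : Type*} [MeasurableSpace E]

/-- The event is the disjoint union, over index sets `s` with at least `k` elements, of the boxes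
where exactly the coordinates in `s` fall in `A`. -/
theorem pi_count_mem_ge {ι : Type*} [Fintype ι] (ν : Measure E) [IsProbabilityMeasure ν]
    {A : Set E} [DecidablePred (· ∈ A)] (hA : MeasurableSet A) (k : ℕ) :
    (Measure.pi (fun _ : ι => ν)).real {y | k ≤ (Finset.univ.filter (fun l => y l ∈ A)).card} =
      ∑ j ∈ Finset.Icc k (Fintype.card ι),
        ((Fintype.card ι).choose j : ℝ) * (ν.real A ^ j * (1 - ν.real A) ^ (Fintype.card ι - j)) := by
  classical
  have hset : {y : ι → E | k ≤ (Finset.univ.filter (fun l => y l ∈ A)).card} =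
      ⋃ s ∈ (Finset.univ : Finset ι).powerset.filter (fun s => k ≤ s.card),
        Set.univ.pi (fun l => if l ∈ s then A else Aᶜ) := by
    ext y
    simp only [Set.mem_ofPred_eq, Set.mem_iUnion, Finset.mem_filter, Finset.mem_powerset,
      Finset.subset_univ, true_and, Set.mem_pi, Set.mem_univ, forall_const, exists_prop]
    constructor
    · intro h
      refine ⟨_, h, fun l => ?_⟩
      by_cases hl : y l ∈ A <;> simp [hl]
    · rintro ⟨s, hs, h⟩
      refine hs.trans (Finset.card_le_card fun l hl => ?_)
      have := h l
      rw [if_pos hl] at this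
      simpa using this
  have hmeas : ∀ s : Finset ι, MeasurableSet (Set.univ.pi (fun l => if l ∈ s then A else Aᶜ)) := by
    intro s
    refine MeasurableSet.univ_pi fun l => ?_
    split_ifs
    exacts [hA, hA.compl]
  rw [hset, measureReal_biUnion_finset]
  · have hval : ∀ s : Finset ι, (Measure.pi (fun _ : ι => ν)).real
        (Set.univ.pi (fun l => if l ∈ s then A else Aᶜ)) =
        ν.real A ^ s.card * (1 - ν.real A) ^ (Fintype.card ι - s.card) := by
      intro s
      rw [measureReal_def, Measure.pi_pi, ENNReal.toReal_prod]
      have : ∀ l, (ν (if l ∈ s then A else Aᶜ)).toReal = if l ∈ s then ν.real A else 1 - ν.real A := by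
        intro l
        split_ifs
        · rfl
        · rw [← measureReal_def, probReal_compl_eq_one_sub hA]
      simp_rw [this]
      rw [Finset.prod_ite, Finset.prod_const, Finset.prod_const]
      congr 2
      · congr 1; ext; simp
      · rw [← Finset.card_compl]; congr 1; ext; simp
    simp_rw [hval]
    rw [Finset.sum_filter, Finset.sum_powerset, Finset.card_univ]
    have : ∀ j ∈ Finset.range (Fintype.card ι + 1),
        (∑ t ∈ Finset.powersetCard j (Finset.univ : Finset ι),
          if k ≤ t.card then ν.real A ^ t.card * (1 - ν.real A) ^ (Fintype.card ι - t.card) else 0)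
        = if k ≤ j then ((Fintype.card ι).choose j : ℝ) *
          (ν.real A ^ j * (1 - ν.real A) ^ (Fintype.card ι - j)) else 0 := by
      intro j _
      rw [Finset.sum_congr rfl (g := fun _ => if k ≤ j then
        (ν.real A ^ j * (1 - ν.real A) ^ (Fintype.card ι - j)) else 0)]
      · rw [Finset.sum_const, Finset.card_powersetCard, Finset.card_univ]
        split_ifs <;> simp
      · intro t ht
        rw [(Finset.mem_powersetCard.1 ht).2]
    rw [Finset.sum_congr rfl this, ← Finset.sum_filter]
    congr 1
    ext j
    simp only [Finset.mem_filter, Finset.mem_range, Finset.mem_Icc]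
    omega
  · intro s _ t _ hst
    rw [Function.onFun, Set.disjoint_left]
    intro y hs ht
    apply hst
    ext l
    have h1 := hs l trivial
    have h2 := ht l trivial
    by_cases hl : y l ∈ A
    · by_cases h3 : l ∈ s <;> by_cases h4 : l ∈ t <;> simp_all
    · by_cases h3 : l ∈ s <;> by_cases h4 : l ∈ t <;> simp_all
  · intro s _; exact hmeas s

end Binomial

/-! ### Digamma at the integers -/

section Digamma

theorem digamma_add_one {x : ℝ} (hx : 0 < x) : digamma (x + 1) = digamma x + 1 / x := by
  have hne : ∀ m : ℕ, x ≠ -m := fun m h => by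
    have : (0 : ℝ) ≤ m := Nat.cast_nonneg m
    linarith
  have hd := (Real.differentiableAt_Gamma hne).hasDerivAt
  have h1 : HasDerivAt (fun y => y * Real.Gamma y) (1 * Real.Gamma x + x * deriv Real.Gamma x) x :=
    (hasDerivAt_id x).mul hd
  have h2 : (fun y => Real.Gamma (y + 1)) =ᶠ[𝓝 x] fun y => y * Real.Gamma y := by
    filter_upwards [lt_mem_nhds hx] with y hy
    exact Real.Gamma_add_one hy.ne'
  have h3 : deriv Real.Gamma (x + 1) = 1 * Real.Gamma x + x * deriv Real.Gamma x := by
    rw [← (h1.congr_of_eventuallyEq h2).deriv, deriv_comp_add_const]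
  have hG := (Real.Gamma_pos_of_pos hx).ne'
  rw [digamma, digamma, h3, Real.Gamma_add_one hx.ne']
  field_simp
  ring

/-- Telescopes the functional equation. The harmonic sum is what the mean of `-log` of a uniform
order statistic produces. -/
theorem digamma_nat_sub {k n : ℕ} (hk : 1 ≤ k) (hkn : k ≤ n) :
    digamma ((n : ℝ) + 1) - digamma k = ∑ j ∈ Finset.Icc k n, 1 / (j : ℝ) := by
  induction n, hkn using Nat.le_induction with
  | base =>
    rw [digamma_add_one (by exact_mod_cast hk)]; simp
  | succ n hn ih =>
    rw [Finset.sum_Icc_succ_top (by omega), ← ih, digamma_add_one (by positivity)]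
    push_cast
    ring

end Digamma

/-! ### Beta integrals -/

section Beta

theorem integral_pow_mul_one_sub_pow (a b : ℕ) :
    ∫ t in (0 : ℝ)..1, t ^ a * (1 - t) ^ b = (a.factorial * b.factorial : ℝ) / (a + b + 1).factorial := by
  induction b generalizing a with
  | zero =>
    simp only [pow_zero, mul_one, integral_pow, Nat.factorial_succ, add_zero, Nat.factorial_zero]
    have : (a.factorial : ℝ) ≠ 0 := by positivity
    push_cast
    field_simp
    simp
  | succ b ih =>
    have h1 : ∀ t : ℝ, t ^ a * (1 - t) ^ (b + 1) = t ^ a * (1 - t) ^ b - t ^ (a + 1) * (1 - t) ^ b :=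
      fun t => by ring
    simp_rw [h1]
    rw [intervalIntegral.integral_sub, ih, ih]
    · have e1 : (a + 1 + b + 1) = (a + b + 1) + 1 := by ring
      have e2 : (a + (b + 1) + 1) = (a + b + 1) + 1 := by ring
      rw [e1, e2, Nat.factorial_succ (a + b + 1), Nat.factorial_succ a, Nat.factorial_succ b]
      have : ((a + b + 1).factorial : ℝ) ≠ 0 := by positivity
      push_cast
      field_simp
      ring
    all_goals
      apply Continuous.intervalIntegrable
      fun_prop

theorem choose_mul_integral {n j : ℕ} (hj : j ≤ n) :
    (n.choose j : ℝ) * ∫ t in (0 : ℝ)..1, t ^ j * (1 - t) ^ (n - j) = 1 / (n + 1 : ℝ) := by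
  rw [integral_pow_mul_one_sub_pow, Nat.add_sub_cancel' hj, Nat.factorial_succ, Nat.cast_choose ℝ hj]
  have h1 : (n.factorial : ℝ) ≠ 0 := by positivity
  have h2 : (j.factorial : ℝ) ≠ 0 := by positivity
  have h3 : ((n - j).factorial : ℝ) ≠ 0 := by positivity
  push_cast
  field_simp

/-- The exponent is `j - 1` because the binomial tail will be integrated against `dt / t`. -/
theorem choose_mul_integral_pred {n j : ℕ} (hj0 : 1 ≤ j) (hj : j ≤ n) :
    (n.choose j : ℝ) * ∫ t in (0 : ℝ)..1, t ^ (j - 1) * (1 - t) ^ (n - j) = 1 / (j : ℝ) := by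
  rw [integral_pow_mul_one_sub_pow, show j - 1 + (n - j) + 1 = n by omega, Nat.cast_choose ℝ hj]
  obtain ⟨i, rfl⟩ := Nat.exists_eq_add_of_le' hj0
  rw [Nat.add_sub_cancel, Nat.factorial_succ i]
  have h1 : (n.factorial : ℝ) ≠ 0 := by positivity
  have h2 : (i.factorial : ℝ) ≠ 0 := by positivity
  have h3 : ((n - (i + 1)).factorial : ℝ) ≠ 0 := by positivity
  push_cast
  field_simp

end Beta

/-! ### Moments of uniform order statistics -/

section OrderStatistic

/-- The upper tail `P(Bin(n, t) ≥ k)` of the binomial distribution. -/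
def binomialTail (n k : ℕ) (t : ℝ) : ℝ :=
  ∑ j ∈ Finset.Icc k n, (n.choose j : ℝ) * (t ^ j * (1 - t) ^ (n - j))

/-- At least `k ≥ 1` successes include at least one, and `1 - (1 - t)^n ≤ n t` is Bernoulli's
inequality. -/
theorem binomialTail_le {n k : ℕ} (hk : 1 ≤ k) {t : ℝ} (ht0 : 0 ≤ t) (ht1 : t ≤ 1) :
    binomialTail n k t ≤ n * t := by
  have h1 : ∑ j ∈ Finset.range (n + 1), (n.choose j : ℝ) * (t ^ j * (1 - t) ^ (n - j)) = 1 := by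
    have := add_pow t (1 - t) n
    rw [add_sub_cancel, one_pow] at this
    exact (Finset.sum_congr rfl fun _ _ => mul_comm _ _).trans this.symm
  have hnn : ∀ j, 0 ≤ (n.choose j : ℝ) * (t ^ j * (1 - t) ^ (n - j)) := fun j => by
    have : 0 ≤ 1 - t := by linarith
    positivity
  rw [← Finset.add_sum_erase _ _ (Finset.mem_range.2 (Nat.succ_pos n))] at h1
  have h2 : binomialTail n k t ≤ ∑ j ∈ (Finset.range (n + 1)).erase 0,
      (n.choose j : ℝ) * (t ^ j * (1 - t) ^ (n - j)) := by
    refine Finset.sum_le_sum_of_subset_of_nonneg (fun j hj => ?_) fun j _ _ => hnn j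
    rw [Finset.mem_Icc] at hj
    simp only [Finset.mem_erase, Finset.mem_range]
    omega
  have h3 := one_add_mul_le_pow (show (-2 : ℝ) ≤ -t by linarith) n
  simp only [Nat.choose_zero_right, Nat.cast_one, pow_zero, one_mul, Nat.sub_zero] at h1
  rw [← sub_eq_add_neg] at h3
  linarith

variable {Ω : Type*} [MeasurableSpace Ω] {P : Measure Ω} [IsProbabilityMeasure P]
  {U : Ω → ℝ} {n k : ℕ}

/-- `U` has the law of the `k`-th smallest of `n` independent uniform variables on `[0,1]`. -/
structure IsUniformOrderStat (P : Measure Ω) (U : Ω → ℝ) (n k : ℕ) : Prop where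
  measurable : Measurable U
  one_le : 1 ≤ k
  le : k ≤ n
  cdf : ∀ t ∈ Set.Icc (0 : ℝ) 1, P.real {ω | U ω ≤ t} = binomialTail n k t

namespace IsUniformOrderStat

theorem ae_pos (h : IsUniformOrderStat P U n k) : ∀ᵐ ω ∂P, 0 < U ω := by
  have h0 := h.cdf 0 (by simp)
  rw [binomialTail, Finset.sum_eq_zero, measureReal_eq_zero_iff] at h0
  · simpa [ae_iff] using h0
  · intro j hj
    have := (Finset.mem_Icc.1 hj).1
    have := h.one_le
    rw [zero_pow (by omega)]
    simp

theorem ae_le_one (h : IsUniformOrderStat P U n k) : ∀ᵐ ω ∂P, U ω ≤ 1 := by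
  have h0 := h.cdf 1 (by simp)
  rw [binomialTail, Finset.sum_eq_single n] at h0
  · have hms : MeasurableSet {ω | U ω ≤ 1} := measurableSet_le h.measurable measurable_const
    have h1 : P.real {ω | U ω ≤ 1}ᶜ = 0 := by rw [probReal_compl_eq_one_sub hms, h0]; simp
    rw [measureReal_eq_zero_iff] at h1
    exact h1
  · intro j hj hjn
    have := (Finset.mem_Icc.1 hj).2
    rw [sub_self, zero_pow (by omega)]
    simp
  · intro hn
    exact absurd (Finset.mem_Icc.2 ⟨h.le, le_rfl⟩) hn

/-- Writing `-log U` as the integral of `1/t` over `[U, 1]`, Tonelli gives `∫ P(U ≤ t) / t dt` over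
`(0, 1]`, and the `j`-th term of the binomial tail integrates to `1/j`. -/
theorem lintegral_neg_log (h : IsUniformOrderStat P U n k) :
    ∫⁻ ω, ENNReal.ofReal (-Real.log (U ω)) ∂P
      = ENNReal.ofReal (∑ j ∈ Finset.Icc k n, 1 / (j : ℝ)) := by
  have h1 : ∀ᵐ ω ∂P, ENNReal.ofReal (-Real.log (U ω)) =
      ∫⁻ t in Set.Ioc (0 : ℝ) 1, {q : Ω × ℝ | U q.1 ≤ q.2}.indicator
        (fun q => ENNReal.ofReal (1 / q.2)) (ω, t) := by
    filter_upwards [h.ae_pos, h.ae_le_one] with ω h0 h1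
    have e1 : ∀ t, {q : Ω × ℝ | U q.1 ≤ q.2}.indicator
        (fun q => ENNReal.ofReal (1 / q.2)) (ω, t) =
        (Set.Ici (U ω)).indicator (fun t => ENNReal.ofReal (1 / t)) t := fun t => by
      simp [Set.indicator]
    simp_rw [e1]
    rw [setLIntegral_indicator measurableSet_Ici]
    have e2 : Set.Ici (U ω) ∩ Set.Ioc 0 1 = Set.Icc (U ω) 1 := by
      ext t
      simp only [Set.mem_inter_iff, Set.mem_Ici, Set.mem_Ioc, Set.mem_Icc]
      exact ⟨fun h => ⟨h.1, h.2.2⟩, fun h => ⟨h.1, h0.trans_le h.1, h.2⟩⟩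
    rw [e2, ← restrict_Ioc_eq_restrict_Icc, ← ofReal_integral_eq_lintegral_ofReal,
      ← intervalIntegral.integral_of_le h1, integral_one_div_of_pos h0 one_pos]
    · simp
    · rw [← IntegrableOn, ← intervalIntegrable_iff_integrableOn_Ioc_of_le h1]
      apply ContinuousOn.intervalIntegrable
      rw [Set.uIcc_of_le h1]
      exact continuousOn_const.div continuousOn_id fun t ht => (h0.trans_le ht.1).ne'
    · filter_upwards [ae_restrict_mem measurableSet_Ioc] with t ht
      have := h0.trans ht.1
      simp only [Pi.zero_apply]
      positivity
  rw [lintegral_congr_ae h1, lintegral_lintegral_swap]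
  · have h2 : ∀ t ∈ Set.Ioc (0 : ℝ) 1, ∫⁻ ω, {q : Ω × ℝ | U q.1 ≤ q.2}.indicator
        (fun q => ENNReal.ofReal (1 / q.2)) (ω, t) ∂P =
        ENNReal.ofReal (∑ j ∈ Finset.Icc k n,
          (n.choose j : ℝ) * (t ^ (j - 1) * (1 - t) ^ (n - j))) := by
      intro t ht
      have e1 : ∀ ω, {q : Ω × ℝ | U q.1 ≤ q.2}.indicator
        (fun q => ENNReal.ofReal (1 / q.2)) (ω, t) =
        {ω | U ω ≤ t}.indicator (fun _ => ENNReal.ofReal (1 / t)) ω := fun ω => by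
        simp [Set.indicator]
      simp_rw [e1]
      rw [lintegral_indicator_const (measurableSet_le h.measurable measurable_const),
        ← ofReal_measureReal, h.cdf t ⟨ht.1.le, ht.2⟩, ← ENNReal.ofReal_mul (by have := ht.1; positivity),
        binomialTail, Finset.mul_sum]
      congr 1
      refine Finset.sum_congr rfl fun j hj => ?_
      have hj1 := (Finset.mem_Icc.1 hj).1
      have hk := h.one_le
      obtain ⟨i, rfl⟩ := Nat.exists_eq_add_of_le' (hk.trans hj1)
      rw [Nat.add_sub_cancel, pow_succ]
      have := ht.1.ne'
      field_simp
    rw [setLIntegral_congr_fun measurableSet_Ioc h2, ← ofReal_integral_eq_lintegral_ofReal,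
      ← intervalIntegral.integral_of_le zero_le_one, intervalIntegral.integral_finsetSum]
    · congr 1
      refine Finset.sum_congr rfl fun j hj => ?_
      rw [intervalIntegral.integral_const_mul]
      rw [Finset.mem_Icc] at hj
      exact choose_mul_integral_pred (h.one_le.trans hj.1) hj.2
    · intro j _
      apply Continuous.intervalIntegrable
      fun_prop
    · rw [← IntegrableOn, ← intervalIntegrable_iff_integrableOn_Ioc_of_le zero_le_one]
      apply Continuous.intervalIntegrable
      fun_prop
    · filter_upwards [ae_restrict_mem measurableSet_Ioc] with t ht
      have h0 := ht.1
      have h1 : 0 ≤ 1 - t := by linarith [ht.2]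
      refine Finset.sum_nonneg fun j _ => ?_
      positivity
  · refine (Measurable.indicator (by fun_prop) ?_).aemeasurable
    exact measurableSet_le (h.measurable.comp measurable_fst) measurable_snd

theorem integrable_log (h : IsUniformOrderStat P U n k) :
    Integrable (fun ω => Real.log (U ω)) P := by
  have hm : Measurable (fun ω => -Real.log (U ω)) := (Real.measurable_log.comp h.measurable).neg
  have : Integrable (fun ω => -Real.log (U ω)) P := by
    refine ⟨hm.aestronglyMeasurable, ?_⟩
    rw [hasFiniteIntegral_iff_ofReal, h.lintegral_neg_log]
    · exact ENNReal.ofReal_lt_top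
    · filter_upwards [h.ae_pos, h.ae_le_one] with ω h0 h1
      simpa using Real.log_nonpos h0.le h1
  simpa using this.neg

theorem integral_log (h : IsUniformOrderStat P U n k) :
    ∫ ω, Real.log (U ω) ∂P = digamma k - digamma ((n : ℝ) + 1) := by
  have e := digamma_nat_sub h.one_le h.le
  have h2 := h.lintegral_neg_log
  rw [← ofReal_integral_eq_lintegral_ofReal (f := fun ω => -Real.log (U ω)) h.integrable_log.neg,
    integral_neg, ENNReal.ofReal_eq_ofReal_iff] at h2
  · linarith
  · rw [← integral_neg]
    apply integral_nonneg_of_ae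
    filter_upwards [h.ae_pos, h.ae_le_one] with ω h0 h1
    simpa using Real.log_nonpos h0.le h1
  · exact Finset.sum_nonneg fun j _ => by positivity
  · filter_upwards [h.ae_pos, h.ae_le_one] with ω h0 h1
    simpa using Real.log_nonpos h0.le h1

theorem integrable (h : IsUniformOrderStat P U n k) : Integrable U P := by
  refine Integrable.of_bound h.measurable.aestronglyMeasurable 1 ?_
  filter_upwards [h.ae_pos, h.ae_le_one] with ω h0 h1
  rw [Real.norm_eq_abs, abs_of_pos h0]
  exact h1

/-- Layer cake for `1 - U`: each of the `n + 1 - k` terms of the tail integrates to `1 / (n + 1)`.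
-/
theorem integral_eq (h : IsUniformOrderStat P U n k) : ∫ ω, U ω ∂P = k / (n + 1 : ℝ) := by
  have h0 : 0 ≤ᵐ[P] fun ω => 1 - U ω := by
    filter_upwards [h.ae_le_one] with ω h1
    simpa using h1
  have h1 : ∫⁻ ω, ENNReal.ofReal (1 - U ω) ∂P = ENNReal.ofReal ((n + 1 - k : ℝ) / (n + 1)) := by
    rw [lintegral_eq_lintegral_meas_le P h0 (by have := h.measurable; fun_prop)]
    have e1 : ∀ t ∈ Set.Ioi (0 : ℝ), P {a | t ≤ 1 - U a} =
        (Set.Ioc (0 : ℝ) 1).indicator (fun t => ENNReal.ofReal (binomialTail n k (1 - t))) t := by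
      intro t ht
      by_cases ht1 : t ≤ 1
      · rw [Set.indicator_of_mem (by exact ⟨ht, ht1⟩), ← h.cdf _ (by simp [ht1, le_of_lt ht.out]),
          ofReal_measureReal]
        congr 1
        ext ω
        simp only [Set.mem_ofPred_eq]
        constructor <;> intro <;> linarith
      · rw [Set.indicator_of_notMem (by simp [ht1])]
        refine measure_mono_null ?_ (show P {ω | ¬ 0 < U ω} = 0 from h.ae_pos)
        intro ω hω
        simp only [Set.mem_ofPred_eq] at hω ⊢
        linarith
    rw [setLIntegral_congr_fun measurableSet_Ioi e1, setLIntegral_indicator measurableSet_Ioc,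
      show Set.Ioc (0 : ℝ) 1 ∩ Set.Ioi 0 = Set.Ioc 0 1 from
        Set.inter_eq_left.2 fun t ht => ht.1, ← ofReal_integral_eq_lintegral_ofReal,
      ← intervalIntegral.integral_of_le zero_le_one,
      intervalIntegral.integral_comp_sub_left (fun t => binomialTail n k t)]
    · congr 1
      simp only [binomialTail, sub_self, sub_zero]
      rw [intervalIntegral.integral_finsetSum]
      · have : ∀ j ∈ Finset.Icc k n, ∫ t in (0 : ℝ)..1, (n.choose j : ℝ) * (t ^ j * (1 - t) ^ (n - j))
            = 1 / (n + 1 : ℝ) := fun j hj => by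
          rw [intervalIntegral.integral_const_mul, choose_mul_integral (Finset.mem_Icc.1 hj).2]
        rw [Finset.sum_congr rfl this, Finset.sum_const, Nat.card_Icc, nsmul_eq_mul,
          Nat.cast_sub (by have := h.le; omega)]
        push_cast
        ring
      · intro j _
        apply Continuous.intervalIntegrable
        fun_prop
    · rw [← IntegrableOn, ← intervalIntegrable_iff_integrableOn_Ioc_of_le zero_le_one]
      apply Continuous.intervalIntegrable
      unfold binomialTail
      fun_prop
    · filter_upwards [ae_restrict_mem measurableSet_Ioc] with t ht
      have h0 := ht.1
      have h1 : 0 ≤ 1 - t := by linarith [ht.2]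
      refine Finset.sum_nonneg fun j _ => ?_
      have : 0 ≤ 1 - (1 - t) := by linarith
      positivity
  have hkn : (k : ℝ) ≤ n := by exact_mod_cast h.le
  rw [← ofReal_integral_eq_lintegral_ofReal (f := fun ω => 1 - U ω)
      ((integrable_const 1).sub h.integrable) h0,
    ENNReal.ofReal_eq_ofReal_iff (integral_nonneg_of_ae h0) (div_nonneg (by linarith) (by positivity)),
    integral_sub (integrable_const 1) h.integrable] at h1
  simp only [integral_const, probReal_univ, smul_eq_mul, mul_one] at h1
  have : (n + 1 - k : ℝ) / (n + 1) = 1 - k / (n + 1 : ℝ) := by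
    field_simp
  linarith

/-- Put `x = (n + 1) U`. Where `x ≥ 1`, `log² x ≤ 4 x`, and `x` has mean `k`. Where `x < 1`, the
tail bound `P(-log x ≥ s) ≤ exp (-s)` contributes at most `2 Γ(2) = 2`. The point is uniformity in
`n`. -/
theorem lintegral_sq_log_le (h : IsUniformOrderStat P U n k) :
    ∫⁻ ω, ENNReal.ofReal (Real.log ((n + 1 : ℝ) * U ω) ^ 2) ∂P ≤ ENNReal.ofReal (4 * k + 2) := by
  have hm := h.measurable
  set G : Ω → ℝ := fun ω => max (-Real.log ((n + 1 : ℝ) * U ω)) 0 with hG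
  have hGm : Measurable G := by fun_prop
  have h1 : ∀ᵐ ω ∂P, ENNReal.ofReal (Real.log ((n + 1 : ℝ) * U ω) ^ 2) ≤
      ENNReal.ofReal (4 * ((n + 1 : ℝ) * U ω)) + ENNReal.ofReal (G ω ^ (2 : ℝ)) := by
    filter_upwards [h.ae_pos] with ω h0
    set x := (n + 1 : ℝ) * U ω with hx
    have hx0 : 0 < x := by positivity
    rw [← ENNReal.ofReal_add (by positivity) (by positivity)]
    apply ENNReal.ofReal_le_ofReal
    rcases le_total (Real.log x) 0 with hl | hl
    · have : G ω = -Real.log x := max_eq_left (by linarith)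
      rw [this, Real.rpow_two, neg_sq]
      linarith
    · have e1 : Real.log x ≤ 2 * Real.sqrt x := by
        have := Real.add_one_le_exp (Real.log (Real.sqrt x))
        rw [Real.exp_log (Real.sqrt_pos.2 hx0), Real.log_sqrt hx0.le] at this
        linarith
      have e2 : Real.log x ^ 2 ≤ (2 * Real.sqrt x) ^ 2 := by gcongr
      rw [mul_pow, Real.sq_sqrt hx0.le] at e2
      have : 0 ≤ G ω ^ (2 : ℝ) := by positivity
      linarith
  refine (lintegral_mono_ae h1).trans ?_
  rw [lintegral_add_left (by fun_prop), ENNReal.ofReal_add (by positivity) (by norm_num)]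
  gcongr
  · rw [← ofReal_integral_eq_lintegral_ofReal ((h.integrable.const_mul _).const_mul _),
      integral_const_mul, integral_const_mul, h.integral_eq]
    · apply ENNReal.ofReal_le_ofReal
      apply le_of_eq
      field_simp
    · filter_upwards [h.ae_pos] with ω h0
      simp only [Pi.zero_apply]
      positivity
  · rw [lintegral_rpow_eq_lintegral_meas_le_mul P (f := G) (ae_of_all _ fun ω => le_max_right _ _)
      hGm.aemeasurable (by norm_num : (0 : ℝ) < 2)]
    have e3 : ∀ s ∈ Set.Ioi (0 : ℝ), P {a | s ≤ G a} * ENNReal.ofReal (s ^ ((2 : ℝ) - 1)) ≤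
        ENNReal.ofReal (Real.exp (-s) * s ^ ((2 : ℝ) - 1)) := by
      intro s hs
      rw [ENNReal.ofReal_mul (Real.exp_nonneg _)]
      gcongr
      have hs0 : (0 : ℝ) < s := hs
      have hes : Real.exp (-s) ≤ 1 := by simpa using hs0.le
      have ht1 : Real.exp (-s) / (n + 1 : ℝ) ≤ 1 := by
        rw [div_le_one (by positivity)]
        linarith [(Nat.cast_nonneg n : (0 : ℝ) ≤ n)]
      have ht0 : 0 ≤ Real.exp (-s) / (n + 1 : ℝ) := by positivity
      calc P {a | s ≤ G a} ≤ P {a | U a ≤ Real.exp (-s) / (n + 1 : ℝ)} := by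
            apply measure_mono_ae
            filter_upwards [h.ae_pos] with ω h0 hω
            have hω' : s ≤ max (-Real.log ((n + 1 : ℝ) * U ω)) 0 := hω
            rcases le_max_iff.1 hω' with h2 | h2
            · show U ω ≤ _
              rw [le_div_iff₀ (by positivity), mul_comm, ← Real.log_le_iff_le_exp (by positivity)]
              linarith
            · linarith
        _ = ENNReal.ofReal (binomialTail n k (Real.exp (-s) / (n + 1 : ℝ))) := by
            rw [← h.cdf _ ⟨ht0, ht1⟩, ofReal_measureReal]
        _ ≤ ENNReal.ofReal (Real.exp (-s)) := by
            apply ENNReal.ofReal_le_ofReal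
            refine (binomialTail_le h.one_le ht0 ht1).trans ?_
            rw [mul_div_assoc', div_le_iff₀ (by positivity)]
            nlinarith [Real.exp_nonneg (-s)]
    have hint := Real.GammaIntegral_convergent (by norm_num : (0 : ℝ) < 2)
    calc _ ≤ ENNReal.ofReal 2 * ∫⁻ s in Set.Ioi (0 : ℝ),
          ENNReal.ofReal (Real.exp (-s) * s ^ ((2 : ℝ) - 1)) := by
          gcongr ENNReal.ofReal 2 * ?_
          exact setLIntegral_mono' measurableSet_Ioi e3
      _ = ENNReal.ofReal 2 * ENNReal.ofReal (Real.Gamma 2) := by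
          rw [Real.Gamma_eq_integral (by norm_num), ← ofReal_integral_eq_lintegral_ofReal hint]
          filter_upwards [ae_restrict_mem measurableSet_Ioi] with t ht
          have h0 : (0 : ℝ) < t := ht
          simp only [Pi.zero_apply]
          positivity
      _ ≤ ENNReal.ofReal 2 := by rw [Real.Gamma_two]; simp

end IsUniformOrderStat

end OrderStatistic

/-! ### The Efron–Stein inequality -/

section EfronStein

open ProbabilityTheory

theorem ofReal_variance_eq_lintegral {α : Type*} [MeasurableSpace α] {μ : Measure α}
    [IsProbabilityMeasure μ] {f : α → ℝ} (hf : MemLp f 2 μ) :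
    ENNReal.ofReal (∫ x, f x ^ 2 ∂μ - (∫ x, f x ∂μ) ^ 2) = evariance f μ := by
  rw [← ofReal_variance hf, variance_eq_sub hf]
  simp

theorem evariance_le_lintegral_sq_sub {α : Type*} [MeasurableSpace α] {μ : Measure α}
    [IsProbabilityMeasure μ] {f : α → ℝ} (hf : MemLp f 2 μ) (a : ℝ) :
    evariance f μ ≤ ∫⁻ x, ENNReal.ofReal ((f x - a) ^ 2) ∂μ := by
  have h1 : MemLp (fun x => f x - a) 2 μ := hf.sub (memLp_const a)
  rw [← ofReal_integral_eq_lintegral_ofReal h1.integrable_sq (ae_of_all _ fun x => sq_nonneg _),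
    ← ofReal_variance hf, ← variance_sub_const hf.aestronglyMeasurable a]
  apply ENNReal.ofReal_le_ofReal
  exact variance_le_expectation_sq h1.aestronglyMeasurable

variable {X Y : Type*} [MeasurableSpace X] [MeasurableSpace Y]

theorem memLp_two_integral_right {μ : Measure X} [IsProbabilityMeasure μ] {ν : Measure Y}
    [IsProbabilityMeasure ν] {f : X × Y → ℝ} (hf : MemLp f 2 (μ.prod ν)) :
    (∀ᵐ x ∂μ, MemLp (fun y => f (x, y)) 2 ν) ∧ MemLp (fun x => ∫ y, f (x, y) ∂ν) 2 μ := by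
  have hs := hf.integrable_sq
  have hi := hf.integrable one_le_two
  have h1 : ∀ᵐ x ∂μ, MemLp (fun y => f (x, y)) 2 ν := by
    filter_upwards [hs.prod_right_ae, hf.aestronglyMeasurable.prodMk_left] with x h2 h3
    exact (memLp_two_iff_integrable_sq h3).2 h2
  refine ⟨h1, ?_⟩
  have hm : AEStronglyMeasurable (fun x => ∫ y, f (x, y) ∂ν) μ := hi.integral_prod_left.1
  rw [memLp_two_iff_integrable_sq hm]
  refine Integrable.mono' hs.integral_prod_left (hm.pow 2) ?_
  filter_upwards [h1] with x hx
  have := variance_nonneg (fun y => f (x, y)) ν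
  rw [variance_eq_sub hx] at this
  rw [Real.norm_eq_abs, abs_of_nonneg (sq_nonneg _)]
  simpa using this

/-- With `m`, `e` the partial means and `c` the mean, expanding `0 ≤ ∫ (f - m(x) - (e(y) - c))²`
gives `∫ m² + ∫ e² ≤ ∫ f² + c²`, which is the claim after writing each partial variance as a
difference of second moments. -/
theorem evariance_prod_le {μ : Measure X} [IsProbabilityMeasure μ] {ν : Measure Y}
    [IsProbabilityMeasure ν] {f : X × Y → ℝ} (hf : MemLp f 2 (μ.prod ν)) :
    evariance f (μ.prod ν) ≤ ∫⁻ x, evariance (fun y => f (x, y)) ν ∂μ +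
      ∫⁻ y, evariance (fun x => f (x, y)) μ ∂ν := by
  obtain ⟨hx, hm⟩ := memLp_two_integral_right hf
  have hfs : MemLp (fun q : Y × X => f q.swap) 2 (ν.prod μ) :=
    hf.comp_measurePreserving Measure.measurePreserving_swap
  obtain ⟨hy, he⟩ := memLp_two_integral_right hfs
  simp only [Prod.swap_prod_mk] at hy he
  set m : X → ℝ := fun x => ∫ y, f (x, y) ∂ν with hmdef
  set e : Y → ℝ := fun y => ∫ x, f (x, y) ∂μ with hedef
  set c : ℝ := ∫ q, f q ∂(μ.prod ν) with hc
  have hfi := hf.integrable one_le_two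
  have hmc : ∫ x, m x ∂μ = c := (integral_prod f hfi).symm
  have hec : ∫ y, e y ∂ν = c := (integral_prod_symm f hfi).symm
  have e1 : ∫⁻ x, evariance (fun y => f (x, y)) ν ∂μ =
      ENNReal.ofReal (∫ q, f q ^ 2 ∂(μ.prod ν) - ∫ x, m x ^ 2 ∂μ) := by
    rw [integral_prod _ hf.integrable_sq, ← integral_sub hf.integrable_sq.integral_prod_left
      hm.integrable_sq, ofReal_integral_eq_lintegral_ofReal (f := fun x => ∫ y, f (x, y) ^ 2 ∂ν - m x ^ 2)
      (hf.integrable_sq.integral_prod_left.sub hm.integrable_sq)]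
    · refine lintegral_congr_ae ?_
      filter_upwards [hx] with x h
      rw [← ofReal_variance_eq_lintegral h]
    · filter_upwards [hx] with x h
      have := variance_nonneg (fun y => f (x, y)) ν
      rw [variance_eq_sub h] at this
      simpa using this
  have e2 : ∫⁻ y, evariance (fun x => f (x, y)) μ ∂ν =
      ENNReal.ofReal (∫ q, f q ^ 2 ∂(μ.prod ν) - ∫ y, e y ^ 2 ∂ν) := by
    rw [integral_prod_symm _ hf.integrable_sq, ← integral_sub hf.integrable_sq.integral_prod_right
      he.integrable_sq, ofReal_integral_eq_lintegral_ofReal (f := fun y => ∫ x, f (x, y) ^ 2 ∂μ - e y ^ 2)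
      (hf.integrable_sq.integral_prod_right.sub he.integrable_sq)]
    · refine lintegral_congr_ae ?_
      filter_upwards [hy] with x h
      rw [← ofReal_variance_eq_lintegral h]
    · filter_upwards [hy] with y h
      have := variance_nonneg (fun x => f (x, y)) μ
      rw [variance_eq_sub h] at this
      simpa using this
  rw [e1, e2, ← ofReal_variance_eq_lintegral hf]
  refine le_trans (ENNReal.ofReal_le_ofReal ?_) ENNReal.ofReal_add_le
  have hφ : MemLp (fun q : X × Y => m q.1) 2 (μ.prod ν) := hm.comp_fst ν
  have he' : MemLp (fun y => e y - c) 2 ν := he.sub (memLp_const c)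
  have hψ : MemLp (fun q : X × Y => e q.2 - c) 2 (μ.prod ν) := he'.comp_snd μ
  have i1 : ∫ q : X × Y, m q.1 ^ 2 ∂(μ.prod ν) = ∫ x, m x ^ 2 ∂μ := by
    rw [integral_fun_fst (fun x => m x ^ 2)]; simp
  have i2 : ∫ q : X × Y, (e q.2 - c) ^ 2 ∂(μ.prod ν) = ∫ y, e y ^ 2 ∂ν - c ^ 2 := by
    have h := variance_eq_sub he
    have h' := variance_eq_integral he.aestronglyMeasurable.aemeasurable
    rw [hec] at h h'
    rw [integral_fun_snd (fun y => (e y - c) ^ 2)]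
    simp only [probReal_univ, one_smul]
    rw [← h', h]
    simp
  have k4 : Integrable (fun q : X × Y => f q * m q.1) (μ.prod ν) := hf.integrable_mul hφ
  have k5 : Integrable (fun q : X × Y => f q * (e q.2 - c)) (μ.prod ν) := hf.integrable_mul hψ
  have k6 : Integrable (fun q : X × Y => m q.1 * (e q.2 - c)) (μ.prod ν) := hφ.integrable_mul hψ
  have i3 : ∫ q : X × Y, f q * m q.1 ∂(μ.prod ν) = ∫ x, m x ^ 2 ∂μ := by
    rw [integral_prod _ k4]
    simp only [integral_mul_const]
    exact integral_congr_ae (ae_of_all _ fun x => (sq (m x)).symm)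
  have i4 : ∫ q : X × Y, f q * (e q.2 - c) ∂(μ.prod ν) = ∫ y, e y ^ 2 ∂ν - c ^ 2 := by
    rw [integral_prod_symm _ k5]
    simp only [integral_mul_const]
    have : ∀ y, (∫ x, f (x, y) ∂μ) * (e y - c) = e y ^ 2 - c * e y := fun y => by
      show e y * _ = _
      ring
    simp_rw [this]
    rw [integral_sub he.integrable_sq ((he.integrable one_le_two).const_mul c), integral_const_mul,
      hec, sq c]
  have i5 : ∫ q : X × Y, m q.1 * (e q.2 - c) ∂(μ.prod ν) = 0 := by
    rw [integral_prod_mul m (fun y => e y - c),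
      integral_sub (he.integrable one_le_two) (integrable_const c), hec]
    simp
  have hpos : 0 ≤ ∫ q : X × Y, (f q - m q.1 - (e q.2 - c)) ^ 2 ∂(μ.prod ν) :=
    integral_nonneg fun q => sq_nonneg _
  have hexp : ∀ q : X × Y, (f q - m q.1 - (e q.2 - c)) ^ 2 =
      (f q ^ 2 + m q.1 ^ 2 + (e q.2 - c) ^ 2) -
        2 * (f q * m q.1 + f q * (e q.2 - c) - m q.1 * (e q.2 - c)) := fun q => by ring
  simp_rw [hexp] at hpos
  have k1 := hf.integrable_sq
  have k2 := hφ.integrable_sq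
  have k3 := hψ.integrable_sq
  have k12 : Integrable (fun q : X × Y => f q ^ 2 + m q.1 ^ 2) (μ.prod ν) := k1.add k2
  have k13 : Integrable (fun q : X × Y => f q ^ 2 + m q.1 ^ 2 + (e q.2 - c) ^ 2) (μ.prod ν) :=
    k12.add k3
  have k45 : Integrable (fun q : X × Y => f q * m q.1 + f q * (e q.2 - c)) (μ.prod ν) := k4.add k5
  have k46 : Integrable (fun q : X × Y => f q * m q.1 + f q * (e q.2 - c) -
    m q.1 * (e q.2 - c)) (μ.prod ν) := k45.sub k6
  rw [integral_sub k13 (k46.const_mul 2), integral_add k12 k3, integral_add k1 k2, integral_const_mul,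
    integral_sub k45 k6, integral_add k4 k5, i1, i2, i3, i4, i5] at hpos
  linarith

/-- The Efron–Stein inequality: the variance of a function of `n` independent variables is at most
the sum of the mean square errors of approximations not depending on the `i`-th variable. -/
theorem evariance_pi_le (μ : Measure X) [IsProbabilityMeasure μ] (n : ℕ) (f : (Fin n → X) → ℝ)
    (hfm : Measurable f) (hf : MemLp f 2 (Measure.pi fun _ => μ))
    (g : Fin n → (Fin n → X) → ℝ) (hgm : ∀ i, Measurable (g i))
    (hg : ∀ i x y, g i (Function.update x i y) = g i x) :
    evariance f (Measure.pi fun _ => μ) ≤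
      ∑ i, ∫⁻ x, ENNReal.ofReal ((f x - g i x) ^ 2) ∂(Measure.pi fun _ => μ) := by
  induction n with
  | zero =>
    refine (evariance_le_lintegral_sq_sub hf (f default)).trans ?_
    have : ∀ x, f x = f default := fun x => by rw [Subsingleton.elim x default]
    simp [this]
  | succ n ih =>
    have hmp := (measurePreserving_piFinSuccAbove (fun _ : Fin (n + 1) => μ) 0).symm
    set π : Measure (Fin n → X) := Measure.pi fun _ => μ with hπ
    have hcons : ∀ q : X × (Fin n → X),
        (MeasurableEquiv.piFinSuccAbove (fun _ : Fin (n + 1) => X) 0).symm q = Fin.cons q.1 q.2 := by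
      intro q
      simp [MeasurableEquiv.piFinSuccAbove, Fin.insertNthEquiv]
    have hmp' : MeasurePreserving (fun q : X × (Fin n → X) => (Fin.cons q.1 q.2 : Fin (n + 1) → X))
        (μ.prod π) (Measure.pi fun _ => μ) := by
      convert hmp using 1
      funext q
      exact (hcons q).symm
    have hcm := hmp'.measurable
    set F : X × (Fin n → X) → ℝ := fun q => f (Fin.cons q.1 q.2) with hF
    have hFL : MemLp F 2 (μ.prod π) := hf.comp_measurePreserving hmp'
    have hFm : Measurable F := hfm.comp hcm
    have hevar : evariance f (Measure.pi fun _ => μ) = evariance F (μ.prod π) := by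
      rw [← ofReal_variance_eq_lintegral hf, ← ofReal_variance_eq_lintegral hFL,
        ← hmp'.map_eq, integral_map hcm.aemeasurable hfm.aestronglyMeasurable,
        integral_map hcm.aemeasurable (hfm.pow_const 2).aestronglyMeasurable]
    have hl : ∀ i, ∫⁻ x, ENNReal.ofReal ((f x - g i x) ^ 2) ∂(Measure.pi fun _ => μ) =
        ∫⁻ q : X × (Fin n → X), ENNReal.ofReal ((F q - g i (Fin.cons q.1 q.2)) ^ 2) ∂(μ.prod π) := by
      intro i
      have := hgm i
      rw [← hmp'.map_eq, lintegral_map (by fun_prop) hcm]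
    have hms : ∀ i, Measurable fun q : X × (Fin n → X) =>
        ENNReal.ofReal ((F q - g i (Fin.cons q.1 q.2)) ^ 2) := fun i =>
      ((hFm.sub ((hgm i).comp hcm)).pow_const 2).ennreal_ofReal
    rw [hevar]
    simp_rw [hl]
    refine (evariance_prod_le hFL).trans ?_
    rw [Fin.sum_univ_succ, add_comm]
    gcongr ?_ + ?_
    -- With the other coordinates frozen, `g 0` is a constant, read off at an arbitrary `x0`, and
    -- the variance is at most the mean square distance to any constant.
    · rw [lintegral_prod_symm _ (hms 0).aemeasurable]
      have hFs : MemLp (fun q : (Fin n → X) × X => F q.swap) 2 (π.prod μ) :=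
        hFL.comp_measurePreserving Measure.measurePreserving_swap
      refine lintegral_mono_ae ?_
      filter_upwards [(memLp_two_integral_right hFs).1] with y hy
      rcases isEmpty_or_nonempty X with hX | ⟨⟨x0⟩⟩
      · simp [Measure.eq_zero_of_isEmpty μ] at *
      · refine (evariance_le_lintegral_sq_sub hy (g 0 (Fin.cons x0 y))).trans (le_of_eq ?_)
        refine lintegral_congr fun x => ?_
        have := hg 0 (Fin.cons x0 y) x
        rw [Fin.update_cons_zero] at this
        simp only [this]
        rfl
    · calc _ ≤ ∫⁻ x, ∑ i : Fin n, ∫⁻ y,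
            ENNReal.ofReal ((F (x, y) - g i.succ (Fin.cons x y)) ^ 2) ∂π ∂μ := by
            refine lintegral_mono_ae ?_
            filter_upwards [(memLp_two_integral_right hFL).1] with x hx
            refine ih (fun y => F (x, y)) (hFm.comp measurable_prodMk_left) hx
              (fun i y => g i.succ (Fin.cons x y))
              (fun i => (hgm i.succ).comp (hcm.comp measurable_prodMk_left)) ?_
            intro i y w
            rw [Fin.cons_update, hg]
        _ = _ := by
            rw [lintegral_finsetSum]
            · refine Finset.sum_congr rfl fun i _ => ?_
              rw [lintegral_prod _ (hms i.succ).aemeasurable]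
            · intro i _
              exact (hms i.succ).lintegral_prod_right'

end EfronStein

/-! ### The probability integral transform -/

section IntegralTransform

open ProbabilityTheory

variable {Ω : Type*} [MeasurableSpace Ω] {P : Measure Ω} [IsProbabilityMeasure P]

theorem continuous_measureReal_le {W : Ω → ℝ} (hW : Measurable W)
    (hno : ∀ r, P {ω | W ω = r} = 0) : Continuous fun r => P.real {ω | W ω ≤ r} := by
  have : IsProbabilityMeasure (P.map W) := Measure.isProbabilityMeasure_map hW.aemeasurable
  have hF : (fun r => P.real {ω | W ω ≤ r}) = cdf (P.map W) := by
    funext r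
    rw [cdf_eq_real, map_measureReal_apply hW measurableSet_Iic]
    rfl
  rw [hF, continuous_iff_continuousAt]
  intro a
  rw [(monotone_cdf _).continuousAt_iff_leftLim_eq_rightLim, StieltjesFunction.rightLim_eq]
  have h1 := (cdf (P.map W)).measure_singleton a
  rw [measure_cdf, Measure.map_apply hW (measurableSet_singleton a)] at h1
  rw [show W ⁻¹' {a} = {ω | W ω = a} from rfl, hno a] at h1
  have h2 := ENNReal.ofReal_eq_zero.1 h1.symm
  have h3 := (monotone_cdf (P.map W)).leftLim_le (le_refl a)
  linarith

/-- The distribution function is continuous, so it attains every level in `(0, 1)`. As it may be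
flat at level `t`, the upper bound goes through levels `s > t`. -/
theorem measureReal_integral_transform {W : Ω → ℝ} (hW : Measurable W)
    (hno : ∀ r, P {ω | W ω = r} = 0) {t : ℝ} (ht : t ∈ Set.Icc (0 : ℝ) 1) :
    P.real {ω | P.real {ω' | W ω' ≤ W ω} ≤ t} = t := by
  set F : ℝ → ℝ := fun r => P.real {ω | W ω ≤ r} with hF
  have hFc : Continuous F := continuous_measureReal_le hW hno
  have hFm : Monotone F := fun a b hab => measureReal_mono fun ω h => le_trans h hab
  have : IsProbabilityMeasure (P.map W) := Measure.isProbabilityMeasure_map hW.aemeasurable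
  have hF' : F = cdf (P.map W) := by
    funext r
    rw [cdf_eq_real, map_measureReal_apply hW measurableSet_Iic]
    rfl
  have hex : ∀ s ∈ Set.Ioo (0 : ℝ) 1, ∃ r, F r = s := by
    intro s hs
    have h0 : Tendsto F atBot (𝓝 0) := hF' ▸ tendsto_cdf_atBot _
    have h1 : Tendsto F atTop (𝓝 1) := hF' ▸ tendsto_cdf_atTop _
    obtain ⟨a, ha⟩ := (h0.eventually_lt_const hs.1).exists
    obtain ⟨b, hb⟩ := (h1.eventually_const_lt hs.2).exists
    exact mem_range_of_exists_le_of_exists_ge hFc ⟨a, ha.le⟩ ⟨b, hb.le⟩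
  have hgoal : {ω | P.real {ω' | W ω' ≤ W ω} ≤ t} = {ω | F (W ω) ≤ t} := rfl
  rw [hgoal]
  apply le_antisymm
  · refine le_of_forall_gt_imp_ge_of_dense fun s hs => ?_
    rcases lt_or_ge s 1 with hs1 | hs1
    · obtain ⟨r, hr⟩ := hex s ⟨lt_of_le_of_lt ht.1 hs, hs1⟩
      rw [← hr]
      refine measureReal_mono fun ω hω => ?_
      have h2 : F (W ω) < F r := by rw [hr]; exact lt_of_le_of_lt hω hs
      exact (hFm.reflect_lt h2).le
    · exact measureReal_le_one.trans hs1
  · rcases ht.1.eq_or_lt with h0 | h0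
    · rw [← h0]; exact measureReal_nonneg
    rcases ht.2.eq_or_lt with h1 | h1
    · have : {ω | F (W ω) ≤ t} = Set.univ := by
        ext ω
        simp only [Set.mem_ofPred_eq, Set.mem_univ, iff_true, h1]
        exact measureReal_le_one
      rw [this, h1]
      simp
    · obtain ⟨r, hr⟩ := hex t ⟨h0, h1⟩
      conv_lhs => rw [← hr]
      refine measureReal_mono fun ω hω => ?_
      have := hFm hω
      rw [hr] at this
      exact this

/-- The distribution function commutes with the order statistic, so the event says that at least `k`
of `n` independent uniform variables are at most `t`. -/
theorem isUniformOrderStat_kthSmallest {W : Ω → ℝ} (hW : Measurable W)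
    (hno : ∀ r, P {ω | W ω = r} = 0) {n k : ℕ} (hk : 1 ≤ k) (hkn : k ≤ n) :
    IsUniformOrderStat (Measure.pi fun _ : Fin n => P)
      (fun y => P.real {ω | W ω ≤ kthSmallest Finset.univ k (fun l => W (y l))}) n k := by
  classical
  set F : ℝ → ℝ := fun r => P.real {ω | W ω ≤ r} with hF
  have hFm : Monotone F := fun a b hab => measureReal_mono fun ω h => le_trans h hab
  have hA : ∀ t, MeasurableSet {ω | F (W ω) ≤ t} := fun t =>
    measurableSet_le (hFm.measurable.comp hW) measurable_const
  have hcard : k ≤ (Finset.univ : Finset (Fin n)).card := by simpa using hkn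
  have hset : ∀ t, {y : Fin n → Ω | F (kthSmallest Finset.univ k (fun l => W (y l))) ≤ t} =
      {y | k ≤ (Finset.univ.filter (fun l => y l ∈ {ω | F (W ω) ≤ t})).card} := by
    intro t
    ext y
    simp only [Set.mem_ofPred_eq]
    rw [kthSmallest_monotone_comp _ hk hcard hFm, kthSmallest_le_iff hk hcard]
  have hms : ∀ t, MeasurableSet
      {y : Fin n → Ω | k ≤ (Finset.univ.filter (fun l => y l ∈ {ω | F (W ω) ≤ t})).card} := by
    intro t
    have : Measurable fun y : Fin n → Ω =>
        (Finset.univ.filter (fun l => y l ∈ {ω | F (W ω) ≤ t})).card := by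
      simp_rw [Finset.card_filter]
      refine Finset.measurable_sum _ fun l _ => ?_
      exact Measurable.ite (measurable_pi_apply l (hA t)) measurable_const measurable_const
    exact this (measurableSet_Ici (a := k))
  refine ⟨measurable_of_Iic fun t => ?_, hk, hkn, fun t ht => ?_⟩
  · have := hms t
    rw [← hset t] at this
    exact this
  · have h1 := pi_count_mem_ge (ι := Fin n) P (hA t) k
    rw [measureReal_integral_transform hW hno ht, Fintype.card_fin, ← hset t] at h1
    exact h1

end IntegralTransform

/-! ### Boxes truncated to the cube -/

section Cell

variable {d : ℕ}

/-- The `j`-th side length of the box around `z` of radius `r`, truncated to the unit cube. -/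
def cellSide (z : Fin d → ℝ) (r : ℝ) (j : Fin d) : ℝ :=
  min (z j + r) 1 - max (z j - r) 0

/-- The volume of the box around `z` of radius `r`, truncated to the unit cube. -/
def cellVolume (z : Fin d → ℝ) (r : ℝ) : ℝ := ∏ j, cellSide z r j

theorem cellSide_mono (z : Fin d → ℝ) (j : Fin d) : Monotone fun r => cellSide z r j := by
  intro a b hab
  unfold cellSide
  have h1 : min (z j + a) 1 ≤ min (z j + b) 1 := min_le_min_right _ (by linarith)
  have h2 : max (z j - b) 0 ≤ max (z j - a) 0 := max_le_max_right _ (by linarith)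
  show _ - _ ≤ _ - _
  linarith

/-- If both ends are cut off the side is the whole unit interval; otherwise a full half of length
`r` survives. -/
theorem min_le_cellSide {z : Fin d → ℝ} (hz : z ∈ openCube d) {r : ℝ} (hr : 0 ≤ r) (j : Fin d) :
    min r 1 ≤ cellSide z r j := by
  have := hz j
  unfold cellSide
  rcases this with ⟨h0, h1⟩
  rcases min_cases r 1 with h | h <;> rcases min_cases (z j + r) 1 with h' | h' <;>
    rcases max_cases (z j - r) 0 with h'' | h'' <;> linarith

theorem cellSide_pos {z : Fin d → ℝ} (hz : z ∈ openCube d) {r : ℝ} (hr : 0 < r) (j : Fin d) :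
    0 < cellSide z r j :=
  lt_of_lt_of_le (lt_min hr one_pos) (min_le_cellSide hz hr.le j)

theorem cellSide_nonneg {z : Fin d → ℝ} (hz : z ∈ openCube d) {r : ℝ} (hr : 0 ≤ r) (j : Fin d) :
    0 ≤ cellSide z r j :=
  (le_min hr zero_le_one).trans (min_le_cellSide hz hr j)

theorem cellVolume_pos {z : Fin d → ℝ} (hz : z ∈ openCube d) {r : ℝ} (hr : 0 < r) :
    0 < cellVolume z r :=
  Finset.prod_pos fun j _ => cellSide_pos hz hr j

theorem cellVolume_mono {z : Fin d → ℝ} (hz : z ∈ openCube d) {r s : ℝ} (hr : 0 ≤ r)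
    (hrs : r ≤ s) : cellVolume z r ≤ cellVolume z s :=
  Finset.prod_le_prod (fun j _ => cellSide_nonneg hz hr j) fun j _ => cellSide_mono z j hrs

theorem pow_le_cellVolume {z : Fin d → ℝ} (hz : z ∈ openCube d) {r : ℝ} (hr : 0 ≤ r)
    (hr1 : r ≤ 1) : r ^ d ≤ cellVolume z r := by
  have : r ^ d = ∏ _j : Fin d, r := by simp
  rw [this]
  refine Finset.prod_le_prod (fun _ _ => hr) fun j _ => ?_
  simpa [min_eq_left hr1] using min_le_cellSide hz hr j

theorem log_cellVolume {z : Fin d → ℝ} (hz : z ∈ openCube d) {r : ℝ} (hr : 0 < r) :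
    Real.log (cellVolume z r) = ∑ j, Real.log (cellSide z r j) :=
  Real.log_prod fun j _ => (cellSide_pos hz hr j).ne'

theorem measurableSet_openCube : MeasurableSet (openCube d) := by
  have : openCube d = Set.univ.pi fun _ => Set.Ioo (0 : ℝ) 1 := by ext; simp [openCube]
  rw [this]
  exact MeasurableSet.univ_pi fun _ => measurableSet_Ioo

theorem isOpen_openCube : IsOpen (openCube d) := by
  have : openCube d = Set.univ.pi fun _ => Set.Ioo (0 : ℝ) 1 := by ext; simp [openCube]
  rw [this]
  exact isOpen_set_pi Set.finite_univ fun _ _ => isOpen_Ioo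

theorem convex_openCube : Convex ℝ (openCube d) := by
  have : openCube d = Set.univ.pi fun _ => Set.Ioo (0 : ℝ) 1 := by ext; simp [openCube]
  rw [this]
  exact convex_pi fun _ _ => convex_Ioo 0 1

theorem volume_openCube : volume (openCube d) = 1 := by
  have : openCube d = Set.univ.pi fun _ => Set.Ioo (0 : ℝ) 1 := by ext; simp [openCube]
  rw [this, volume_pi_pi]
  simp

theorem dist_le_one_of_mem_openCube {z w : Fin d → ℝ} (hz : z ∈ openCube d)
    (hw : w ∈ openCube d) : dist z w ≤ 1 := by
  rw [dist_pi_le_iff zero_le_one]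
  intro j
  have h1 := hz j
  have h2 := hw j
  rw [Real.dist_eq, abs_le]
  constructor <;> linarith [h1.1, h1.2, h2.1, h2.2]

/-- The truncated cell is the maximum-norm ball cut by the cube, up to a null set. Mass and volume
thus refer to the same set even near the boundary, which is why truncation removes the boundary
bias. -/
theorem volume_closedBall_inter_openCube {z : Fin d → ℝ} (hz : z ∈ openCube d) {r : ℝ}
    (hr : 0 ≤ r) :
    volume (Metric.closedBall z r ∩ openCube d) = ENNReal.ofReal (cellVolume z r) := by
  have h1 : Metric.closedBall z r ∩ openCube d =
      Set.univ.pi fun j => Metric.closedBall (z j) r ∩ Set.Ioo (0 : ℝ) 1 := by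
    rw [closedBall_pi _ hr, Set.pi_inter_distrib]
    congr 1
    ext
    simp [openCube]
  rw [h1, volume_pi_pi, cellVolume, ENNReal.ofReal_prod_of_nonneg fun j _ => cellSide_nonneg hz hr j]
  refine Finset.prod_congr rfl fun j _ => ?_
  have h2 : (Metric.closedBall (z j) r ∩ Set.Ioo (0 : ℝ) 1 : Set ℝ) =ᵐ[volume]
      (Metric.closedBall (z j) r ∩ Set.Icc (0 : ℝ) 1 : Set ℝ) :=
    (ae_eq_refl _).inter Ioo_ae_eq_Icc
  rw [measure_congr h2, Real.closedBall_eq_Icc, Set.Icc_inter_Icc, Real.volume_Icc]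
  rfl

end Cell

/-! ### Nearly uniform densities on the cube -/

section NearUniform

variable {d : ℕ}

/-- A probability density on the open unit cube that is Lipschitz for the maximum norm with a
constant `L ≤ c < 1`; its values on the cube are then in `[1 - c, 1 + c]`. -/
structure IsNearUniform (q : (Fin d → ℝ) → ℝ) (L c : ℝ) : Prop where
  measurable : Measurable q
  zero_off : ∀ z ∉ openCube d, q z = 0
  lipschitz : ∀ z ∈ openCube d, ∀ w ∈ openCube d, |q z - q w| ≤ L * dist z w
  nonneg : 0 ≤ L
  le : L ≤ c
  lt_one : c < 1
  lintegral_eq : ∫⁻ z, ENNReal.ofReal (q z) = 1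

namespace IsNearUniform

variable {q : (Fin d → ℝ) → ℝ} {L c : ℝ}

theorem isProbabilityMeasure (h : IsNearUniform q L c) : IsProbabilityMeasure (densityLaw q) :=
  ⟨by rw [densityLaw, withDensity_apply _ MeasurableSet.univ, Measure.restrict_univ, h.lintegral_eq]⟩

theorem law_apply (h : IsNearUniform q L c) {A : Set (Fin d → ℝ)} (hA : MeasurableSet A) :
    densityLaw q A = ∫⁻ z in A ∩ openCube d, ENNReal.ofReal (q z) := by
  rw [densityLaw, withDensity_apply _ hA, ← lintegral_indicator hA,
    ← lintegral_indicator (hA.inter measurableSet_openCube)]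
  refine lintegral_congr fun z => ?_
  by_cases hz : z ∈ openCube d
  · by_cases hzA : z ∈ A <;> simp [hz, hzA]
  · by_cases hzA : z ∈ A <;> simp [hz, hzA, h.zero_off z hz]

theorem ae_mem_openCube (h : IsNearUniform q L c) : ∀ᵐ z ∂(densityLaw q), z ∈ openCube d := by
  have : densityLaw q (openCube d)ᶜ = 0 := by
    rw [h.law_apply measurableSet_openCube.compl]
    simp
  exact this

theorem abs_sub_le (h : IsNearUniform q L c) {z w : Fin d → ℝ} (hz : z ∈ openCube d)
    (hw : w ∈ openCube d) : |q z - q w| ≤ c := by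
  refine (h.lipschitz z hz w hw).trans ?_
  have := dist_le_one_of_mem_openCube hz hw
  nlinarith [h.nonneg, h.le]

theorem lintegral_openCube (h : IsNearUniform q L c) :
    ∫⁻ z in openCube d, ENNReal.ofReal (q z) = 1 := by
  have := h.isProbabilityMeasure
  rw [← Set.univ_inter (openCube d), ← h.law_apply MeasurableSet.univ, measure_univ]

/-- Otherwise `q` would stay below `1` by a fixed margin on a set of volume one, contradicting total
mass one. -/
theorem one_sub_le (h : IsNearUniform q L c) {z : Fin d → ℝ} (hz : z ∈ openCube d) :
    1 - c ≤ q z := by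
  by_contra! hlt
  have h1 : ∫⁻ w in openCube d, ENNReal.ofReal (q w) ≤
      ∫⁻ _w in openCube d, ENNReal.ofReal (q z + c) := by
    refine setLIntegral_mono' measurableSet_openCube fun w hw => ENNReal.ofReal_le_ofReal ?_
    have := (abs_le.1 (h.abs_sub_le hz hw)).1
    linarith
  rw [h.lintegral_openCube, setLIntegral_const, volume_openCube, mul_one, ENNReal.one_le_ofReal] at h1
  linarith

theorem le_one_add (h : IsNearUniform q L c) {z : Fin d → ℝ} (hz : z ∈ openCube d) :
    q z ≤ 1 + c := by
  by_contra! hlt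
  have h1 : ∫⁻ _w in openCube d, ENNReal.ofReal (q z - c) ≤
      ∫⁻ w in openCube d, ENNReal.ofReal (q w) := by
    refine setLIntegral_mono' measurableSet_openCube fun w hw => ENNReal.ofReal_le_ofReal ?_
    have := (abs_le.1 (h.abs_sub_le hz hw)).2
    linarith
  rw [h.lintegral_openCube, setLIntegral_const, volume_openCube, mul_one, ENNReal.ofReal_le_one] at h1
  linarith

theorem one_sub_pos (h : IsNearUniform q L c) : 0 < 1 - c := by linarith [h.lt_one]

theorem c_nonneg (h : IsNearUniform q L c) : 0 ≤ c := h.nonneg.trans h.le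

theorem abs_log_sub_log_le (h : IsNearUniform q L c) {a b : ℝ} (ha : 1 - c ≤ a) (hb : 1 - c ≤ b) :
    |Real.log a - Real.log b| ≤ |a - b| / (1 - c) := by
  have hc := h.one_sub_pos
  have key : ∀ x y : ℝ, 1 - c ≤ x → 1 - c ≤ y → Real.log x - Real.log y ≤ |x - y| / (1 - c) := by
    intro x y hx hy
    have hx0 : 0 < x := hc.trans_le hx
    have hy0 : 0 < y := hc.trans_le hy
    rw [← Real.log_div hx0.ne' hy0.ne']
    refine (Real.log_le_sub_one_of_pos (div_pos hx0 hy0)).trans ?_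
    have : x / y - 1 = (x - y) / y := by field_simp
    rw [this]
    calc (x - y) / y ≤ |x - y| / y := by gcongr; exact le_abs_self _
      _ ≤ |x - y| / (1 - c) := by gcongr
  rw [abs_le]
  have h1 := key a b ha hb
  have h2 := key b a hb ha
  rw [abs_sub_comm] at h2
  constructor <;> linarith

theorem abs_log_le (h : IsNearUniform q L c) {a : ℝ} (ha : 1 - c ≤ a) (ha' : a ≤ 1 + c) :
    |Real.log a| ≤ c / (1 - c) := by
  have := h.abs_log_sub_log_le ha (b := 1) (by linarith [h.c_nonneg])
  rw [Real.log_one, sub_zero] at this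
  refine this.trans ?_
  have hc := h.one_sub_pos
  gcongr
  rw [abs_le]
  constructor <;> linarith

theorem law_closedBall_bounds (h : IsNearUniform q L c) {z : Fin d → ℝ} (hz : z ∈ openCube d)
    {r : ℝ} (hr : 0 ≤ r) {a b : ℝ} (hb0 : 0 ≤ a)
    (hab : ∀ w ∈ Metric.closedBall z r ∩ openCube d, a ≤ q w ∧ q w ≤ b) :
    a * cellVolume z r ≤ (densityLaw q).real (Metric.closedBall z r) ∧
      (densityLaw q).real (Metric.closedBall z r) ≤ b * cellVolume z r := by
  have hP := h.isProbabilityMeasure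
  have hV : 0 ≤ cellVolume z r := Finset.prod_nonneg fun j _ => cellSide_nonneg hz hr j
  have hms : MeasurableSet (Metric.closedBall z r ∩ openCube d) :=
    measurableSet_closedBall.inter measurableSet_openCube
  have hb0' : 0 ≤ b := by
    have := hab z ⟨Metric.mem_closedBall_self hr, hz⟩
    linarith
  have e := h.law_apply (A := Metric.closedBall z r) measurableSet_closedBall
  have lo : ENNReal.ofReal (a * cellVolume z r) ≤ densityLaw q (Metric.closedBall z r) := by
    rw [e, ENNReal.ofReal_mul hb0, ← volume_closedBall_inter_openCube hz hr, ← setLIntegral_const]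
    exact setLIntegral_mono' hms fun w hw => ENNReal.ofReal_le_ofReal (hab w hw).1
  have hi : densityLaw q (Metric.closedBall z r) ≤ ENNReal.ofReal (b * cellVolume z r) := by
    rw [e, ENNReal.ofReal_mul hb0', ← volume_closedBall_inter_openCube hz hr, ← setLIntegral_const]
    exact setLIntegral_mono' hms fun w hw => ENNReal.ofReal_le_ofReal (hab w hw).2
  rw [← ofReal_measureReal] at lo hi
  exact ⟨(ENNReal.ofReal_le_ofReal_iff measureReal_nonneg).1 lo,
    (ENNReal.ofReal_le_ofReal_iff (mul_nonneg hb0' hV)).1 hi⟩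

theorem law_closedBall_bounds_const (h : IsNearUniform q L c) {z : Fin d → ℝ}
    (hz : z ∈ openCube d) {r : ℝ} (hr : 0 ≤ r) :
    (1 - c) * cellVolume z r ≤ (densityLaw q).real (Metric.closedBall z r) ∧
      (densityLaw q).real (Metric.closedBall z r) ≤ (1 + c) * cellVolume z r :=
  h.law_closedBall_bounds hz hr h.one_sub_pos.le fun _ hw => ⟨h.one_sub_le hw.2, h.le_one_add hw.2⟩

/-- Mass over volume is an average of `q` over the cell, and `log` is `1/(1-c)`-Lipschitz on `[1-c,
∞)`. The first bound serves integrability and second moments; the second carries the factor `L`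
needed for the bias. -/
theorem abs_log_law_sub_log_cellVolume (h : IsNearUniform q L c) {z : Fin d → ℝ}
    (hz : z ∈ openCube d) {r : ℝ} (hr : 0 < r) :
    |Real.log ((densityLaw q).real (Metric.closedBall z r)) - Real.log (cellVolume z r)|
      ≤ c / (1 - c) ∧
    |Real.log ((densityLaw q).real (Metric.closedBall z r)) - Real.log (cellVolume z r)
      - Real.log (q z)| ≤ L / (1 - c) * r := by
  have hV := cellVolume_pos hz hr
  have hc := h.one_sub_pos
  obtain ⟨h1, h2⟩ := h.law_closedBall_bounds_const hz hr.le
  rw [← le_div_iff₀ hV] at h1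
  rw [← div_le_iff₀ hV] at h2
  have hm : 0 < (densityLaw q).real (Metric.closedBall z r) := by
    have := hc.trans_le h1
    exact (div_pos_iff_of_pos_right hV).1 this
  rw [← Real.log_div hm.ne' hV.ne']
  refine ⟨h.abs_log_le h1 h2, (h.abs_log_sub_log_le h1 (h.one_sub_le hz)).trans ?_⟩
  rw [div_mul_eq_mul_div]
  gcongr
  have hlip : ∀ w ∈ Metric.closedBall z r ∩ openCube d, |q w - q z| ≤ L * r := fun w hw =>
    (h.lipschitz w hw.2 z hz).trans (mul_le_mul_of_nonneg_left hw.1 h.nonneg)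
  rw [abs_le]
  constructor
  -- A negative lower bound for the density is truncated by `ENNReal.ofReal`, but is also trivially
  -- below the mass ratio.
  · rcases le_or_gt 0 (q z - L * r) with h0 | h0
    · have := (h.law_closedBall_bounds hz hr.le (a := q z - L * r) (b := q z + L * r) h0 fun w hw => by
        have := abs_le.1 (hlip w hw)
        constructor <;> linarith).1
      rw [← le_div_iff₀ hV] at this
      linarith
    · linarith
  · have := (h.law_closedBall_bounds hz hr.le (a := 0) (b := q z + L * r) le_rfl fun w hw => by
      have := abs_le.1 (hlip w hw)
      have := h.one_sub_le hw.2
      constructor <;> linarith).2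
    rw [← div_le_iff₀ hV] at this
    linarith

theorem pow_le_law (h : IsNearUniform q L c) {z : Fin d → ℝ} (hz : z ∈ openCube d)
    {r : ℝ} (hr : 0 ≤ r) (hr1 : r ≤ 1) :
    (1 - c) * r ^ d ≤ (densityLaw q).real (Metric.closedBall z r) :=
  (mul_le_mul_of_nonneg_left (pow_le_cellVolume hz hr hr1) h.one_sub_pos.le).trans
    (h.law_closedBall_bounds_const hz hr).1

/-- Spheres are Lebesgue-null. In dimension zero the sphere of radius zero would be the whole space.
-/
theorem law_dist_eq (hd : 1 ≤ d) (z : Fin d → ℝ) (r : ℝ) :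
    densityLaw q {w | dist z w = r} = 0 := by
  have : Nonempty (Fin d) := ⟨⟨0, hd⟩⟩
  have h1 : {w : Fin d → ℝ | dist z w = r} = Metric.sphere z r := by
    ext w
    rw [Metric.mem_sphere, dist_comm w z]
    rfl
  rw [h1]
  exact withDensity_absolutelyContinuous _ _ (Measure.addHaar_sphere _ _ _)

/-- The mass of the ball around `z` that reaches to the `k`-th nearest of `n` sample points is
distributed as the `k`-th smallest of `n` uniform variables. -/
theorem isUniformOrderStat (h : IsNearUniform q L c) (hd : 1 ≤ d) (z : Fin d → ℝ) {n k : ℕ}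
    (hk : 1 ≤ k) (hkn : k ≤ n) :
    IsUniformOrderStat (Measure.pi fun _ : Fin n => densityLaw q)
      (fun y => (densityLaw q).real
        (Metric.closedBall z (kthSmallest Finset.univ k (fun l => dist z (y l))))) n k := by
  have := h.isProbabilityMeasure
  have h1 := isUniformOrderStat_kthSmallest (P := densityLaw q) (W := fun w => dist z w)
    (by fun_prop) (law_dist_eq hd z) hk hkn
  convert h1 using 4
  ext w
  rw [Metric.mem_closedBall, dist_comm]
  rfl

end IsNearUniform

end NearUniform

/-! ### Measurability of radii and cell volumes -/

section Measurability

theorem kthSmallest_map {ι κ : Type*} (s : Finset ι) (e : ι ↪ κ) (k : ℕ) (v : κ → ℝ) :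
    kthSmallest (s.map e) k v = kthSmallest s k (fun l => v (e l)) := by
  simp only [kthSmallest, Finset.filter_map, Finset.card_map]
  rfl

theorem measurable_kthSmallest {ι Ω : Type*} [MeasurableSpace Ω] {s : Finset ι} {k : ℕ}
    (hk : 1 ≤ k) (hs : k ≤ s.card) {v : Ω → ι → ℝ} (hv : ∀ l, Measurable fun ω => v ω l) :
    Measurable fun ω => kthSmallest s k (v ω) := by
  refine measurable_of_Iic fun t => ?_
  have h1 : (fun ω => kthSmallest s k (v ω)) ⁻¹' Set.Iic t =
      (fun ω => (s.filter (fun l => v ω l ≤ t)).card) ⁻¹' Set.Ici k := by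
    ext ω
    simp only [Set.mem_preimage, Set.mem_Iic, Set.mem_Ici]
    exact kthSmallest_le_iff hk hs
  rw [h1]
  have : Measurable fun ω => (s.filter (fun l => v ω l ≤ t)).card := by
    simp_rw [Finset.card_filter]
    refine Finset.measurable_sum _ fun l _ => ?_
    exact Measurable.ite (measurableSet_le (hv l) measurable_const) measurable_const
      measurable_const
  exact this measurableSet_Ici

theorem measurable_cellVolume {d : ℕ} {Ω : Type*} [MeasurableSpace Ω] {z : Ω → Fin d → ℝ}
    {r : Ω → ℝ} (hz : Measurable z) (hr : Measurable r) :
    Measurable fun ω => cellVolume (z ω) (r ω) := by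
  unfold cellVolume cellSide
  fun_prop

end Measurability

/-! ### The cell around a fixed centre -/

namespace IsNearUniform

variable {d : ℕ} {q : (Fin d → ℝ) → ℝ} {L c : ℝ} {n k : ℕ}

/-- A bound for the second moment of `log (N V)`, where `V` is the volume of a `k`-NN cell. -/
def sqLogBound (k : ℕ) (c : ℝ) : ℝ := 2 * (4 * k + 2) + 2 * (c / (1 - c)) ^ 2

theorem sqLogBound_nonneg (k : ℕ) (c : ℝ) : 0 ≤ sqLogBound k c := by
  unfold sqLogBound
  positivity

theorem ae_pi_mem_openCube {ι : Type*} [Fintype ι] (h : IsNearUniform q L c) :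
    ∀ᵐ y ∂(Measure.pi fun _ : ι => densityLaw q), ∀ l, y l ∈ openCube d := by
  have := h.isProbabilityMeasure
  rw [ae_all_iff]
  intro l
  exact (measurePreserving_eval (fun _ : ι => densityLaw q) l).quasiMeasurePreserving.ae
    h.ae_mem_openCube

/-- A radius of zero would make the mass of the ball zero, since points are null, but that mass is
almost surely positive. The upper bound is the diameter of the cube. -/
theorem ae_radius (h : IsNearUniform q L c) (hd : 1 ≤ d) {z : Fin d → ℝ} (hz : z ∈ openCube d)
    (hk : 1 ≤ k) (hkn : k ≤ n) :
    ∀ᵐ y ∂(Measure.pi fun _ : Fin n => densityLaw q),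
      0 < kthSmallest Finset.univ k (fun l => dist z (y l)) ∧
        kthSmallest Finset.univ k (fun l => dist z (y l)) ≤ 1 := by
  have := h.isProbabilityMeasure
  filter_upwards [(h.isUniformOrderStat hd z hk hkn).ae_pos, h.ae_pi_mem_openCube] with y h1 h2
  obtain ⟨l, -, hl⟩ := exists_kthSmallest_eq (fun l => dist z (y l)) hk
    (show k ≤ (Finset.univ : Finset (Fin n)).card by simpa using hkn)
  rw [hl] at h1 ⊢
  refine ⟨lt_of_le_of_ne dist_nonneg fun h0 => ?_, dist_le_one_of_mem_openCube hz (h2 l)⟩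
  rw [← h0, measureReal_def] at h1
  have e : Metric.closedBall z 0 = {w | dist z w = 0} := by
    ext w
    simp [eq_comm]
  rw [e, law_dist_eq hd z 0] at h1
  simp at h1

theorem measurable_radius (z : Fin d → ℝ) (hk : 1 ≤ k) (hkn : k ≤ n) :
    Measurable fun y : Fin n → Fin d → ℝ => kthSmallest Finset.univ k (fun l => dist z (y l)) :=
  measurable_kthSmallest hk (by simpa using hkn) fun l => by fun_prop

theorem integrable_log_cellVolume (h : IsNearUniform q L c) (hd : 1 ≤ d) {z : Fin d → ℝ}
    (hz : z ∈ openCube d) (hk : 1 ≤ k) (hkn : k ≤ n) :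
    Integrable (fun y => Real.log (cellVolume z (kthSmallest Finset.univ k (fun l => dist z (y l)))))
      (Measure.pi fun _ : Fin n => densityLaw q) := by
  have := h.isProbabilityMeasure
  have hU := h.isUniformOrderStat hd z hk hkn
  refine Integrable.mono' (hU.integrable_log.norm.add (integrable_const (c / (1 - c)))) ?_ ?_
  · exact (Real.measurable_log.comp
      (measurable_cellVolume measurable_const (measurable_radius z hk hkn))).aestronglyMeasurable
  · filter_upwards [h.ae_radius hd hz hk hkn] with y hy
    have := (h.abs_log_law_sub_log_cellVolume hz hy.1).1
    simp only [Real.norm_eq_abs, Pi.add_apply]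
    rw [abs_sub_comm] at this
    have h2 := abs_sub_abs_le_abs_sub
      (Real.log (cellVolume z (kthSmallest Finset.univ k (fun l => dist z (y l)))))
      (Real.log ((densityLaw q).real
        (Metric.closedBall z (kthSmallest Finset.univ k (fun l => dist z (y l))))))
    linarith

/-- Jensen for `r ↦ r ^ d`, combined with `(1 - c) R ^ d ≤ U` and `E U = k / (n + 1)` for the mass
`U` of the ball. -/
theorem integral_radius_le (h : IsNearUniform q L c) (hd : 1 ≤ d) {z : Fin d → ℝ}
    (hz : z ∈ openCube d) (hk : 1 ≤ k) (hkn : k ≤ n) :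
    Integrable (fun y => kthSmallest Finset.univ k (fun l => dist z (y l)))
      (Measure.pi fun _ : Fin n => densityLaw q) ∧
    ∫ y, kthSmallest Finset.univ k (fun l => dist z (y l))
      ∂(Measure.pi fun _ : Fin n => densityLaw q) ≤
        (1 / (1 - c)) ^ (1 / (d : ℝ)) * ((k : ℝ) / (n + 1 : ℕ)) ^ (1 / (d : ℝ)) := by
  have := h.isProbabilityMeasure
  have hU := h.isUniformOrderStat hd z hk hkn
  have hc := h.one_sub_pos
  set R : (Fin n → Fin d → ℝ) → ℝ := fun y => kthSmallest Finset.univ k (fun l => dist z (y l))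
  have hRm : Measurable R := measurable_radius z hk hkn
  have hR := h.ae_radius hd hz hk hkn
  have hRi : Integrable R (Measure.pi fun _ : Fin n => densityLaw q) := by
    refine Integrable.of_bound hRm.aestronglyMeasurable 1 ?_
    filter_upwards [hR] with y hy
    rw [Real.norm_eq_abs, abs_of_pos hy.1]
    exact hy.2
  have hRdi : Integrable (fun y => R y ^ d) (Measure.pi fun _ : Fin n => densityLaw q) := by
    refine Integrable.of_bound (hRm.pow_const d).aestronglyMeasurable 1 ?_
    filter_upwards [hR] with y hy
    have := hy.1
    rw [Real.norm_eq_abs, abs_of_pos (pow_pos hy.1 d)]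
    exact pow_le_one₀ hy.1.le hy.2
  refine ⟨hRi, ?_⟩
  have h0 : 0 ≤ ∫ y, R y ∂(Measure.pi fun _ : Fin n => densityLaw q) :=
    integral_nonneg_of_ae (by filter_upwards [hR] with y hy using hy.1.le)
  have hJ : (∫ y, R y ∂(Measure.pi fun _ : Fin n => densityLaw q)) ^ d ≤
      ∫ y, R y ^ d ∂(Measure.pi fun _ : Fin n => densityLaw q) :=
    (convexOn_pow d).map_integral_le (continuous_pow d).continuousOn isClosed_Ici
      (by filter_upwards [hR] with y hy using hy.1.le) hRi hRdi
  have hB : ∫ y, R y ^ d ∂(Measure.pi fun _ : Fin n => densityLaw q) ≤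
      (1 / (1 - c)) * ((k : ℝ) / (n + 1 : ℕ)) := by
    have e := hU.integral_eq
    have : ∫ y, (1 - c) * R y ^ d ∂(Measure.pi fun _ : Fin n => densityLaw q) ≤
        k / (n + 1 : ℝ) := by
      rw [← e]
      refine integral_mono_ae (hRdi.const_mul _) hU.integrable ?_
      filter_upwards [hR] with y hy
      exact h.pow_le_law hz hy.1.le hy.2
    rw [integral_const_mul] at this
    rw [div_mul_eq_mul_div, one_mul, le_div_iff₀ hc]
    push_cast
    linarith
  have hd0 : (d : ℝ) ≠ 0 := by exact_mod_cast (by omega : d ≠ 0)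
  rw [← Real.mul_rpow (by positivity) (by positivity)]
  calc ∫ y, R y ∂(Measure.pi fun _ : Fin n => densityLaw q)
      = ((∫ y, R y ∂(Measure.pi fun _ : Fin n => densityLaw q)) ^ d) ^ (1 / (d : ℝ)) := by
        rw [← Real.rpow_natCast, ← Real.rpow_mul h0, mul_one_div_cancel hd0, Real.rpow_one]
    _ ≤ _ := by
        gcongr
        exact hJ.trans hB

/-- The bias of the `k`-NN cell at a given point. -/
theorem abs_integral_log_cellVolume_le (h : IsNearUniform q L c) (hd : 1 ≤ d) {z : Fin d → ℝ}
    (hz : z ∈ openCube d) (hk : 1 ≤ k) (hkn : k ≤ n) :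
    |∫ y, Real.log (cellVolume z (kthSmallest Finset.univ k (fun l => dist z (y l))))
      ∂(Measure.pi fun _ : Fin n => densityLaw q) + Real.log (q z)
      - (digamma k - digamma (n + 1 : ℕ))| ≤
      L / (1 - c) * ((1 / (1 - c)) ^ (1 / (d : ℝ)) * ((k : ℝ) / (n + 1 : ℕ)) ^ (1 / (d : ℝ))) := by
  have := h.isProbabilityMeasure
  have hU := h.isUniformOrderStat hd z hk hkn
  have hc := h.one_sub_pos
  have hL := h.nonneg
  obtain ⟨hRi, hR⟩ := h.integral_radius_le hd hz hk hkn
  have hV := h.integrable_log_cellVolume hd hz hk hkn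
  have e := hU.integral_log
  have e' : digamma k - digamma (n + 1 : ℕ) - ∫ y, Real.log (cellVolume z
      (kthSmallest Finset.univ k (fun l => dist z (y l))))
      ∂(Measure.pi fun _ : Fin n => densityLaw q) - Real.log (q z) =
      ∫ y, (Real.log ((densityLaw q).real
        (Metric.closedBall z (kthSmallest Finset.univ k (fun l => dist z (y l))))) -
        Real.log (cellVolume z (kthSmallest Finset.univ k (fun l => dist z (y l)))) -
        Real.log (q z)) ∂(Measure.pi fun _ : Fin n => densityLaw q) := by
    have hUV : Integrable (fun y => Real.log ((densityLaw q).real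
        (Metric.closedBall z (kthSmallest Finset.univ k (fun l => dist z (y l))))) -
        Real.log (cellVolume z (kthSmallest Finset.univ k (fun l => dist z (y l)))))
        (Measure.pi fun _ : Fin n => densityLaw q) := hU.integrable_log.sub hV
    rw [integral_sub hUV (integrable_const _), integral_sub hU.integrable_log hV, e]
    simp
  -- The digamma difference is exactly the mean of the logarithm of the mass, so the bias is the
  -- mean of a quantity bounded pointwise by `L / (1 - c)` times the radius.
  rw [abs_sub_comm, ← sub_sub, e']
  refine abs_integral_le_integral_abs.trans ?_
  calc _ ≤ ∫ y, L / (1 - c) * kthSmallest Finset.univ k (fun l => dist z (y l))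
        ∂(Measure.pi fun _ : Fin n => densityLaw q) := by
        refine integral_mono_ae ((hU.integrable_log.sub hV).sub (integrable_const _)).abs
          (hRi.const_mul _) ?_
        filter_upwards [h.ae_radius hd hz hk hkn] with y hy
        exact (h.abs_log_law_sub_log_cellVolume hz hy.1).2
    _ ≤ _ := by
        rw [integral_const_mul]
        gcongr

/-- Writes `log (N V)` as `log (N U)`, with `U` the mass of the ball, plus an error bounded by `c /
(1 - c)`. The result does not depend on `n` or `z`. -/
theorem lintegral_sq_log_cellVolume_le (h : IsNearUniform q L c) (hd : 1 ≤ d) {z : Fin d → ℝ}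
    (hz : z ∈ openCube d) (hk : 1 ≤ k) (hkn : k ≤ n) :
    ∫⁻ y, ENNReal.ofReal (Real.log (((n + 1 : ℕ) : ℝ) *
      cellVolume z (kthSmallest Finset.univ k (fun l => dist z (y l)))) ^ 2)
      ∂(Measure.pi fun _ : Fin n => densityLaw q) ≤ ENNReal.ofReal (sqLogBound k c) := by
  have := h.isProbabilityMeasure
  have hU := h.isUniformOrderStat hd z hk hkn
  have hm := hU.measurable
  set U : (Fin n → Fin d → ℝ) → ℝ := fun y => (densityLaw q).real
    (Metric.closedBall z (kthSmallest Finset.univ k (fun l => dist z (y l)))) with hUdef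
  calc _ ≤ ∫⁻ y, (ENNReal.ofReal 2 * ENNReal.ofReal (Real.log ((n + 1 : ℝ) * U y) ^ 2) +
        ENNReal.ofReal (2 * (c / (1 - c)) ^ 2)) ∂(Measure.pi fun _ : Fin n => densityLaw q) := by
        refine lintegral_mono_ae ?_
        filter_upwards [h.ae_radius hd hz hk hkn, hU.ae_pos] with y hy hU0
        rw [← ENNReal.ofReal_mul zero_le_two, ← ENNReal.ofReal_add (by positivity) (by positivity)]
        apply ENNReal.ofReal_le_ofReal
        have h1 := (h.abs_log_law_sub_log_cellVolume hz hy.1).1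
        have hV := cellVolume_pos hz hy.1
        have hn : (0 : ℝ) < n + 1 := by positivity
        push_cast
        rw [Real.log_mul hn.ne' hV.ne', Real.log_mul hn.ne' hU0.ne']
        have h2 := sq_le_sq' (abs_le.1 h1).1 (abs_le.1 h1).2
        have h3 := add_sq_le (a := Real.log (n + 1 : ℝ) + Real.log (U y))
          (b := Real.log (cellVolume z (kthSmallest Finset.univ k (fun l => dist z (y l))))
            - Real.log (U y))
        have h4 : (Real.log (cellVolume z (kthSmallest Finset.univ k (fun l => dist z (y l))))
            - Real.log (U y)) ^ 2 ≤ (c / (1 - c)) ^ 2 := by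
          rw [← neg_sq, neg_sub]; exact h2
        calc _ = (Real.log (n + 1 : ℝ) + Real.log (U y) + (Real.log (cellVolume z
              (kthSmallest Finset.univ k (fun l => dist z (y l)))) - Real.log (U y))) ^ 2 := by ring
          _ ≤ _ := h3
          _ ≤ _ := by linarith
    _ ≤ _ := by
        rw [lintegral_add_right _ measurable_const, lintegral_const_mul _ (by fun_prop), sqLogBound,
          ENNReal.ofReal_add (by positivity) (by positivity), lintegral_const, measure_univ, mul_one]
        gcongr
        rw [ENNReal.ofReal_mul zero_le_two]
        gcongr
        exact hU.lintegral_sq_log_le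

end IsNearUniform

/-! ### Nearest-neighbour cells within a sample -/

section Sample

variable {d N : ℕ}

/-- The distance from the `i`-th point to its `k`-th nearest neighbour in the sample. -/
def knnRadius (k : ℕ) (z : Fin N → Fin d → ℝ) (i : Fin N) : ℝ :=
  kthSmallest (Finset.univ.erase i) k (fun l => dist (z i) (z l))

/-- The volume of the `k`-NN cell of the `i`-th point, truncated to the unit cube. -/
def knnVolume (k : ℕ) (z : Fin N → Fin d → ℝ) (i : Fin N) : ℝ :=
  cellVolume (z i) (knnRadius k z i)

theorem knnEps_eq (k : ℕ) (z : Fin N → Fin d → ℝ) (i : Fin N) :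
    knnEps k z i = 2 * knnRadius k z i := by
  unfold knnEps knnRadius kthSmallest
  congr 3
  ext r
  have : (Finset.univ.filter (fun l => l ≠ i ∧ dist (z i) (z l) ≤ r)) =
      (Finset.univ.erase i).filter (fun l => dist (z i) (z l) ≤ r) := by
    ext l
    simp
  rw [this]

theorem truncSide_eq (k : ℕ) (z : Fin N → Fin d → ℝ) (i : Fin N) (j : Fin d) :
    truncSide k z i j = cellSide (z i) (knnRadius k z i) j := by
  rw [truncSide, cellSide, knnEps_eq, mul_div_cancel_left₀ _ two_ne_zero]

theorem kthSmallest_congr {ι : Type*} {s : Finset ι} {k : ℕ} {v w : ι → ℝ}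
    (h : ∀ l ∈ s, v l = w l) : kthSmallest s k v = kthSmallest s k w := by
  unfold kthSmallest
  congr 2
  ext r
  rw [Finset.filter_congr fun l hl => by rw [h l hl]]

theorem measurable_knnRadius {k : ℕ} (hk : 1 ≤ k) (hkN : k < N) (i : Fin N) :
    Measurable fun z : Fin N → Fin d → ℝ => knnRadius k z i :=
  measurable_kthSmallest hk
    (by rw [Finset.card_erase_of_mem (Finset.mem_univ i), Finset.card_univ, Fintype.card_fin]; omega)
    fun l => by fun_prop

theorem measurable_knnVolume {k : ℕ} (hk : 1 ≤ k) (hkN : k < N) (i : Fin N) :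
    Measurable fun z : Fin N → Fin d → ℝ => knnVolume k z i :=
  measurable_cellVolume (measurable_pi_apply i) (measurable_knnRadius hk hkN i)

theorem measurable_tKL {k : ℕ} (hk : 1 ≤ k) (hkN : k < N) :
    Measurable fun z : Fin N → Fin d → ℝ => tKL k z := by
  unfold tKL
  simp_rw [truncSide_eq]
  unfold cellSide
  have := fun i => measurable_knnRadius (d := d) hk hkN i
  fun_prop

/-- Relabels the other points by `Fin n`, so that given the `i`-th point they form an independent
sample of size `n`. -/
theorem knnRadius_succAbove {n : ℕ} (k : ℕ) (z : Fin (n + 1) → Fin d → ℝ) (i : Fin (n + 1)) :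
    knnRadius k z i =
      kthSmallest Finset.univ k (fun l => dist (z i) (z (i.succAbove l))) := by
  have : (Finset.univ.erase i) = Finset.univ.map (Fin.succAboveEmb i) := by
    ext l
    simp [Fin.exists_succAbove_eq_iff]
  rw [knnRadius, this, kthSmallest_map]
  rfl

theorem measurePreserving_succAbove {E : Type*} [MeasurableSpace E] (ν : Measure E)
    [IsProbabilityMeasure ν] {n : ℕ} (i : Fin (n + 1)) :
    MeasurePreserving (fun z : Fin (n + 1) → E => (z i, fun l => z (i.succAbove l)))
      (Measure.pi fun _ => ν) (ν.prod (Measure.pi fun _ => ν)) :=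
  measurePreserving_piFinSuccAbove (fun _ : Fin (n + 1) => ν) i

end Sample

/-! ### Averaging over the centre of the cell -/

namespace IsNearUniform

variable {d : ℕ} {q : (Fin d → ℝ) → ℝ} {L c : ℝ} {N k : ℕ}

theorem measurable_log_cell (hk : 1 ≤ k) {n : ℕ} (hkn : k ≤ n) (a : ℝ) :
    Measurable fun p : (Fin d → ℝ) × (Fin n → Fin d → ℝ) => Real.log (a *
      cellVolume p.1 (kthSmallest Finset.univ k (fun l => dist p.1 (p.2 l)))) := by
  have : Measurable fun p : (Fin d → ℝ) × (Fin n → Fin d → ℝ) =>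
      cellVolume p.1 (kthSmallest Finset.univ k (fun l => dist p.1 (p.2 l))) :=
    measurable_cellVolume measurable_fst
      (measurable_kthSmallest hk (by simpa using hkn) fun l => by fun_prop)
  fun_prop

theorem ae_knnRadius_pos (h : IsNearUniform q L c) (hd : 1 ≤ d) (hk : 1 ≤ k) (hkN : k < N)
    (i : Fin N) : ∀ᵐ z ∂(Measure.pi fun _ : Fin N => densityLaw q), 0 < knnRadius k z i := by
  have := h.isProbabilityMeasure
  obtain ⟨n, rfl⟩ : ∃ n, N = n + 1 := ⟨N - 1, by omega⟩
  have hkn : k ≤ n := by omega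
  simp_rw [knnRadius_succAbove]
  have h1 : ∀ᵐ p ∂((densityLaw q).prod (Measure.pi fun _ : Fin n => densityLaw q)),
      0 < kthSmallest Finset.univ k (fun l => dist p.1 (p.2 l)) := by
    have hms : MeasurableSet {p : (Fin d → ℝ) × (Fin n → Fin d → ℝ) |
        0 < kthSmallest Finset.univ k (fun l => dist p.1 (p.2 l))} :=
      measurableSet_lt measurable_const
        (measurable_kthSmallest hk (by simpa using hkn) fun l => by fun_prop)
    refine (Measure.ae_prod_iff_ae_ae hms).2 ?_
    filter_upwards [h.ae_mem_openCube] with w hw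
    filter_upwards [h.ae_radius hd hw hk hkn] with y hy using hy.1
  exact (measurePreserving_succAbove (densityLaw q) i).quasiMeasurePreserving.ae h1

theorem lintegral_sq_log_knnVolume_le (h : IsNearUniform q L c) (hd : 1 ≤ d) (hk : 1 ≤ k)
    (hkN : k < N) (i : Fin N) :
    ∫⁻ z, ENNReal.ofReal (Real.log ((N : ℝ) * knnVolume k z i) ^ 2)
      ∂(Measure.pi fun _ : Fin N => densityLaw q) ≤ ENNReal.ofReal (sqLogBound k c) := by
  have := h.isProbabilityMeasure
  obtain ⟨n, rfl⟩ : ∃ n, N = n + 1 := ⟨N - 1, by omega⟩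
  have hkn : k ≤ n := by omega
  simp_rw [knnVolume, knnRadius_succAbove]
  have hm : Measurable fun p : (Fin d → ℝ) × (Fin n → Fin d → ℝ) =>
      ENNReal.ofReal (Real.log (((n + 1 : ℕ) : ℝ) *
        cellVolume p.1 (kthSmallest Finset.univ k (fun l => dist p.1 (p.2 l)))) ^ 2) :=
    ((measurable_log_cell hk hkn _).pow_const 2).ennreal_ofReal
  rw [(measurePreserving_succAbove (densityLaw q) i).lintegral_comp hm,
    lintegral_prod _ hm.aemeasurable]
  calc _ ≤ ∫⁻ _w, ENNReal.ofReal (sqLogBound k c) ∂(densityLaw q) := by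
        refine lintegral_mono_ae ?_
        filter_upwards [h.ae_mem_openCube] with w hw
        exact h.lintegral_sq_log_cellVolume_le hd hw hk hkn
    _ = _ := by simp

theorem memLp_log_knnVolume (h : IsNearUniform q L c) (hd : 1 ≤ d) (hk : 1 ≤ k)
    (hkN : k < N) (i : Fin N) :
    MemLp (fun z => Real.log ((N : ℝ) * knnVolume k z i)) 2
      (Measure.pi fun _ : Fin N => densityLaw q) ∧
    ∫ z, Real.log ((N : ℝ) * knnVolume k z i) ^ 2
      ∂(Measure.pi fun _ : Fin N => densityLaw q) ≤ sqLogBound k c := by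
  have hl := h.lintegral_sq_log_knnVolume_le hd hk hkN i
  have hm : Measurable fun z : Fin N → Fin d → ℝ => Real.log ((N : ℝ) * knnVolume k z i) := by
    have := measurable_knnVolume (d := d) hk hkN i
    fun_prop
  have hi : Integrable (fun z : Fin N → Fin d → ℝ => Real.log ((N : ℝ) * knnVolume k z i) ^ 2)
      (Measure.pi fun _ : Fin N => densityLaw q) := by
    refine ⟨(hm.pow_const 2).aestronglyMeasurable, ?_⟩
    rw [hasFiniteIntegral_iff_ofReal (ae_of_all _ fun z => sq_nonneg _)]
    exact hl.trans_lt ENNReal.ofReal_lt_top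
  refine ⟨(memLp_two_iff_integrable_sq hm.aestronglyMeasurable).2 hi, ?_⟩
  rw [← ofReal_integral_eq_lintegral_ofReal hi (ae_of_all _ fun z => sq_nonneg _)] at hl
  exact (ENNReal.ofReal_le_ofReal_iff (sqLogBound_nonneg k c)).1 hl

theorem ae_log_mul_knnVolume (h : IsNearUniform q L c) (hd : 1 ≤ d) (hk : 1 ≤ k)
    (hkN : k < N) (i : Fin N) : ∀ᵐ z ∂(Measure.pi fun _ : Fin N => densityLaw q),
      Real.log ((N : ℝ) * knnVolume k z i) = Real.log N + Real.log (knnVolume k z i) := by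
  filter_upwards [h.ae_knnRadius_pos hd hk hkN i, h.ae_pi_mem_openCube] with z hr hz
  have hN : (N : ℝ) ≠ 0 := by exact_mod_cast (by omega : N ≠ 0)
  exact Real.log_mul hN (cellVolume_pos (hz i) hr).ne'

theorem integrable_log_knnVolume (h : IsNearUniform q L c) (hd : 1 ≤ d) (hk : 1 ≤ k)
    (hkN : k < N) (i : Fin N) :
    Integrable (fun z => Real.log (knnVolume k z i))
      (Measure.pi fun _ : Fin N => densityLaw q) := by
  have := h.isProbabilityMeasure
  refine (((h.memLp_log_knnVolume hd hk hkN i).1.integrable one_le_two).sub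
    (integrable_const (Real.log N))).congr ?_
  filter_upwards [h.ae_log_mul_knnVolume hd hk hkN i] with z hz
  simp [hz]

theorem integrable_log_density (h : IsNearUniform q L c) :
    Integrable (fun z => Real.log (q z)) (densityLaw q) := by
  have := h.isProbabilityMeasure
  refine Integrable.of_bound (Real.measurable_log.comp h.measurable).aestronglyMeasurable
    (c / (1 - c)) ?_
  filter_upwards [h.ae_mem_openCube] with z hz
  exact h.abs_log_le (h.one_sub_le hz) (h.le_one_add hz)

/-- Conditioning on the `i`-th point reduces this to the bias at a fixed centre; with `N = n + 1`
the order statistic of `N - 1` points yields `ψ(N)`. -/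
theorem abs_integral_log_knnVolume_le (h : IsNearUniform q L c) (hd : 1 ≤ d) (hk : 1 ≤ k)
    (hkN : k < N) (i : Fin N) :
    |∫ z, Real.log (knnVolume k z i) ∂(Measure.pi fun _ : Fin N => densityLaw q)
      + ∫ w, Real.log (q w) ∂(densityLaw q) - (digamma k - digamma N)| ≤
      L / (1 - c) * ((1 / (1 - c)) ^ (1 / (d : ℝ)) * ((k : ℝ) / N) ^ (1 / (d : ℝ))) := by
  have := h.isProbabilityMeasure
  have hint := h.integrable_log_knnVolume hd hk hkN i
  obtain ⟨n, rfl⟩ : ∃ n, N = n + 1 := ⟨N - 1, by omega⟩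
  have hkn : k ≤ n := by omega
  have hmp := measurePreserving_succAbove (densityLaw q) i
  simp_rw [knnVolume, knnRadius_succAbove] at hint ⊢
  have hm : Measurable fun p : (Fin d → ℝ) × (Fin n → Fin d → ℝ) => Real.log
      (cellVolume p.1 (kthSmallest Finset.univ k (fun l => dist p.1 (p.2 l)))) := by
    simpa using measurable_log_cell hk hkn 1
  have hint' := (hmp.integrable_comp hm.aestronglyMeasurable).1 hint
  have e1 : ∫ z : Fin (n + 1) → Fin d → ℝ, Real.log (cellVolume (z i)
      (kthSmallest Finset.univ k (fun l => dist (z i) (z (i.succAbove l)))))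
      ∂(Measure.pi fun _ => densityLaw q) =
      ∫ w, ∫ y, Real.log (cellVolume w (kthSmallest Finset.univ k (fun l => dist w (y l))))
        ∂(Measure.pi fun _ : Fin n => densityLaw q) ∂(densityLaw q) := by
    rw [← integral_prod _ hint', ← hmp.map_eq, integral_map hmp.measurable.aemeasurable
      hm.aestronglyMeasurable]
  rw [e1]
  have e2 : ∫ w, ∫ y, Real.log (cellVolume w (kthSmallest Finset.univ k (fun l => dist w (y l))))
        ∂(Measure.pi fun _ : Fin n => densityLaw q) ∂(densityLaw q)
      + ∫ w, Real.log (q w) ∂(densityLaw q) - (digamma k - digamma (n + 1 : ℕ)) =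
      ∫ w, (∫ y, Real.log (cellVolume w (kthSmallest Finset.univ k (fun l => dist w (y l))))
        ∂(Measure.pi fun _ : Fin n => densityLaw q) + Real.log (q w)
          - (digamma k - digamma (n + 1 : ℕ))) ∂(densityLaw q) := by
    have i1 : Integrable (fun w => ∫ y, Real.log (cellVolume w
        (kthSmallest Finset.univ k (fun l => dist w (y l))))
        ∂(Measure.pi fun _ : Fin n => densityLaw q)) (densityLaw q) := hint'.integral_prod_left
    have i2 : Integrable (fun w => ∫ y, Real.log (cellVolume w
        (kthSmallest Finset.univ k (fun l => dist w (y l))))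
        ∂(Measure.pi fun _ : Fin n => densityLaw q) + Real.log (q w)) (densityLaw q) :=
      i1.add h.integrable_log_density
    rw [integral_sub i2 (integrable_const _), integral_add i1 h.integrable_log_density]
    simp
  rw [e2, ← Real.norm_eq_abs]
  refine (norm_integral_le_of_norm_le_const (C := L / (1 - c) * ((1 / (1 - c)) ^ (1 / (d : ℝ)) *
    ((k : ℝ) / (n + 1 : ℕ)) ^ (1 / (d : ℝ)))) ?_).trans (by simp)
  filter_upwards [h.ae_mem_openCube] with w hw
  exact h.abs_integral_log_cellVolume_le hd hw hk hkn

end IsNearUniform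

/-! ### The estimator and its leave-one-out versions -/

section Estimator

variable {d N : ℕ}

/-- The truncated Kozachenko-Leonenko estimator, with the empirical mean of `J` added. -/
def correctedTKL (k : ℕ) (J : (Fin d → ℝ) → ℝ) (z : Fin N → Fin d → ℝ) : ℝ :=
  tKL k z + (1 / (N : ℝ)) * ∑ i, J (z i)

/-- The volume of the `k`-NN cell of the `i`-th point when the `j`-th point is left out. -/
def leaveOneOutVolume (k : ℕ) (j : Fin N) (z : Fin N → Fin d → ℝ) (i : Fin N) : ℝ :=
  cellVolume (z i) (kthSmallest ((Finset.univ.erase i).erase j) k (fun l => dist (z i) (z l)))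

/-- The estimator from the sample without its `j`-th point, on the scale of the full sample. -/
def leaveOneOut (k : ℕ) (J : (Fin d → ℝ) → ℝ) (j : Fin N) (z : Fin N → Fin d → ℝ) : ℝ :=
  -digamma k + digamma N + (1 / (N : ℝ)) *
    (∑ i ∈ Finset.univ.erase j, (Real.log (leaveOneOutVolume k j z i) + J (z i)) - Real.log N)

theorem correctedTKL_eq {k : ℕ} (J : (Fin d → ℝ) → ℝ) {z : Fin N → Fin d → ℝ}
    (hz : ∀ i, z i ∈ openCube d) (hr : ∀ i, 0 < knnRadius k z i) :
    correctedTKL k J z = -digamma k + digamma N +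
      (1 / (N : ℝ)) * ∑ i, (Real.log (knnVolume k z i) + J (z i)) := by
  rw [correctedTKL, tKL, Finset.sum_add_distrib, mul_add, ← add_assoc]
  congr 3
  refine Finset.sum_congr rfl fun i _ => ?_
  simp_rw [truncSide_eq]
  rw [knnVolume, log_cellVolume (hz i) (hr i)]

theorem measurable_correctedTKL {k : ℕ} (hk : 1 ≤ k) (hkN : k < N) {J : (Fin d → ℝ) → ℝ}
    (hJ : Measurable J) : Measurable (correctedTKL (N := N) k J) := by
  have := measurable_tKL (d := d) hk hkN
  unfold correctedTKL
  fun_prop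

theorem leaveOneOut_update (k : ℕ) (J : (Fin d → ℝ) → ℝ) (j : Fin N) (z : Fin N → Fin d → ℝ)
    (w : Fin d → ℝ) : leaveOneOut k J j (Function.update z j w) = leaveOneOut k J j z := by
  unfold leaveOneOut leaveOneOutVolume
  congr 3
  refine Finset.sum_congr rfl fun i hi => ?_
  rw [Function.update_of_ne (Finset.ne_of_mem_erase hi)]
  congr 3
  refine kthSmallest_congr fun l hl => ?_
  rw [Function.update_of_ne (Finset.ne_of_mem_erase hl)]

theorem measurable_leaveOneOut {k : ℕ} (hk : 1 ≤ k) (hkN : k + 1 < N) {J : (Fin d → ℝ) → ℝ}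
    (hJ : Measurable J) (j : Fin N) : Measurable (leaveOneOut k J j) := by
  have h1 : ∀ i ∈ Finset.univ.erase j,
      Measurable fun z : Fin N → Fin d → ℝ => leaveOneOutVolume k j z i := by
    intro i hi
    refine measurable_cellVolume (measurable_pi_apply i)
      (measurable_kthSmallest hk ?_ fun l => by fun_prop)
    rw [Finset.card_erase_of_mem (Finset.mem_erase.2
      ⟨(Finset.ne_of_mem_erase hi).symm, Finset.mem_univ j⟩),
      Finset.card_erase_of_mem (Finset.mem_univ i), Finset.card_univ, Fintype.card_fin]
    omega
  unfold leaveOneOut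
  refine measurable_const.add (measurable_const.mul (Measurable.sub ?_ measurable_const))
  refine Finset.measurable_sum _ fun i hi => ?_
  have := h1 i hi
  fun_prop

/-- The indices whose `k`-NN cell can change when the `j`-th point is left out. -/
def nearIndices (k : ℕ) (z : Fin N → Fin d → ℝ) (j : Fin N) : Finset (Fin N) :=
  (Finset.univ.erase j).filter (fun i =>
    (((Finset.univ.erase i).erase j).filter
      (fun l => dist (z i) (z l) ≤ dist (z i) (z j))).card < k)

theorem card_nearIndices_le (k : ℕ) (z : Fin N → Fin d → ℝ) (j : Fin N) :
    (nearIndices k z j).card ≤ k * 2 ^ d :=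
  card_filter_isNearNeighbour_le k z j

theorem card_filter_mem_nearIndices_le (k : ℕ) (z : Fin N → Fin d → ℝ) (i : Fin N) :
    (Finset.univ.filter (fun j => i ∈ nearIndices k z j)).card ≤ k := by
  refine le_trans (Finset.card_le_card fun j hj => ?_)
    (card_filter_rank_lt_le (Finset.univ.erase i) k (fun l => dist (z i) (z l)))
  have h1 := Finset.mem_filter.1 (Finset.mem_filter.1 hj).2
  exact Finset.mem_filter.2 ⟨Finset.mem_erase.2
    ⟨(Finset.ne_of_mem_erase h1.1).symm, Finset.mem_univ j⟩, h1.2⟩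

/-- Deleting `z j` removes one summand and changes only the cells indexed by `nearIndices`. A
changed radius lies between the `k`-NN and `(k+1)`-NN radii, so its log-volume moves by at most the
gap between the two. Cauchy–Schwarz over at most `k * 2 ^ d` indices gives the factor. -/
theorem sq_sub_leaveOneOut_le {k : ℕ} (hk : 1 ≤ k) (hkN : k + 1 < N) (J : (Fin d → ℝ) → ℝ)
    {z : Fin N → Fin d → ℝ} (hz : ∀ i, z i ∈ openCube d) (hr : ∀ i, 0 < knnRadius k z i)
    (j : Fin N) :
    (correctedTKL k J z - leaveOneOut k J j z) ^ 2 ≤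
      2 / (N : ℝ) ^ 2 * ((Real.log N + Real.log (knnVolume k z j) + J (z j)) ^ 2 +
        k * 2 ^ d * ∑ i ∈ nearIndices k z j,
          (Real.log (knnVolume (k + 1) z i) - Real.log (knnVolume k z i)) ^ 2) := by
  have hN : (0 : ℝ) < N := by exact_mod_cast (by omega : 0 < N)
  have hcard : ∀ i : Fin N, k + 1 ≤ (Finset.univ.erase i : Finset (Fin N)).card := fun i => by
    rw [Finset.card_erase_of_mem (Finset.mem_univ i), Finset.card_univ, Fintype.card_fin]
    omega
  set W : Fin N → ℝ := fun i =>
    Real.log (knnVolume k z i) - Real.log (leaveOneOutVolume k j z i) with hW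
  have hW0 : ∀ i ∈ Finset.univ.erase j, i ∉ nearIndices k z j → W i = 0 := by
    intro i hi hni
    have h1 : k ≤ (((Finset.univ.erase i).erase j).filter
        (fun l => dist (z i) (z l) ≤ dist (z i) (z j))).card := by
      by_contra! hlt
      exact hni (Finset.mem_filter.2 ⟨hi, hlt⟩)
    have h2 := kthSmallest_erase_eq (fun l => dist (z i) (z l)) hk (hcard i) j h1
    simp only [hW, knnVolume, leaveOneOutVolume, knnRadius, h2, sub_self]
  have hW1 : ∀ i, W i ^ 2 ≤
      (Real.log (knnVolume (k + 1) z i) - Real.log (knnVolume k z i)) ^ 2 := by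
    intro i
    have a1 := kthSmallest_le_erase (fun l => dist (z i) (z l)) hk (hcard i) j
    have a2 := kthSmallest_erase_le_succ (fun l => dist (z i) (z l)) hk (hcard i) j
    have b0 := cellVolume_pos (hz i) (hr i)
    have b1 := cellVolume_mono (hz i) (hr i).le a1
    have b2 := cellVolume_mono (hz i) ((hr i).le.trans a1) a2
    have c1 : Real.log (knnVolume k z i) ≤ Real.log (leaveOneOutVolume k j z i) :=
      Real.log_le_log b0 b1
    have c2 : Real.log (leaveOneOutVolume k j z i) ≤ Real.log (knnVolume (k + 1) z i) :=
      Real.log_le_log (b0.trans_le b1) b2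
    rw [← neg_sq (W i)]
    refine pow_le_pow_left₀ ?_ ?_ 2 <;> simp only [hW] <;> linarith
  -- The `- log N` in `leaveOneOut` stands in for the deleted log-volume, leaving `log (N V_j) + J
  -- (z j)`, whose second moment stays bounded in `N`.
  have hdiff : correctedTKL k J z - leaveOneOut k J j z = (1 / (N : ℝ)) *
      ((Real.log N + Real.log (knnVolume k z j) + J (z j)) + ∑ i ∈ nearIndices k z j, W i) := by
    have e1 : ∑ i ∈ nearIndices k z j, W i = ∑ i ∈ Finset.univ.erase j, W i :=
      Finset.sum_subset (Finset.filter_subset _ _) hW0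
    rw [correctedTKL_eq J hz hr, leaveOneOut, e1, ← Finset.add_sum_erase _ _ (Finset.mem_univ j)]
    simp only [hW, Finset.sum_sub_distrib, Finset.sum_add_distrib]
    ring
  have hcs : (∑ i ∈ nearIndices k z j, W i) ^ 2 ≤ k * 2 ^ d * ∑ i ∈ nearIndices k z j,
      (Real.log (knnVolume (k + 1) z i) - Real.log (knnVolume k z i)) ^ 2 := by
    refine sq_sum_le_card_mul_sum_sq.trans ?_
    have : ((nearIndices k z j).card : ℝ) ≤ k * 2 ^ d := by exact_mod_cast card_nearIndices_le k z j
    gcongr ?_ * ?_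
    exact Finset.sum_le_sum fun i _ => hW1 i
  rw [hdiff, mul_pow, one_div, inv_pow, div_eq_inv_mul, mul_assoc]
  gcongr
  refine add_sq_le.trans ?_
  gcongr

/-- Double counting: exchanging the sums, each `i` lies in `nearIndices k z j` for at most `k`
values of `j`. This supplies the second factor `k`. -/
theorem sum_sq_sub_leaveOneOut_le {k : ℕ} (hk : 1 ≤ k) (hkN : k + 1 < N) (J : (Fin d → ℝ) → ℝ)
    {z : Fin N → Fin d → ℝ} (hz : ∀ i, z i ∈ openCube d) (hr : ∀ i, 0 < knnRadius k z i) :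
    ∑ j, (correctedTKL k J z - leaveOneOut k J j z) ^ 2 ≤
      2 / (N : ℝ) ^ 2 * ∑ i, ((Real.log N + Real.log (knnVolume k z i) + J (z i)) ^ 2 +
        k ^ 2 * 2 ^ d * (Real.log (knnVolume (k + 1) z i) - Real.log (knnVolume k z i)) ^ 2) := by
  refine (Finset.sum_le_sum fun j _ => sq_sub_leaveOneOut_le hk hkN J hz hr j).trans ?_
  rw [← Finset.mul_sum]
  refine mul_le_mul_of_nonneg_left ?_ (by positivity)
  rw [Finset.sum_add_distrib, Finset.sum_add_distrib]
  refine add_le_add le_rfl ?_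
  rw [← Finset.mul_sum, ← Finset.mul_sum]
  set W : Fin N → ℝ := fun i =>
    (Real.log (knnVolume (k + 1) z i) - Real.log (knnVolume k z i)) ^ 2 with hW
  have hswap : ∑ j, ∑ i ∈ nearIndices k z j, W i =
      ∑ i, (Finset.univ.filter (fun j => i ∈ nearIndices k z j)).card * W i := by
    rw [Finset.sum_comm' (t' := Finset.univ)
      (s' := fun i => Finset.univ.filter (fun j => i ∈ nearIndices k z j)) (by simp)]
    simp
  have hle : ∑ j, ∑ i ∈ nearIndices k z j, W i ≤ k * ∑ i, W i := by
    rw [hswap, Finset.mul_sum]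
    refine Finset.sum_le_sum fun i _ => ?_
    have : ((Finset.univ.filter (fun j => i ∈ nearIndices k z j)).card : ℝ) ≤ k := by
      exact_mod_cast card_filter_mem_nearIndices_le k z i
    exact mul_le_mul_of_nonneg_right this (sq_nonneg _)
  calc _ ≤ (k : ℝ) * 2 ^ d * (k * ∑ i, W i) := by gcongr
    _ = _ := by ring

end Estimator

/-! ### Bias and variance for a nearly uniform density -/

namespace IsNearUniform

open ProbabilityTheory

variable {d : ℕ} {q : (Fin d → ℝ) → ℝ} {L c : ℝ} {N k : ℕ} {J : (Fin d → ℝ) → ℝ}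

theorem ae_correctedTKL_eq (h : IsNearUniform q L c) (hd : 1 ≤ d) (hk : 1 ≤ k) (hkN : k < N) :
    ∀ᵐ z ∂(Measure.pi fun _ : Fin N => densityLaw q), correctedTKL k J z =
      -digamma k + digamma N + (1 / (N : ℝ)) * ∑ i, (Real.log (knnVolume k z i) + J (z i)) := by
  filter_upwards [ae_all_iff.2 (h.ae_knnRadius_pos hd hk hkN), h.ae_pi_mem_openCube] with z hr hz
  exact correctedTKL_eq J hz hr

theorem integral_pi_eval (h : IsNearUniform q L c) (hJ : Integrable J (densityLaw q)) (i : Fin N) :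
    Integrable (fun z : Fin N → Fin d → ℝ => J (z i)) (Measure.pi fun _ => densityLaw q) ∧
      ∫ z : Fin N → Fin d → ℝ, J (z i) ∂(Measure.pi fun _ => densityLaw q) =
        ∫ w, J w ∂(densityLaw q) := by
  have := h.isProbabilityMeasure
  have hmp := measurePreserving_eval (fun _ : Fin N => densityLaw q) i
  refine ⟨hmp.integrable_comp_of_integrable hJ, ?_⟩
  have hm : AEStronglyMeasurable J ((Measure.pi fun _ : Fin N => densityLaw q).map
    (Function.eval i)) := by rw [hmp.map_eq]; exact hJ.1
  conv_rhs => rw [← hmp.map_eq]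
  rw [integral_map hmp.measurable.aemeasurable hm]

theorem integrable_correctedTKL (h : IsNearUniform q L c) (hd : 1 ≤ d) (hk : 1 ≤ k) (hkN : k < N)
    (hJ : Integrable J (densityLaw q)) :
    Integrable (correctedTKL k J) (Measure.pi fun _ : Fin N => densityLaw q) := by
  have := h.isProbabilityMeasure
  have h1 : Integrable (fun z : Fin N → Fin d → ℝ => -digamma k + digamma N +
      (1 / (N : ℝ)) * ∑ i, (Real.log (knnVolume k z i) + J (z i)))
      (Measure.pi fun _ : Fin N => densityLaw q) :=
    (integrable_const _).add ((integrable_finsetSum _ fun i _ =>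
      (h.integrable_log_knnVolume hd hk hkN i).add (h.integral_pi_eval hJ i).1).const_mul _)
  refine h1.congr ?_
  filter_upwards [h.ae_correctedTKL_eq hd hk hkN (J := J)] with z hz using hz.symm

/-- The bias of the truncated Kozachenko-Leonenko estimator for a nearly uniform density. -/
theorem abs_integral_correctedTKL_le (h : IsNearUniform q L c) (hd : 1 ≤ d) (hk : 1 ≤ k)
    (hkN : k < N) (hJ : Integrable J (densityLaw q)) :
    |∫ z, correctedTKL k J z ∂(Measure.pi fun _ : Fin N => densityLaw q)
      - (∫ w, J w ∂(densityLaw q) - ∫ w, Real.log (q w) ∂(densityLaw q))| ≤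
      L / (1 - c) * ((1 / (1 - c)) ^ (1 / (d : ℝ)) * ((k : ℝ) / N) ^ (1 / (d : ℝ))) := by
  have := h.isProbabilityMeasure
  have hN : (0 : ℝ) < N := by exact_mod_cast (by omega : 0 < N)
  have hi : ∀ i : Fin N, Integrable (fun z => Real.log (knnVolume k z i) + J (z i))
      (Measure.pi fun _ : Fin N => densityLaw q) := fun i =>
    (h.integrable_log_knnVolume hd hk hkN i).add (h.integral_pi_eval hJ i).1
  have e1 : ∫ z, correctedTKL k J z ∂(Measure.pi fun _ : Fin N => densityLaw q)
      - (∫ w, J w ∂(densityLaw q) - ∫ w, Real.log (q w) ∂(densityLaw q)) =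
      (1 / (N : ℝ)) * ∑ i : Fin N, (∫ z, Real.log (knnVolume k z i)
        ∂(Measure.pi fun _ : Fin N => densityLaw q) + ∫ w, Real.log (q w) ∂(densityLaw q)
        - (digamma k - digamma N)) := by
    rw [integral_congr_ae (h.ae_correctedTKL_eq hd hk hkN), integral_add (integrable_const _)
      ((integrable_finsetSum _ fun i _ => hi i).const_mul _), integral_const_mul,
      integral_finsetSum _ fun i _ => hi i]
    simp_rw [fun i : Fin N => integral_add (h.integrable_log_knnVolume hd hk hkN i)
      (h.integral_pi_eval hJ i).1, fun i : Fin N => (h.integral_pi_eval hJ i).2]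
    simp only [Finset.sum_add_distrib, Finset.sum_sub_distrib, Finset.sum_const, Finset.card_univ,
      Fintype.card_fin, nsmul_eq_mul, integral_const, probReal_univ, one_smul]
    field_simp
    ring
  rw [e1, abs_mul, abs_of_pos (by positivity)]
  calc _ ≤ (1 / (N : ℝ)) * ∑ i : Fin N,
        (L / (1 - c) * ((1 / (1 - c)) ^ (1 / (d : ℝ)) * ((k : ℝ) / N) ^ (1 / (d : ℝ)))) := by
        gcongr
        exact (Finset.abs_sum_le_sum_abs _ _).trans
          (Finset.sum_le_sum fun i _ => h.abs_integral_log_knnVolume_le hd hk hkN i)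
    _ = _ := by
        rw [Finset.sum_const, Finset.card_univ, Fintype.card_fin, nsmul_eq_mul, ← mul_assoc,
          one_div_mul_cancel hN.ne', one_mul]

/-- A constant such that the variance of the estimator is at most `varianceBound d k c m / N`,
where `m` bounds the second moment of the correction term. -/
def varianceBound (d k : ℕ) (c m : ℝ) : ℝ :=
  (k + 3) * (2 * sqLogBound k c + 2 * m) +
    2 * (k ^ 2 * 2 ^ d * (2 * sqLogBound (k + 1) c + 2 * sqLogBound k c))

theorem memLp_eval (h : IsNearUniform q L c) (hJ : MemLp J 2 (densityLaw q)) (i : Fin N) :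
    MemLp (fun z : Fin N → Fin d → ℝ => J (z i)) 2 (Measure.pi fun _ => densityLaw q) := by
  have := h.isProbabilityMeasure
  exact hJ.comp_measurePreserving (measurePreserving_eval (fun _ : Fin N => densityLaw q) i)

theorem integral_sq_add_le {α : Type*} [MeasurableSpace α] {μ : Measure α} {f g : α → ℝ}
    (hf : MemLp f 2 μ) (hg : MemLp g 2 μ) {a b : ℝ} (ha : ∫ x, f x ^ 2 ∂μ ≤ a)
    (hb : ∫ x, g x ^ 2 ∂μ ≤ b) :
    ∫ x, (f x + g x) ^ 2 ∂μ ≤ 2 * a + 2 * b := by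
  calc ∫ x, (f x + g x) ^ 2 ∂μ ≤ ∫ x, (2 * f x ^ 2 + 2 * g x ^ 2) ∂μ := by
        refine integral_mono (hf.add hg).integrable_sq
          ((hf.integrable_sq.const_mul 2).add (hg.integrable_sq.const_mul 2)) fun x => ?_
        have := add_sq_le (a := f x) (b := g x)
        show _ ≤ _ * _ + _
        linarith
    _ ≤ 2 * a + 2 * b := by
        rw [integral_add (hf.integrable_sq.const_mul 2) (hg.integrable_sq.const_mul 2),
          integral_const_mul, integral_const_mul]
        linarith

theorem memLp_correctedTKL (h : IsNearUniform q L c) (hd : 1 ≤ d) (hk : 1 ≤ k)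
    (hkN : k < N) (hJ : MemLp J 2 (densityLaw q)) :
    MemLp (correctedTKL k J) 2 (Measure.pi fun _ : Fin N => densityLaw q) := by
  have := h.isProbabilityMeasure
  have hT : ∀ i : Fin N, MemLp (fun z => Real.log ((N : ℝ) * knnVolume k z i) + J (z i)) 2
      (Measure.pi fun _ : Fin N => densityLaw q) := fun i =>
    (h.memLp_log_knnVolume hd hk hkN i).1.add (h.memLp_eval hJ i)
  have hS : MemLp (fun z : Fin N → Fin d → ℝ =>
      ∑ i, (Real.log ((N : ℝ) * knnVolume k z i) + J (z i))) 2
      (Measure.pi fun _ : Fin N => densityLaw q) := memLp_finsetSum _ fun i _ => hT i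
  have h1 : MemLp (fun z : Fin N → Fin d → ℝ => (-digamma k + digamma N - Real.log N) +
      (1 / (N : ℝ)) * ∑ i, (Real.log ((N : ℝ) * knnVolume k z i) + J (z i))) 2
      (Measure.pi fun _ : Fin N => densityLaw q) :=
    (memLp_const (-digamma k + digamma N - Real.log N)).add (hS.const_mul (1 / (N : ℝ)))
  refine h1.ae_eq ?_
  have hN : (N : ℝ) ≠ 0 := by exact_mod_cast (by omega : N ≠ 0)
  filter_upwards [h.ae_correctedTKL_eq hd hk hkN (J := J),
    ae_all_iff.2 (h.ae_log_mul_knnVolume hd hk hkN)] with z hz hl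
  rw [hz]
  simp_rw [hl]
  simp only [Finset.sum_add_distrib, Finset.sum_const, Finset.card_univ,
      Fintype.card_fin, nsmul_eq_mul]
  field_simp
  ring

/-- The variance of the truncated Kozachenko-Leonenko estimator for a nearly uniform density. -/
theorem evariance_correctedTKL_le (h : IsNearUniform q L c) (hd : 1 ≤ d) (hk : 1 ≤ k)
    (hkN : k < N) (hJm : Measurable J) (hJ : MemLp J 2 (densityLaw q)) {m : ℝ}
    (hm : ∫ w, J w ^ 2 ∂(densityLaw q) ≤ m) :
    evariance (correctedTKL k J) (Measure.pi fun _ : Fin N => densityLaw q) ≤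
      ENNReal.ofReal (varianceBound d k c m * (1 / (N : ℝ))) := by
  have := h.isProbabilityMeasure
  have hN : (0 : ℝ) < N := by exact_mod_cast (by omega : 0 < N)
  have hm0 : 0 ≤ m := (integral_nonneg fun _ => sq_nonneg _).trans hm
  have hB := sqLogBound_nonneg k c
  have hB' := sqLogBound_nonneg (k + 1) c
  have hX := fun i : Fin N => h.memLp_log_knnVolume hd hk hkN i
  have hT : ∀ i : Fin N, MemLp (fun z => Real.log ((N : ℝ) * knnVolume k z i) + J (z i)) 2
      (Measure.pi fun _ : Fin N => densityLaw q) := fun i =>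
    (hX i).1.add (h.memLp_eval hJ i)
  have hT2 : ∀ i : Fin N, ∫ z, (Real.log ((N : ℝ) * knnVolume k z i) + J (z i)) ^ 2
      ∂(Measure.pi fun _ : Fin N => densityLaw q) ≤ 2 * sqLogBound k c + 2 * m := fun i =>
    integral_sq_add_le (hX i).1 (h.memLp_eval hJ i) (hX i).2
      ((h.integral_pi_eval hJ.integrable_sq i).2.le.trans hm)
  have hf := h.memLp_correctedTKL hd hk hkN hJ
  -- If `N = k + 1`, a sample with one point deleted has no `k`-th neighbours, and the plain
  -- second-moment bound is used instead, with `1 = (k + 1) / N`. The factor `k + 3` in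
  -- `varianceBound` dominates both the `2` of the first case and the `k + 1` of the second.
  rcases Nat.lt_or_ge (k + 1) N with hkN' | hkN'
  · have hY := fun i : Fin N => h.memLp_log_knnVolume hd (Nat.succ_pos k) hkN' i
    have hW : ∀ i : Fin N, MemLp (fun z => Real.log ((N : ℝ) * knnVolume (k + 1) z i) +
        -Real.log ((N : ℝ) * knnVolume k z i)) 2 (Measure.pi fun _ : Fin N => densityLaw q) :=
      fun i => (hY i).1.add (hX i).1.neg
    have hW2 : ∀ i : Fin N, ∫ z, (Real.log ((N : ℝ) * knnVolume (k + 1) z i) +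
        -Real.log ((N : ℝ) * knnVolume k z i)) ^ 2
        ∂(Measure.pi fun _ : Fin N => densityLaw q) ≤
        2 * sqLogBound (k + 1) c + 2 * sqLogBound k c := fun i => by
      refine integral_sq_add_le (hY i).1 (hX i).1.neg (hY i).2 ?_
      simpa using (hX i).2
    refine (evariance_pi_le (densityLaw q) N _ (measurable_correctedTKL hk hkN hJm) hf
      (leaveOneOut k J) (measurable_leaveOneOut hk hkN' hJm) (leaveOneOut_update k J)).trans ?_
    rw [← lintegral_finsetSum _ fun j _ => by
      have h1 := measurable_correctedTKL hk hkN hJm (d := d)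
      have h2 := measurable_leaveOneOut hk hkN' hJm j
      fun_prop]
    have hint : ∀ i : Fin N, Integrable (fun z =>
        (Real.log ((N : ℝ) * knnVolume k z i) + J (z i)) ^ 2 +
        k ^ 2 * 2 ^ d * (Real.log ((N : ℝ) * knnVolume (k + 1) z i) +
        -Real.log ((N : ℝ) * knnVolume k z i)) ^ 2)
        (Measure.pi fun _ : Fin N => densityLaw q) := fun i =>
      (hT i).integrable_sq.add ((hW i).integrable_sq.const_mul _)
    calc _ ≤ ∫⁻ z, ENNReal.ofReal (2 / (N : ℝ) ^ 2 * ∑ i : Fin N,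
          ((Real.log ((N : ℝ) * knnVolume k z i) + J (z i)) ^ 2 +
          k ^ 2 * 2 ^ d * (Real.log ((N : ℝ) * knnVolume (k + 1) z i) +
          -Real.log ((N : ℝ) * knnVolume k z i)) ^ 2))
          ∂(Measure.pi fun _ : Fin N => densityLaw q) := by
          refine lintegral_mono_ae ?_
          filter_upwards [ae_all_iff.2 (h.ae_knnRadius_pos hd hk hkN), h.ae_pi_mem_openCube,
            ae_all_iff.2 (h.ae_log_mul_knnVolume hd hk hkN),
            ae_all_iff.2 (h.ae_log_mul_knnVolume hd (Nat.succ_pos k) hkN')] with z hr hz hl hl'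
          rw [← ENNReal.ofReal_sum_of_nonneg fun j _ => sq_nonneg _]
          refine ENNReal.ofReal_le_ofReal ((sum_sq_sub_leaveOneOut_le hk hkN' J hz hr).trans
            (le_of_eq ?_))
          congr 1
          refine Finset.sum_congr rfl fun i _ => ?_
          rw [hl i, hl' i]
          ring
      _ ≤ _ := by
          rw [← ofReal_integral_eq_lintegral_ofReal
            ((integrable_finsetSum _ fun i _ => hint i).const_mul _)
            (ae_of_all _ fun z => by simp only [Pi.zero_apply]; positivity)]
          apply ENNReal.ofReal_le_ofReal
          rw [integral_const_mul, integral_finsetSum _ fun i _ => hint i]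
          have hle : ∀ i ∈ (Finset.univ : Finset (Fin N)), ∫ z,
              ((Real.log ((N : ℝ) * knnVolume k z i) + J (z i)) ^ 2 +
              k ^ 2 * 2 ^ d * (Real.log ((N : ℝ) * knnVolume (k + 1) z i) +
              -Real.log ((N : ℝ) * knnVolume k z i)) ^ 2)
              ∂(Measure.pi fun _ : Fin N => densityLaw q) ≤
              (2 * sqLogBound k c + 2 * m) +
                k ^ 2 * 2 ^ d * (2 * sqLogBound (k + 1) c + 2 * sqLogBound k c) := by
            intro i _
            rw [integral_add (hT i).integrable_sq ((hW i).integrable_sq.const_mul _),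
              integral_const_mul]
            gcongr
            · exact hT2 i
            · exact hW2 i
          refine (mul_le_mul_of_nonneg_left (Finset.sum_le_sum hle) (by positivity)).trans ?_
          rw [Finset.sum_const, Finset.card_univ, Fintype.card_fin, nsmul_eq_mul, varianceBound]
          have e : 2 / (N : ℝ) ^ 2 * (N * ((2 * sqLogBound k c + 2 * m) +
              k ^ 2 * 2 ^ d * (2 * sqLogBound (k + 1) c + 2 * sqLogBound k c))) =
              (2 * (2 * sqLogBound k c + 2 * m) + 2 *
              (k ^ 2 * 2 ^ d * (2 * sqLogBound (k + 1) c + 2 * sqLogBound k c))) * (1 / N) := by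
            field_simp
          rw [e]
          gcongr
          have : (0 : ℝ) ≤ k := Nat.cast_nonneg k
          linarith
  · have hNk : N = k + 1 := by omega
    refine (evariance_le_lintegral_sq_sub hf (-digamma k + digamma N - Real.log N)).trans ?_
    calc _ ≤ ∫⁻ z, ENNReal.ofReal ((1 / (N : ℝ)) * ∑ i : Fin N,
          (Real.log ((N : ℝ) * knnVolume k z i) + J (z i)) ^ 2)
          ∂(Measure.pi fun _ : Fin N => densityLaw q) := by
          refine lintegral_mono_ae ?_
          filter_upwards [h.ae_correctedTKL_eq hd hk hkN (J := J),
            ae_all_iff.2 (h.ae_log_mul_knnVolume hd hk hkN)] with z hz hl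
          apply ENNReal.ofReal_le_ofReal
          have e : correctedTKL k J z - (-digamma k + digamma N - Real.log N) =
              (1 / (N : ℝ)) * ∑ i, (Real.log ((N : ℝ) * knnVolume k z i) + J (z i)) := by
            rw [hz]
            simp_rw [hl]
            simp only [Finset.sum_add_distrib, Finset.sum_const, Finset.card_univ,
              Fintype.card_fin, nsmul_eq_mul]
            field_simp
            ring
          rw [e, mul_pow]
          have := sq_sum_le_card_mul_sum_sq (s := (Finset.univ : Finset (Fin N)))
            (f := fun i => Real.log ((N : ℝ) * knnVolume k z i) + J (z i))
          rw [Finset.card_univ, Fintype.card_fin] at this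
          calc _ ≤ (1 / (N : ℝ)) ^ 2 * _ := mul_le_mul_of_nonneg_left this (by positivity)
            _ = _ := by field_simp
      _ ≤ _ := by
          rw [← ofReal_integral_eq_lintegral_ofReal
            ((integrable_finsetSum _ fun i _ => (hT i).integrable_sq).const_mul _)
            (ae_of_all _ fun z => by simp only [Pi.zero_apply]; positivity)]
          apply ENNReal.ofReal_le_ofReal
          rw [integral_const_mul, integral_finsetSum _ fun i _ => (hT i).integrable_sq]
          refine (mul_le_mul_of_nonneg_left (Finset.sum_le_sum fun i _ => hT2 i)
            (by positivity)).trans ?_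
          rw [Finset.sum_const, Finset.card_univ, Fintype.card_fin, nsmul_eq_mul, varianceBound,
            mul_comm (1 / (N : ℝ))]
          gcongr
          have hNk' : (N : ℝ) = k + 1 := by exact_mod_cast hNk
          rw [hNk']
          have : (0 : ℝ) ≤ k ^ 2 * 2 ^ d * (2 * sqLogBound (k + 1) c + 2 * sqLogBound k c) := by
            positivity
          nlinarith

end IsNearUniform

/-! ### A first-moment bound uniform over the density -/

namespace IsNearUniform

variable {d : ℕ} {q : (Fin d → ℝ) → ℝ} {L c : ℝ} {N k : ℕ} {J : (Fin d → ℝ) → ℝ}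

/-- The bound sees `q` only through `c` and `m`; this uniformity gives joint integrability over
training sample and sample. It rests on `|x| ≤ 1 + x²`. -/
theorem integral_abs_correctedTKL_le (h : IsNearUniform q L c) (hd : 1 ≤ d) (hk : 1 ≤ k)
    (hkN : k < N) (hJ : Integrable J (densityLaw q)) {m : ℝ}
    (hm : ∫ w, |J w| ∂(densityLaw q) ≤ m) :
    ∫ z, |correctedTKL k J z| ∂(Measure.pi fun _ : Fin N => densityLaw q) ≤
      |-digamma k + digamma N - Real.log N| + (1 + sqLogBound k c + m) := by
  have := h.isProbabilityMeasure
  have hN : (0 : ℝ) < N := by exact_mod_cast (by omega : 0 < N)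
  have hX := fun i : Fin N => h.memLp_log_knnVolume hd hk hkN i
  have hi : ∀ i : Fin N, Integrable (fun z => 1 + Real.log ((N : ℝ) * knnVolume k z i) ^ 2
      + |J (z i)|) (Measure.pi fun _ : Fin N => densityLaw q) := fun i =>
    ((integrable_const 1).add (hX i).1.integrable_sq).add (h.integral_pi_eval hJ i).1.abs
  calc _ ≤ ∫ z, (|-digamma k + digamma N - Real.log N| + (1 / (N : ℝ)) * ∑ i,
        (1 + Real.log ((N : ℝ) * knnVolume k z i) ^ 2 + |J (z i)|))
        ∂(Measure.pi fun _ : Fin N => densityLaw q) := by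
        refine integral_mono_ae (h.integrable_correctedTKL hd hk hkN hJ).abs ((integrable_const _).add
          ((integrable_finsetSum _ fun i _ => hi i).const_mul _)) ?_
        filter_upwards [h.ae_correctedTKL_eq hd hk hkN (J := J),
          ae_all_iff.2 (h.ae_log_mul_knnVolume hd hk hkN)] with z hz hl
        have e : correctedTKL k J z = (-digamma k + digamma N - Real.log N) +
            (1 / (N : ℝ)) * ∑ i, (Real.log ((N : ℝ) * knnVolume k z i) + J (z i)) := by
          rw [hz]
          simp_rw [hl]
          simp only [Finset.sum_add_distrib, Finset.sum_const, Finset.card_univ,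
            Fintype.card_fin, nsmul_eq_mul]
          field_simp
          ring
        show |correctedTKL k J z| ≤ _
        rw [e]
        refine (abs_add_le _ _).trans (add_le_add le_rfl ?_)
        rw [abs_mul, abs_of_pos (by positivity : (0 : ℝ) < 1 / N)]
        refine mul_le_mul_of_nonneg_left ((Finset.abs_sum_le_sum_abs _ _).trans
          (Finset.sum_le_sum fun i _ => (abs_add_le _ _).trans (add_le_add ?_ le_rfl)))
          (by positivity)
        set x := Real.log ((N : ℝ) * knnVolume k z i)
        nlinarith [sq_nonneg (|x| - 1), sq_abs x, abs_nonneg x]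
    _ ≤ _ := by
        rw [integral_add (integrable_const _) ((integrable_finsetSum _ fun i _ => hi i).const_mul _),
          integral_const_mul, integral_finsetSum _ fun i _ => hi i]
        simp only [integral_const, probReal_univ, one_smul]
        refine add_le_add le_rfl ?_
        have hle : ∀ i ∈ (Finset.univ : Finset (Fin N)), ∫ z, (1 +
            Real.log ((N : ℝ) * knnVolume k z i) ^ 2 + |J (z i)|)
            ∂(Measure.pi fun _ : Fin N => densityLaw q) ≤ 1 + sqLogBound k c + m := by
          intro i _
          have i1 : Integrable (fun z => 1 + Real.log ((N : ℝ) * knnVolume k z i) ^ 2)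
            (Measure.pi fun _ : Fin N => densityLaw q) :=
            (integrable_const 1).add (hX i).1.integrable_sq
          rw [integral_add i1 (h.integral_pi_eval hJ i).1.abs, integral_add (integrable_const 1)
            (hX i).1.integrable_sq, (h.integral_pi_eval hJ.abs i).2]
          have := (hX i).2
          simp only [integral_const, probReal_univ, one_smul]
          linarith
        refine (mul_le_mul_of_nonneg_left (Finset.sum_le_sum hle) (by positivity)).trans ?_
        rw [Finset.sum_const, Finset.card_univ, Fintype.card_fin, nsmul_eq_mul, ← mul_assoc,
          one_div_mul_cancel hN.ne', one_mul]

end IsNearUniform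

/-! ### Uniformizing maps and change of variables -/

namespace CubeMap

variable {d : ℕ} (f : CubeMap d)

/-- The correction term `log |det ∂f⁻¹(z)/∂z|`. -/
def logJacobian (z : Fin d → ℝ) : ℝ := Real.log |(fderiv ℝ f.inv z).det|

theorem measurable_logJacobian : Measurable f.logJacobian := by
  have h1 : Measurable fun z => (fderiv ℝ f.inv z).det :=
    ContinuousLinearMap.continuous_det.measurable.comp (measurable_fderiv ℝ f.inv)
  unfold logJacobian
  fun_prop

theorem measurable_map : Measurable f.map := f.differentiable_map.continuous.measurable

theorem umTKL_eq {N : ℕ} (k : ℕ) (x : Fin N → Fin d → ℝ) :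
    umTKL k f x = correctedTKL k f.logJacobian (fun i => f.map (x i)) := rfl

theorem differentiableAt_inv {z : Fin d → ℝ} (hz : z ∈ openCube d) :
    DifferentiableAt ℝ f.inv z :=
  (f.differentiableOn_inv z hz).differentiableAt (isOpen_openCube.mem_nhds hz)

theorem det_mul_det (x : Fin d → ℝ) :
    (fderiv ℝ f.inv (f.map x)).det * (fderiv ℝ f.map x).det = 1 := by
  have h1 := (f.differentiableAt_inv (f.map_mem x)).hasFDerivAt.comp x
    (f.differentiable_map x).hasFDerivAt
  have h2 : f.inv ∘ f.map = id := funext f.inv_map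
  rw [h2] at h1
  have h3 := h1.unique (hasFDerivAt_id x)
  have h4 : LinearMap.det ((fderiv ℝ f.inv (f.map x)).toLinearMap ∘ₗ
      (fderiv ℝ f.map x).toLinearMap) = 1 := by
    change LinearMap.det (((fderiv ℝ f.inv (f.map x)).comp (fderiv ℝ f.map x)).toLinearMap) = 1
    rw [h3]
    exact LinearMap.det_id
  rwa [LinearMap.det_comp] at h4

theorem logJacobian_map (x : Fin d → ℝ) :
    f.logJacobian (f.map x) = -Real.log |(fderiv ℝ f.map x).det| := by
  have h := f.det_mul_det x
  rw [logJacobian, eq_inv_of_mul_eq_one_left h, abs_inv, Real.log_inv]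

variable {p : (Fin d → ℝ) → ℝ}

theorem pushDensity_of_mem {z : Fin d → ℝ} (hz : z ∈ openCube d) :
    pushDensity p f z = p (f.inv z) * |(fderiv ℝ f.inv z).det| :=
  Set.indicator_of_mem hz _

/-- Differentiability of the Jacobian factor is assumed for `f`, not for `f⁻¹`; so the density is
rewritten as `p(f⁻¹ z) / |det Df(f⁻¹ z)|`, whose denominator never vanishes. -/
theorem differentiableAt_pushDensity (hp : Differentiable ℝ p) {z : Fin d → ℝ}
    (hz : z ∈ openCube d) : DifferentiableAt ℝ (pushDensity p f) z := by
  have h1 : pushDensity p f =ᶠ[𝓝 z]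
      fun w => p (f.inv w) * (|(fderiv ℝ f.map (f.inv w)).det|)⁻¹ := by
    filter_upwards [isOpen_openCube.mem_nhds hz] with w hw
    rw [f.pushDensity_of_mem hw]
    have h := f.det_mul_det (f.inv w)
    rw [f.map_inv w hw] at h
    rw [eq_inv_of_mul_eq_one_left h, abs_inv]
  refine DifferentiableAt.congr_of_eventuallyEq ?_ h1
  have hi := f.differentiableAt_inv hz
  have h2 : DifferentiableAt ℝ (fun w => |(fderiv ℝ f.map (f.inv w)).det|) z :=
    (f.differentiable_jacobian (f.inv z)).comp z hi
  refine ((hp _).comp z hi).mul (h2.inv ?_)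
  rw [abs_ne_zero]
  exact right_ne_zero_of_mul_eq_one (f.det_mul_det (f.inv z))

theorem measurable_pushDensity (hp : Differentiable ℝ p) : Measurable (pushDensity p f) := by
  classical
  have hc : ContinuousOn (pushDensity p f) (openCube d) := fun z hz =>
    (f.differentiableAt_pushDensity hp hz).continuousAt.continuousWithinAt
  have h1 : pushDensity p f = (openCube d).piecewise (pushDensity p f) 0 := by
    funext z
    by_cases hz : z ∈ openCube d
    · simp [hz]
    · simp [hz, pushDensity]
  rw [h1]
  exact hc.measurable_piecewise continuousOn_const measurableSet_openCube

theorem measurePreserving_map (hp0 : ∀ x, 0 ≤ p x) :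
    MeasurePreserving f.map (densityLaw p) (densityLaw (pushDensity p f)) := by
  refine ⟨f.measurable_map, ?_⟩
  ext A hA
  rw [Measure.map_apply f.measurable_map hA, densityLaw, densityLaw, withDensity_apply _ hA,
    withDensity_apply _ (f.measurable_map hA)]
  have h1 : f.map ⁻¹' A = f.inv '' (A ∩ openCube d) := by
    ext x
    constructor
    · intro hx
      exact ⟨f.map x, ⟨hx, f.map_mem x⟩, f.inv_map x⟩
    · rintro ⟨z, ⟨hzA, hz⟩, rfl⟩
      rwa [Set.mem_preimage, f.map_inv z hz]
  have hinj : Set.InjOn f.inv (A ∩ openCube d) := by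
    intro z hz w hw hzw
    rw [← f.map_inv z hz.2, ← f.map_inv w hw.2, hzw]
  rw [h1, lintegral_image_eq_lintegral_abs_det_fderiv_mul volume (hA.inter measurableSet_openCube)
    (fun z hz => (f.differentiableAt_inv hz.2).hasFDerivAt.hasFDerivWithinAt) hinj,
    ← lintegral_indicator hA, ← lintegral_indicator (hA.inter measurableSet_openCube)]
  refine lintegral_congr fun z => ?_
  by_cases hz : z ∈ openCube d
  · by_cases hzA : z ∈ A
    · simp only [Set.mem_inter_iff, hzA, hz, and_self, Set.indicator_of_mem]
      rw [f.pushDensity_of_mem hz, mul_comm, ENNReal.ofReal_mul (hp0 _)]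
    · simp [hzA]
  · by_cases hzA : z ∈ A <;> simp [hz, hzA, pushDensity]

/-- The mean value inequality on the convex cube: the operator norm of the derivative, for the
maximum norm, is bounded by the ℓ¹-norm of the gradient. -/
theorem isNearUniform (hp0 : ∀ x, 0 ≤ p x) (hp1 : ∫⁻ x, ENNReal.ofReal (p x) = 1)
    (hp : Differentiable ℝ p) {c : ℝ} (hc0 : 0 ≤ c) (hc1 : c < 1)
    (hc : gradSup (pushDensity p f) ≤ ENNReal.ofReal c) :
    IsNearUniform (pushDensity p f) (gradSup (pushDensity p f)).toReal c where
  measurable := f.measurable_pushDensity hp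
  zero_off z hz := Set.indicator_of_notMem hz _
  lipschitz z hz w hw := by
    have hfin : gradSup (pushDensity p f) ≠ ∞ := (hc.trans_lt ENNReal.ofReal_lt_top).ne
    rw [← Real.norm_eq_abs, dist_eq_norm]
    refine Convex.norm_image_sub_le_of_norm_fderiv_le (𝕜 := ℝ)
      (fun u hu => f.differentiableAt_pushDensity hp hu) (fun u hu => ?_) convex_openCube hw hz
    have hle : ∑ j, |fderiv ℝ (pushDensity p f) u (Pi.single j 1)| ≤
        (gradSup (pushDensity p f)).toReal := by
      rw [← ENNReal.ofReal_le_iff_le_toReal hfin]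
      exact le_iSup₂_of_le u hu le_rfl
    refine ContinuousLinearMap.opNorm_le_bound _ ENNReal.toReal_nonneg fun v => ?_
    have hv : fderiv ℝ (pushDensity p f) u v =
        ∑ j, v j * fderiv ℝ (pushDensity p f) u (Pi.single j 1) := by
      conv_lhs => rw [pi_eq_sum_univ' v]
      simp only [map_sum, map_smul, smul_eq_mul]
    rw [hv]
    refine (norm_sum_le _ _).trans ?_
    calc _ ≤ ∑ j, |fderiv ℝ (pushDensity p f) u (Pi.single j 1)| * ‖v‖ := by
          refine Finset.sum_le_sum fun j _ => ?_
          rw [norm_mul, mul_comm, Real.norm_eq_abs (fderiv _ _ _ _)]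
          exact mul_le_mul_of_nonneg_left (norm_le_pi_norm v j) (abs_nonneg _)
      _ ≤ _ := by
          rw [← Finset.sum_mul]
          gcongr
  nonneg := ENNReal.toReal_nonneg
  le := ENNReal.toReal_le_of_le_ofReal hc0 hc
  lt_one := hc1
  lintegral_eq := by
    have h1 := (f.measurePreserving_map hp0).measure_preimage MeasurableSet.univ.nullMeasurableSet
    rw [Set.preimage_univ, densityLaw, densityLaw, withDensity_apply _ MeasurableSet.univ,
      withDensity_apply _ MeasurableSet.univ, Measure.restrict_univ, hp1] at h1
    exact h1.symm

end CubeMap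

/-! ### Integration against a density -/

section DensityLaw

variable {d : ℕ} {p : (Fin d → ℝ) → ℝ}

theorem integrable_densityLaw_iff (hpm : Measurable p) (hp0 : ∀ x, 0 ≤ p x)
    (g : (Fin d → ℝ) → ℝ) : Integrable g (densityLaw p) ↔ Integrable (fun x => p x * g x) := by
  rw [densityLaw, integrable_withDensity_iff_integrable_smul' hpm.ennreal_ofReal
    (ae_of_all _ fun _ => ENNReal.ofReal_lt_top)]
  simp only [ENNReal.toReal_ofReal (hp0 _), smul_eq_mul]

theorem integral_densityLaw (hpm : Measurable p) (hp0 : ∀ x, 0 ≤ p x)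
    (g : (Fin d → ℝ) → ℝ) : ∫ x, g x ∂(densityLaw p) = ∫ x, p x * g x := by
  rw [densityLaw, integral_withDensity_eq_integral_toReal_smul hpm.ennreal_ofReal
    (ae_of_all _ fun _ => ENNReal.ofReal_lt_top)]
  simp only [ENNReal.toReal_ofReal (hp0 _), smul_eq_mul]

theorem isProbabilityMeasure_densityLaw (hp1 : ∫⁻ x, ENNReal.ofReal (p x) = 1) :
    IsProbabilityMeasure (densityLaw p) :=
  ⟨by rw [densityLaw, withDensity_apply _ MeasurableSet.univ, Measure.restrict_univ, hp1]⟩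

end DensityLaw

/-! ### Bias and mean square error for a fixed uniformizing map -/

namespace CubeMap

open ProbabilityTheory

variable {d : ℕ} {f : CubeMap d} {p : (Fin d → ℝ) → ℝ} {L c : ℝ}

/-- The transported density is at least `1 - c > 0`, so neither factor of it vanishes and the
logarithm splits at every `x`. -/
theorem logJacobian_map_eq (h : IsNearUniform (pushDensity p f) L c) (x : Fin d → ℝ) :
    f.logJacobian (f.map x) = Real.log (pushDensity p f (f.map x)) - Real.log (p x) := by
  have h1 := h.one_sub_pos.trans_le (h.one_sub_le (f.map_mem x))
  rw [f.pushDensity_of_mem (f.map_mem x), f.inv_map] at h1 ⊢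
  rw [Real.log_mul (left_ne_zero_of_mul h1.ne') (right_ne_zero_of_mul h1.ne'), logJacobian]
  ring

theorem abs_log_pushDensity_le (h : IsNearUniform (pushDensity p f) L c) (x : Fin d → ℝ) :
    |Real.log (pushDensity p f (f.map x))| ≤ c / (1 - c) :=
  h.abs_log_le (h.one_sub_le (f.map_mem x)) (h.le_one_add (f.map_mem x))

theorem integral_map_eq (hp0 : ∀ x, 0 ≤ p x) {g : (Fin d → ℝ) → ℝ} (hg : Measurable g) :
    ∫ z, g z ∂(densityLaw (pushDensity p f)) = ∫ x, g (f.map x) ∂(densityLaw p) := by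
  rw [← (f.measurePreserving_map hp0).map_eq, integral_map f.measurable_map.aemeasurable
    hg.aestronglyMeasurable]

theorem integrable_map_iff (hp0 : ∀ x, 0 ≤ p x) {g : (Fin d → ℝ) → ℝ} (hg : Measurable g) :
    Integrable g (densityLaw (pushDensity p f)) ↔
      Integrable (fun x => g (f.map x)) (densityLaw p) :=
  ((f.measurePreserving_map hp0).integrable_comp hg.aestronglyMeasurable).symm

theorem integrable_logJacobian (h : IsNearUniform (pushDensity p f) L c) (hp0 : ∀ x, 0 ≤ p x)
    (hlog : Integrable (fun x => Real.log (p x)) (densityLaw p)) :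
    Integrable f.logJacobian (densityLaw (pushDensity p f)) := by
  rw [integrable_map_iff hp0 f.measurable_logJacobian]
  simp_rw [logJacobian_map_eq h]
  have hq : Measurable fun z => Real.log (pushDensity p f z) :=
    Real.measurable_log.comp h.measurable
  exact ((integrable_map_iff hp0 hq).1 h.integrable_log_density).sub hlog

theorem integral_abs_logJacobian_le (h : IsNearUniform (pushDensity p f) L c)
    (hp0 : ∀ x, 0 ≤ p x) (hp1 : ∫⁻ x, ENNReal.ofReal (p x) = 1)
    (hlog : Integrable (fun x => Real.log (p x)) (densityLaw p)) :
    ∫ z, |f.logJacobian z| ∂(densityLaw (pushDensity p f)) ≤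
      c / (1 - c) + ∫ x, |Real.log (p x)| ∂(densityLaw p) := by
  have := isProbabilityMeasure_densityLaw hp1
  have hJ := integrable_logJacobian h hp0 hlog
  rw [integrable_map_iff hp0 f.measurable_logJacobian] at hJ
  rw [integral_map_eq hp0 f.measurable_logJacobian.abs]
  calc _ ≤ ∫ x, (c / (1 - c) + |Real.log (p x)|) ∂(densityLaw p) := by
        refine integral_mono hJ.abs ((integrable_const _).add hlog.abs) fun x => ?_
        simp only [logJacobian_map_eq h]
        exact (abs_sub _ _).trans (add_le_add (abs_log_pushDensity_le h x) le_rfl)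
    _ = _ := by
        rw [integral_add (integrable_const _) hlog.abs]
        simp

theorem memLp_logJacobian (h : IsNearUniform (pushDensity p f) L c) (hp0 : ∀ x, 0 ≤ p x)
    (hp1 : ∫⁻ x, ENNReal.ofReal (p x) = 1) (hpm : Measurable p)
    (hlog : Integrable (fun x => Real.log (p x) ^ 2) (densityLaw p)) :
    MemLp f.logJacobian 2 (densityLaw (pushDensity p f)) ∧
    ∫ z, f.logJacobian z ^ 2 ∂(densityLaw (pushDensity p f)) ≤
      2 * (c / (1 - c)) ^ 2 + 2 * ∫ x, Real.log (p x) ^ 2 ∂(densityLaw p) := by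
  have := isProbabilityMeasure_densityLaw hp1
  have hl : MemLp (fun x => Real.log (p x)) 2 (densityLaw p) :=
    (memLp_two_iff_integrable_sq (Real.measurable_log.comp hpm).aestronglyMeasurable).2 hlog
  have hqm : Measurable fun x => Real.log (pushDensity p f (f.map x)) :=
    Real.measurable_log.comp (h.measurable.comp f.measurable_map)
  have hq : MemLp (fun x => Real.log (pushDensity p f (f.map x))) 2 (densityLaw p) :=
    MemLp.of_bound hqm.aestronglyMeasurable (c / (1 - c)) (ae_of_all _ (abs_log_pushDensity_le h))
  have hq2 : ∫ x, Real.log (pushDensity p f (f.map x)) ^ 2 ∂(densityLaw p) ≤ (c / (1 - c)) ^ 2 := by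
    calc _ ≤ ∫ _x, (c / (1 - c)) ^ 2 ∂(densityLaw p) := by
          refine integral_mono hq.integrable_sq (integrable_const _) fun x => ?_
          have := abs_le.1 (abs_log_pushDensity_le h x)
          exact sq_le_sq' this.1 this.2
      _ = _ := by simp
  have he : ∀ x, f.logJacobian (f.map x) =
      Real.log (pushDensity p f (f.map x)) + -Real.log (p x) := fun x => by
    rw [logJacobian_map_eq h, sub_eq_add_neg]
  constructor
  · rw [memLp_two_iff_integrable_sq f.measurable_logJacobian.aestronglyMeasurable,
      integrable_map_iff hp0 (f.measurable_logJacobian.pow_const 2)]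
    simp_rw [he]
    exact (hq.add hl.neg).integrable_sq
  · rw [integral_map_eq hp0 (f.measurable_logJacobian.pow_const 2)]
    simp_rw [he]
    refine IsNearUniform.integral_sq_add_le hq hl.neg hq2 ?_
    simp

/-- The `log q` terms cancel after pulling back to `x`. Hence the quantity around which the
estimator on the cube is centred is the entropy of `p` itself. -/
theorem integral_logJacobian_sub (h : IsNearUniform (pushDensity p f) L c) (hp0 : ∀ x, 0 ≤ p x)
    (hpm : Measurable p) (hlog : Integrable (fun x => Real.log (p x)) (densityLaw p)) :
    ∫ z, f.logJacobian z ∂(densityLaw (pushDensity p f)) -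
      ∫ z, Real.log (pushDensity p f z) ∂(densityLaw (pushDensity p f)) = entropy p := by
  have hq : Measurable fun z => Real.log (pushDensity p f z) :=
    Real.measurable_log.comp h.measurable
  rw [integral_map_eq hp0 f.measurable_logJacobian, integral_map_eq hp0 hq]
  simp_rw [logJacobian_map_eq h]
  rw [integral_sub ((integrable_map_iff hp0 hq).1 h.integrable_log_density) hlog,
    integral_densityLaw hpm hp0 (fun x => Real.log (p x)), entropy]
  ring

theorem measurePreserving_sample (hp0 : ∀ x, 0 ≤ p x) (h : IsNearUniform (pushDensity p f) L c)
    (N : ℕ) : MeasurePreserving (fun (x : Fin N → Fin d → ℝ) i => f.map (x i)) (sampleLaw p N)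
      (Measure.pi fun _ => densityLaw (pushDensity p f)) := by
  have := h.isProbabilityMeasure
  exact measurePreserving_pi (fun _ => densityLaw p) (fun _ => densityLaw (pushDensity p f))
    fun _ => f.measurePreserving_map hp0

/-- The constant in the bound for the bias. -/
def biasConst (d : ℕ) (c : ℝ) : ℝ := 1 / (1 - c) * (1 / (1 - c)) ^ (1 / (d : ℝ))

variable {N k : ℕ}

theorem umTKL_bias (h : IsNearUniform (pushDensity p f) L c) (hd : 1 ≤ d) (hp0 : ∀ x, 0 ≤ p x)
    (hp1 : ∫⁻ x, ENNReal.ofReal (p x) = 1) (hpm : Measurable p)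
    (hlog : Integrable (fun x => Real.log (p x)) (densityLaw p)) (hk : 1 ≤ k) (hkN : k < N) :
    Integrable (umTKL k f) (sampleLaw p N) ∧
    |∫ x, umTKL k f x ∂(sampleLaw p N) - entropy p| ≤
      biasConst d c * ((k : ℝ) / N) ^ (1 / (d : ℝ)) * L ∧
    ∫ x, |umTKL k f x| ∂(sampleLaw p N) ≤ |-digamma k + digamma N - Real.log N| +
      (1 + IsNearUniform.sqLogBound k c +
        (c / (1 - c) + ∫ x, |Real.log (p x)| ∂(densityLaw p))) := by
  have hmp := measurePreserving_sample hp0 h N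
  have hJ := integrable_logJacobian h hp0 hlog
  have hm := measurable_correctedTKL hk hkN f.measurable_logJacobian
  have e : umTKL (N := N) k f = fun x => correctedTKL k f.logJacobian (fun i => f.map (x i)) :=
    funext fun x => f.umTKL_eq k x
  have hint := h.integrable_correctedTKL hd hk hkN hJ
  refine ⟨?_, ?_, ?_⟩
  · rw [e]
    exact hmp.integrable_comp_of_integrable hint
  · have h1 := h.abs_integral_correctedTKL_le hd hk hkN hJ
    rw [integral_logJacobian_sub h hp0 hpm hlog, ← hmp.map_eq,
      integral_map hmp.measurable.aemeasurable hm.aestronglyMeasurable] at h1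
    rw [e]
    refine h1.trans (le_of_eq ?_)
    rw [biasConst]
    ring
  · have h1 := h.integral_abs_correctedTKL_le hd hk hkN hJ
      (integral_abs_logJacobian_le h hp0 hp1 hlog)
    rw [← hmp.map_eq, integral_map hmp.measurable.aemeasurable
      hm.abs.aestronglyMeasurable] at h1
    rw [e]
    exact h1

/-- Bias–variance decomposition on the cube, pulled back along the measure-preserving sample map.
The variance constant depends on `c` but not on `L`, so it is the same for almost all training
samples. -/
theorem umTKL_mse (h : IsNearUniform (pushDensity p f) L c) (hd : 1 ≤ d) (hp0 : ∀ x, 0 ≤ p x)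
    (hp1 : ∫⁻ x, ENNReal.ofReal (p x) = 1) (hpm : Measurable p)
    (hlog : Integrable (fun x => Real.log (p x)) (densityLaw p))
    (hlog2 : Integrable (fun x => Real.log (p x) ^ 2) (densityLaw p)) (hk : 1 ≤ k) (hkN : k < N) :
    Integrable (fun x => (umTKL k f x - entropy p) ^ 2) (sampleLaw p N) ∧
    ∫ x, (umTKL k f x - entropy p) ^ 2 ∂(sampleLaw p N) ≤
      IsNearUniform.varianceBound d k c
        (2 * (c / (1 - c)) ^ 2 + 2 * ∫ x, Real.log (p x) ^ 2 ∂(densityLaw p)) * (1 / (N : ℝ)) +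
      (biasConst d c * ((k : ℝ) / N) ^ (1 / (d : ℝ)) * L) ^ 2 := by
  have := h.isProbabilityMeasure
  have hmp := measurePreserving_sample hp0 h N
  have hm := measurable_correctedTKL hk hkN f.measurable_logJacobian
  obtain ⟨hJ, hJ2⟩ := memLp_logJacobian h hp0 hp1 hpm hlog2
  have hL2 := h.memLp_correctedTKL hd hk hkN hJ
  have hvar := h.evariance_correctedTKL_le hd hk hkN f.measurable_logJacobian hJ hJ2
  have hbias := h.abs_integral_correctedTKL_le hd hk hkN (hJ.integrable one_le_two)
  rw [integral_logJacobian_sub h hp0 hpm hlog] at hbias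
  have hm0 : 0 ≤ ∫ x, Real.log (p x) ^ 2 ∂(densityLaw p) := integral_nonneg fun _ => sq_nonneg _
  have hvb : 0 ≤ IsNearUniform.varianceBound d k c
      (2 * (c / (1 - c)) ^ 2 + 2 * ∫ x, Real.log (p x) ^ 2 ∂(densityLaw p)) := by
    have := IsNearUniform.sqLogBound_nonneg k c
    have := IsNearUniform.sqLogBound_nonneg (k + 1) c
    unfold IsNearUniform.varianceBound
    positivity
  rw [← ofReal_variance hL2, ENNReal.ofReal_le_ofReal_iff (by positivity), variance_eq_sub hL2] at hvar
  have hsub : MemLp (fun z => correctedTKL k f.logJacobian z - entropy p) 2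
      (Measure.pi fun _ : Fin N => densityLaw (pushDensity p f)) := hL2.sub (memLp_const _)
  have hsq : ∫ z, (correctedTKL k f.logJacobian z - entropy p) ^ 2
      ∂(Measure.pi fun _ : Fin N => densityLaw (pushDensity p f)) =
      (∫ z, correctedTKL k f.logJacobian z ^ 2
        ∂(Measure.pi fun _ : Fin N => densityLaw (pushDensity p f)) -
      (∫ z, correctedTKL k f.logJacobian z
        ∂(Measure.pi fun _ : Fin N => densityLaw (pushDensity p f))) ^ 2) +
      (∫ z, correctedTKL k f.logJacobian z
        ∂(Measure.pi fun _ : Fin N => densityLaw (pushDensity p f)) - entropy p) ^ 2 := by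
    have h1 : ∀ z : Fin N → Fin d → ℝ, (correctedTKL k f.logJacobian z - entropy p) ^ 2 =
        correctedTKL k f.logJacobian z ^ 2 - 2 * entropy p * correctedTKL k f.logJacobian z
          + entropy p ^ 2 := fun z => by ring
    have i1 := hL2.integrable_sq
    have i2 := (hL2.integrable one_le_two).const_mul (2 * entropy p)
    have i3 : Integrable (fun z => correctedTKL k f.logJacobian z ^ 2 -
        2 * entropy p * correctedTKL k f.logJacobian z)
        (Measure.pi fun _ : Fin N => densityLaw (pushDensity p f)) := i1.sub i2
    simp_rw [h1]
    rw [integral_add i3 (integrable_const _), integral_sub i1 i2, integral_const_mul]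
    simp only [integral_const, probReal_univ, one_smul]
    ring
  have e : (fun x : Fin N → Fin d → ℝ => (umTKL k f x - entropy p) ^ 2) =
      fun x => (fun z => (correctedTKL k f.logJacobian z - entropy p) ^ 2) (fun i => f.map (x i)) :=
    funext fun x => by rw [f.umTKL_eq]
  refine ⟨?_, ?_⟩
  · rw [e]
    exact hmp.integrable_comp_of_integrable hsub.integrable_sq
  · have e2 := integral_map (μ := sampleLaw p N) hmp.measurable.aemeasurable
      (f := fun z => (correctedTKL k f.logJacobian z - entropy p) ^ 2)
      ((hm.sub measurable_const).pow_const 2).aestronglyMeasurable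
    rw [hmp.map_eq] at e2
    rw [e, ← e2, hsq]
    refine add_le_add (by simpa using hvar) ?_
    have hb : |∫ z, correctedTKL k f.logJacobian z
        ∂(Measure.pi fun _ : Fin N => densityLaw (pushDensity p f)) - entropy p| ≤
        biasConst d c * ((k : ℝ) / N) ^ (1 / (d : ℝ)) * L := by
      refine hbias.trans (le_of_eq ?_)
      rw [biasConst]
      ring
    exact sq_le_sq' (abs_le.1 hb).1 (abs_le.1 hb).2

end CubeMap

/-! ### Joint measurability in training sample and sample -/

section JointMeasurability

variable {d : ℕ} {Ω : Type*} [MeasurableSpace Ω]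

/-- Directional derivatives are pointwise limits of jointly measurable difference quotients, and the
determinant is a polynomial in them. -/
theorem measurable_fderiv_det_of_jointly {F : Ω → (Fin d → ℝ) → (Fin d → ℝ)}
    (hF : Measurable fun q : Ω × (Fin d → ℝ) => F q.1 q.2) (hd : ∀ ω, Differentiable ℝ (F ω)) :
    Measurable fun q : Ω × (Fin d → ℝ) => (fderiv ℝ (F q.1) q.2).det := by
  have hdir : ∀ v, Measurable fun q : Ω × (Fin d → ℝ) => fderiv ℝ (F q.1) q.2 v := by
    intro v
    refine measurable_of_tendsto_metrizable (f := fun (n : ℕ) (q : Ω × (Fin d → ℝ)) =>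
      (n : ℝ) • (F q.1 (q.2 + (n : ℝ)⁻¹ • v) - F q.1 q.2)) (fun n => ?_) ?_
    · have h1 : Measurable fun q : Ω × (Fin d → ℝ) => F q.1 (q.2 + (n : ℝ)⁻¹ • v) :=
        hF.comp (measurable_fst.prodMk (measurable_snd.add_const _))
      have h2 := h1.sub hF
      exact h2.const_smul (n : ℝ)
    · rw [tendsto_pi_nhds]
      intro q
      refine (hd q.1 q.2).hasFDerivAt.lim v ?_
      simp only [Real.norm_natCast]
      exact tendsto_natCast_atTop_atTop
  have hdet : ∀ A : (Fin d → ℝ) →L[ℝ] (Fin d → ℝ),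
      A.det = (Matrix.of fun i j => A (Pi.single j 1) i).det := by
    intro A
    rw [ContinuousLinearMap.det, ← LinearMap.det_toMatrix']
    congr 1
  simp_rw [hdet, Matrix.det_apply', Matrix.of_apply]
  refine Finset.measurable_sum _ fun σ _ => measurable_const.mul ?_
  refine Finset.measurable_prod _ fun i _ => ?_
  exact (measurable_pi_apply _).comp (hdir _)

/-- Only `f` is assumed jointly measurable, not `f⁻¹`; so the correction is expressed through the
Jacobian of `f`. -/
theorem measurable_umTKL {N k : ℕ} (hk : 1 ≤ k) (hkN : k < N) {f : Ω → CubeMap d}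
    (hf : Measurable fun q : Ω × (Fin d → ℝ) => (f q.1).map q.2) :
    Measurable fun q : Ω × (Fin N → Fin d → ℝ) => umTKL k (f q.1) q.2 := by
  have hev : ∀ i, Measurable fun q : Ω × (Fin N → Fin d → ℝ) => (q.1, q.2 i) := fun i => by fun_prop
  have h1 : Measurable fun q : Ω × (Fin N → Fin d → ℝ) => fun i => (f q.1).map (q.2 i) :=
    measurable_pi_iff.2 fun i => hf.comp (hev i)
  have h2 : ∀ i, Measurable fun q : Ω × (Fin N → Fin d → ℝ) =>
      (fderiv ℝ (f q.1).map (q.2 i)).det := fun i =>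
    (measurable_fderiv_det_of_jointly hf fun ω => (f ω).differentiable_map).comp (hev i)
  have e : (fun q : Ω × (Fin N → Fin d → ℝ) => umTKL k (f q.1) q.2) = fun q =>
      tKL k (fun i => (f q.1).map (q.2 i)) +
        (1 / (N : ℝ)) * ∑ i, -Real.log |(fderiv ℝ (f q.1).map (q.2 i)).det| := by
    funext q
    simp only [← CubeMap.logJacobian_map]
    rfl
  rw [e]
  refine ((measurable_tKL hk hkN).comp h1).add (measurable_const.mul ?_)
  refine Finset.measurable_sum _ fun i _ => ?_
  have := h2 i
  fun_prop

end JointMeasurability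

/-! ### The mean of the truncated gradient bound -/

section TruncatedMean

variable {d : ℕ} {p : (Fin d → ℝ) → ℝ} {UM : ∀ N : ℕ, (Fin N → Fin d → ℝ) → CubeMap d} {M : ℕ}
  {Cbar : ℝ}

/-- The (lower) mean of `min C₂^N 1` over the training samples. -/
def meanGradSup (p : (Fin d → ℝ) → ℝ) (UM : ∀ N : ℕ, (Fin N → Fin d → ℝ) → CubeMap d)
    (N : ℕ) : ℝ≥0∞ :=
  ∫⁻ S, min (gradSup (pushDensity p (UM N S))) 1 ∂(sampleLaw p N)

theorem isProbabilityMeasure_sampleLaw (hp1 : ∫⁻ x, ENNReal.ofReal (p x) = 1) (N : ℕ) :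
    IsProbabilityMeasure (sampleLaw p N) := by
  have := isProbabilityMeasure_densityLaw hp1
  unfold sampleLaw
  infer_instance

theorem meanGradSup_le_one (hp1 : ∫⁻ x, ENNReal.ofReal (p x) = 1) (N : ℕ) :
    meanGradSup p UM N ≤ 1 := by
  have := isProbabilityMeasure_sampleLaw hp1 N
  refine (lintegral_mono fun S => min_le_right _ _).trans ?_
  simp

theorem tendsto_meanGradSup (hp1 : ∫⁻ x, ENNReal.ofReal (p x) = 1)
    (hUM : UMAssumption p UM M Cbar) : Tendsto (meanGradSup p UM) atTop (𝓝 0) := by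
  rw [ENNReal.tendsto_nhds_zero]
  intro ε hε
  have hε2 : 0 < ε / 2 := ENNReal.half_pos hε.ne'
  filter_upwards [ENNReal.tendsto_nhds_zero.1 (hUM.tendsto_inProbability (ε / 2) hε2) (ε / 2) hε2]
    with N hN
  have := isProbabilityMeasure_sampleLaw hp1 N
  -- The exceptional set need not be measurable, so its measurable hull of equal measure is used.
  -- Off the hull the integrand is below `ε / 2`, on it at most `1`.
  set A := toMeasurable (sampleLaw p N) {S | ε / 2 ≤ gradSup (pushDensity p (UM N S))} with hA
  calc meanGradSup p UM N ≤ ∫⁻ S, (ε / 2 + A.indicator 1 S) ∂(sampleLaw p N) := by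
        refine lintegral_mono fun S => ?_
        by_cases hS : S ∈ A
        · rw [Set.indicator_of_mem hS]
          exact (min_le_right _ _).trans le_add_self
        · have h1 : ¬ ε / 2 ≤ gradSup (pushDensity p (UM N S)) := fun h =>
            hS (subset_toMeasurable _ _ h)
          exact (min_le_left _ _).trans ((not_le.1 h1).le.trans le_self_add)
    _ = ε / 2 + sampleLaw p N {S | ε / 2 ≤ gradSup (pushDensity p (UM N S))} := by
        rw [lintegral_add_left measurable_const,
          lintegral_indicator_one (measurableSet_toMeasurable _ _), measure_toMeasurable]
        simp
    _ ≤ ε / 2 + ε / 2 := by gcongr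
    _ = ε := ENNReal.add_halves ε

theorem tendsto_toReal_meanGradSup (hp1 : ∫⁻ x, ENNReal.ofReal (p x) = 1)
    (hUM : UMAssumption p UM M Cbar) :
    Tendsto (fun N => (meanGradSup p UM N).toReal) atTop (𝓝 0) :=
  (ENNReal.tendsto_toReal ENNReal.zero_ne_top).comp (tendsto_meanGradSup hp1 hUM)

/-- For `N > M` the truncation at `1` is almost surely inactive; it is there to keep `meanGradSup`
finite for every `N`. -/
theorem UMAssumption.ae_isNearUniform (hp0 : ∀ x, 0 ≤ p x)
    (hp1 : ∫⁻ x, ENNReal.ofReal (p x) = 1) (hp : Differentiable ℝ p)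
    (hUM : UMAssumption p UM M Cbar) {N : ℕ} (hN : M < N) : ∀ᵐ S ∂(sampleLaw p N),
      IsNearUniform (pushDensity p (UM N S)) (gradSup (pushDensity p (UM N S))).toReal Cbar ∧
      ENNReal.ofReal (gradSup (pushDensity p (UM N S))).toReal ≤
        min (gradSup (pushDensity p (UM N S))) 1 := by
  filter_upwards [hUM.ae_le N hN] with S hS
  refine ⟨(UM N S).isNearUniform hp0 hp1 hp hUM.Cbar_pos.le hUM.Cbar_lt_one hS, ?_⟩
  rw [ENNReal.ofReal_toReal (hS.trans_lt ENNReal.ofReal_lt_top).ne]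
  refine le_min le_rfl (hS.trans ?_)
  rw [ENNReal.ofReal_le_one]
  exact hUM.Cbar_lt_one.le

end TruncatedMean

/-! ### Integrating conditional bounds over the training sample -/

section ProductIntegral

variable {α β : Type*} [MeasurableSpace α] [MeasurableSpace β] {μ : Measure α} {ν : Measure β}
  [IsProbabilityMeasure μ] [IsProbabilityMeasure ν]

theorem integrable_prod_of_le {F : α × β → ℝ} (hF : Measurable F) {a : ℝ}
    (h : ∀ᵐ x ∂μ, Integrable (fun y => F (x, y)) ν ∧ ∫ y, |F (x, y)| ∂ν ≤ a) :
    Integrable F (μ.prod ν) := by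
  rw [integrable_prod_iff hF.aestronglyMeasurable]
  refine ⟨h.mono fun x hx => hx.1, Integrable.of_bound
    hF.stronglyMeasurable.norm.integral_prod_right'.aestronglyMeasurable a ?_⟩
  filter_upwards [h] with x hx
  rw [Real.norm_eq_abs, abs_of_nonneg (integral_nonneg fun _ => norm_nonneg _)]
  exact hx.2

/-- `g` carries no measurability assumption: monotonicity, adding a constant and scaling by a finite
constant remain valid for the lower integral. -/
theorem integral_le_of_ofReal_le {f : α → ℝ} (hf : Integrable f μ) {a b : ℝ}
    (ha : 0 ≤ a) (hb : 0 ≤ b) {g : α → ℝ≥0∞} (hg : ∫⁻ x, g x ∂μ ≠ ∞)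
    (h : ∀ᵐ x ∂μ, ENNReal.ofReal (f x) ≤ ENNReal.ofReal a + ENNReal.ofReal b * g x) :
    ∫ x, f x ∂μ ≤ a + b * (∫⁻ x, g x ∂μ).toReal := by
  have h1 : ENNReal.ofReal (∫ x, f x ∂μ) ≤ ENNReal.ofReal a + ENNReal.ofReal b * ∫⁻ x, g x ∂μ := by
    calc _ ≤ ENNReal.ofReal (∫ x, max (f x) 0 ∂μ) :=
          ENNReal.ofReal_le_ofReal (integral_mono hf hf.pos_part fun x => le_max_left _ _)
      _ = ∫⁻ x, ENNReal.ofReal (f x) ∂μ := by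
          rw [ofReal_integral_eq_lintegral_ofReal hf.pos_part (ae_of_all _ fun x => le_max_right _ _)]
          refine lintegral_congr fun x => ?_
          rw [ENNReal.ofReal_max, ENNReal.ofReal_zero, max_eq_left zero_le]
      _ ≤ ∫⁻ x, (ENNReal.ofReal a + ENNReal.ofReal b * g x) ∂μ := lintegral_mono_ae h
      _ = _ := by
          rw [lintegral_add_left measurable_const, lintegral_const_mul' _ _ ENNReal.ofReal_ne_top]
          simp
  rw [← ENNReal.ofReal_toReal hg, ← ENNReal.ofReal_mul hb, ← ENNReal.ofReal_add ha (by positivity),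
    ENNReal.ofReal_le_ofReal_iff (by positivity)] at h1
  exact h1

end ProductIntegral

end

/-! ### The theorem: averaging over the training sample -/

theorem corollary2 (d : ℕ) (hd : 1 ≤ d)
    -- the differentiable density of `X`, with finite entropy
    (p : (Fin d → ℝ) → ℝ) (hp_nonneg : ∀ x, 0 ≤ p x)
    (hp_prob : ∫⁻ x, ENNReal.ofReal (p x) = 1)
    (hp_diff : Differentiable ℝ p)
    (hp_ent : Integrable (fun x => p x * Real.log (p x)))
    -- the uniformizing map constructed from a training sample, jointly measurable
    (UM : ∀ N : ℕ, (Fin N → Fin d → ℝ) → CubeMap d)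
    (hUM_meas : ∀ N : ℕ, Measurable
      (fun q : (Fin N → Fin d → ℝ) × (Fin d → ℝ) => (UM N q.1).map q.2))
    (M : ℕ) (Cbar : ℝ) (hUM : UMAssumption p UM M Cbar) :
    ∃ C D : ℕ → ℝ, Tendsto C atTop (𝓝 0) ∧ Tendsto D atTop (𝓝 0) ∧
      ∀ k : ℕ, 1 ≤ k →
        -- bias
        (∀ N : ℕ, M < N → k < N →
          Integrable (fun q : (Fin N → Fin d → ℝ) × (Fin N → Fin d → ℝ) =>
              umTKL k (UM N q.1) q.2) ((sampleLaw p N).prod (sampleLaw p N)) ∧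
          |(∫ q : (Fin N → Fin d → ℝ) × (Fin N → Fin d → ℝ), umTKL k (UM N q.1) q.2
              ∂((sampleLaw p N).prod (sampleLaw p N))) - entropy p|
            ≤ C N * ((k : ℝ) / N) ^ (1 / (d : ℝ))) ∧
        -- mean square error
        (Integrable (fun x => p x * Real.log (p x) ^ 2) →
          ∃ C₁ : ℝ, 0 < C₁ ∧ ∀ N : ℕ, M < N → k < N →
            Integrable (fun q : (Fin N → Fin d → ℝ) × (Fin N → Fin d → ℝ) =>
                (umTKL k (UM N q.1) q.2 - entropy p) ^ 2)
              ((sampleLaw p N).prod (sampleLaw p N)) ∧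
            (∫ q : (Fin N → Fin d → ℝ) × (Fin N → Fin d → ℝ),
                (umTKL k (UM N q.1) q.2 - entropy p) ^ 2
                ∂((sampleLaw p N).prod (sampleLaw p N)))
              ≤ C₁ * (1 / (N : ℝ)) + D N * ((k : ℝ) / N) ^ (2 / (d : ℝ))) := by
  have hpm : Measurable p := hp_diff.continuous.measurable
  have hlog : Integrable (fun x => Real.log (p x)) (densityLaw p) :=
    (integrable_densityLaw_iff hpm hp_nonneg _).2 hp_ent
  have hprob : ∀ N, IsProbabilityMeasure (sampleLaw p N) :=
    isProbabilityMeasure_sampleLaw hp_prob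
  have hc : 0 < 1 - Cbar := by linarith [hUM.Cbar_lt_one]
  have hK : 0 ≤ CubeMap.biasConst d Cbar := by
    unfold CubeMap.biasConst
    positivity
  have hlim := tendsto_toReal_meanGradSup hp_prob hUM
  have hfin : ∀ N, meanGradSup p UM N ≠ ∞ := fun N =>
    ((meanGradSup_le_one hp_prob N).trans_lt ENNReal.one_lt_top).ne
  -- Given `S`, the bias is at most `biasConst * (k/N)^(1/d) * L`; averaging replaces `L` by the
  -- mean of `min C₂^N 1`. `D` uses the same mean, not that of a square, at the price of `L² ≤ L`.
  refine ⟨fun N => CubeMap.biasConst d Cbar * (meanGradSup p UM N).toReal,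
    fun N => CubeMap.biasConst d Cbar ^ 2 * (meanGradSup p UM N).toReal,
    by simpa using hlim.const_mul _, by simpa using hlim.const_mul _, fun k hk => ⟨?_, ?_⟩⟩
  · intro N hMN hkN
    have hm := measurable_umTKL hk hkN (hUM_meas N)
    have hae := hUM.ae_isNearUniform hp_nonneg hp_prob hp_diff hMN
    have hr : 0 ≤ ((k : ℝ) / N) ^ (1 / (d : ℝ)) := by positivity
    have hint : Integrable (fun q : (Fin N → Fin d → ℝ) × (Fin N → Fin d → ℝ) =>
        umTKL k (UM N q.1) q.2) ((sampleLaw p N).prod (sampleLaw p N)) := by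
      refine integrable_prod_of_le (a := |-digamma k + digamma N - Real.log N| +
        (1 + IsNearUniform.sqLogBound k Cbar +
          (Cbar / (1 - Cbar) + ∫ x, |Real.log (p x)| ∂(densityLaw p)))) hm ?_
      filter_upwards [hae] with S hS
      have h1 := CubeMap.umTKL_bias hS.1 hd hp_nonneg hp_prob hpm hlog hk hkN
      exact ⟨h1.1, h1.2.2⟩
    refine ⟨hint, ?_⟩
    have hbias : ∀ᵐ S ∂(sampleLaw p N), ENNReal.ofReal
        |∫ x, umTKL k (UM N S) x ∂(sampleLaw p N) - entropy p| ≤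
        ENNReal.ofReal (CubeMap.biasConst d Cbar * ((k : ℝ) / N) ^ (1 / (d : ℝ))) *
          min (gradSup (pushDensity p (UM N S))) 1 := by
      filter_upwards [hae] with S hS
      have h1 := (CubeMap.umTKL_bias hS.1 hd hp_nonneg hp_prob hpm hlog hk hkN).2.1
      refine (ENNReal.ofReal_le_ofReal h1).trans ?_
      rw [ENNReal.ofReal_mul (by positivity)]
      gcongr
      exact hS.2
    have e1 : (∫ q : (Fin N → Fin d → ℝ) × (Fin N → Fin d → ℝ), umTKL k (UM N q.1) q.2
        ∂((sampleLaw p N).prod (sampleLaw p N))) - entropy p =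
        ∫ S, (∫ x, umTKL k (UM N S) x ∂(sampleLaw p N) - entropy p) ∂(sampleLaw p N) := by
      rw [integral_prod _ hint, integral_sub hint.integral_prod_left (integrable_const _)]
      simp
    rw [e1]
    refine abs_integral_le_integral_abs.trans ?_
    have hi : Integrable (fun S => |∫ x, umTKL k (UM N S) x ∂(sampleLaw p N) - entropy p|)
        (sampleLaw p N) := (hint.integral_prod_left.sub (integrable_const _)).abs
    have h2 := integral_le_of_ofReal_le (a := 0)
      (b := CubeMap.biasConst d Cbar * ((k : ℝ) / N) ^ (1 / (d : ℝ))) hi le_rfl (by positivity)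
      (hfin N) (hbias.mono fun S hS => by rwa [ENNReal.ofReal_zero, zero_add])
    refine h2.trans (le_of_eq ?_)
    simp only [meanGradSup]
    ring
  · intro hent2
    have hlog2 : Integrable (fun x => Real.log (p x) ^ 2) (densityLaw p) :=
      (integrable_densityLaw_iff hpm hp_nonneg _).2 hent2
    set V := IsNearUniform.varianceBound d k Cbar (2 * (Cbar / (1 - Cbar)) ^ 2 +
      2 * ∫ x, Real.log (p x) ^ 2 ∂(densityLaw p)) with hV
    refine ⟨max V 1, lt_max_of_lt_right one_pos, fun N hMN hkN => ?_⟩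
    have hm := (measurable_umTKL hk hkN (hUM_meas N)).sub_const (entropy p) |>.pow_const 2
    have hae := hUM.ae_isNearUniform hp_nonneg hp_prob hp_diff hMN
    have hr : 0 ≤ ((k : ℝ) / N) ^ (1 / (d : ℝ)) := by positivity
    have hr2 : ((k : ℝ) / N) ^ (2 / (d : ℝ)) = (((k : ℝ) / N) ^ (1 / (d : ℝ))) ^ 2 := by
      rw [← Real.rpow_natCast, ← Real.rpow_mul (by positivity)]
      congr 1
      push_cast
      ring
    have hVN : V * (1 / (N : ℝ)) ≤ max V 1 * (1 / (N : ℝ)) :=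
      mul_le_mul_of_nonneg_right (le_max_left _ _) (by positivity)
    have hmse : ∀ᵐ S ∂(sampleLaw p N),
        Integrable (fun x => (umTKL k (UM N S) x - entropy p) ^ 2) (sampleLaw p N) ∧
        ∫ x, (umTKL k (UM N S) x - entropy p) ^ 2 ∂(sampleLaw p N) ≤ max V 1 * (1 / (N : ℝ)) +
          CubeMap.biasConst d Cbar ^ 2 * ((k : ℝ) / N) ^ (2 / (d : ℝ)) *
            (gradSup (pushDensity p (UM N S))).toReal := by
      filter_upwards [hae] with S hS
      have h1 := CubeMap.umTKL_mse hS.1 hd hp_nonneg hp_prob hpm hlog hlog2 hk hkN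
      refine ⟨h1.1, h1.2.trans (add_le_add hVN ?_)⟩
      rw [mul_pow, mul_pow, hr2]
      gcongr
      have hL0 := hS.1.nonneg
      have hL1 := hS.1.le.trans hS.1.lt_one.le
      -- This is `L² ≤ L`, from `0 ≤ L ≤ 1`.
      nlinarith
    have hint : Integrable (fun q : (Fin N → Fin d → ℝ) × (Fin N → Fin d → ℝ) =>
        (umTKL k (UM N q.1) q.2 - entropy p) ^ 2) ((sampleLaw p N).prod (sampleLaw p N)) := by
      refine integrable_prod_of_le (a := max V 1 * (1 / (N : ℝ)) +
          CubeMap.biasConst d Cbar ^ 2 * ((k : ℝ) / N) ^ (2 / (d : ℝ)) * 1) hm ?_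
      filter_upwards [hmse, hae] with S hS hS'
      refine ⟨hS.1, ?_⟩
      simp only [abs_sq]
      refine hS.2.trans ?_
      gcongr
      exact hS'.1.le.trans hS'.1.lt_one.le
    refine ⟨hint, ?_⟩
    rw [integral_prod _ hint]
    have h2 := integral_le_of_ofReal_le (a := max V 1 * (1 / (N : ℝ)))
      (b := CubeMap.biasConst d Cbar ^ 2 * ((k : ℝ) / N) ^ (2 / (d : ℝ)))
      hint.integral_prod_left (by positivity) (by positivity) (hfin N) ?_
    · refine h2.trans (le_of_eq ?_)
      simp only [meanGradSup]
      ring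
    · filter_upwards [hmse, hae] with S hS hS'
      refine (ENNReal.ofReal_le_ofReal hS.2).trans ?_
      rw [ENNReal.ofReal_add (by positivity) (by positivity),
        ENNReal.ofReal_mul (p := _ * _) (by positivity)]
      gcongr
      exact hS'.2
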